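/- Let $F=(f,g_1,g_2)\colon\mathbb R\times\mathbb R^2\to\mathbb R\times\mathbb R^2$ be a $C^\infty$ vector field in the coordinates $(x,y)=(x,y_1,y_2)$, and assume: (i) $F(0,y)=0$ for all $y\in\mathbb R^2$; (ii) $\partial_x f(0)=0$; (iii) $\partial_{y_1}\partial_x f(0)>0$ and $\partial_{y_2}\partial_x f(0)=0$; (iv) $\partial_x g_1(0)=0$; (v) $\kappa:=\partial_{y_1}\partial_x f(0)\,\partial_{y_2}\partial_x g_1(0)+\partial_{y_2}^2\partial_x f(0)\,\partial_x g_2(0)\neq 0$; (vi) $\partial_x g_2(0)>0$. Put $a=\operatorname{sign}\kappa\in\{-1,+1\}$. A point $(0,y)$ with $\partial_xf(0,y)=0$ is called transcritical. Then for every $N\in\mathbb N$ and every neighbourhood $O$ of the origin there is an open neighbourhood $U\subseteq O$ of the origin with the following properties. (1) On $U$ the vector field $F$ is flow-equivalent to the cusp normal form $$\dot z_0=0,\qquad \dot z_1=0,\qquad \dot z_2=a z_2^3+z_1z_2+z_0+r(z),\qquad r(z)=\mathcal O(z_2^N),$$ on an open neighbourhood $V$ of the origin: there are a $C^\infty$ function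 $r$ on $V$ with $|r(z)|\le C|z_2|^N$ on $V$ for a constant $C$, and a $C^\infty$ diffeomorphism $U\to V$ fixing the origin which transforms $F$ into the normal form up to a positive $C^\infty$ factor (so it maps trajectories to trajectories and preserves the direction of time). (2) If $a=-1$, the forward trajectory of every point of $U$ stays in $U$ and converges to an equilibrium $(0,y)\in U$. If $a=+1$, the same holds for backward trajectories. (3) The transcritical points in $U$ form a smooth curve $\gamma=\{(0,\vartheta(s),s):\alpha<s<\beta\}$ with $\alpha<0<\beta$ and $\vartheta(0)=0$. Let $\gamma_1$ ($s>0$) and $\gamma_2$ ($s<0$) be the two components of $\gamma\setminus\{0\}$. For $j=1,2$ let $W_j$ be the unstable (if $a=-1$) or stable (if $a=+1$) set of $\gamma_j$ in $U$, i.e. the set of points of $U$ the backward (respectively forward) trajectory of which stays in $U$ and converges to a point of $\gamma_j$. Then $W_j$ is a smooth embedded surface with boundary $\gamma_j$; $W_j\setminus\gamma_j$ consists of heteroclinic orbits between points of $\gamma_j$ and other equilibria, every point of $\gamma_j$ is an end point of such an orbit, and $W_1\setminus\gamma_1$, $W_2\setminus\gamma_2$ lie on opposite sides of the plane $\{x=0\}$.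 Let $\sigma_j$ be the set of limits of the trajectories of the points of $W_j\setminus\gamma_j$ in forward time (if $a=-1$) or backward time (if $a=+1$). Then $\sigma_1\cup\{0\}\cup\sigma_2$ is a smooth curve $\{(0,\theta(s),s):\alpha'<s<\beta'\}$ with $\alpha'<0<\beta'$ and $\theta(0)=0$, where $\sigma_1$ is the part $s<0$ and $\sigma_2$ the part $s>0$, and it is tangent to $\gamma$ at the origin, $\theta'(0)=\vartheta'(0)$. -/

import Mathlib

open Set Filter
open scoped ContDiff Topology

namespace DriftSing

/-- Phase space `ℝ³` with coordinates `(x, y₁, y₂)`, also used for `(z₀, z₁, z₂)`. -/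
abbrev R3 : Type := ℝ × ℝ × ℝ

/-- Partial derivative with respect to the first coordinate `x`. -/
noncomputable def dx (u : R3 → ℝ) : R3 → ℝ := fun p => deriv (fun t => u (t, p.2.1, p.2.2)) p.1

/-- Partial derivative with respect to the second coordinate `y₁`. -/
noncomputable def dy₁ (u : R3 → ℝ) : R3 → ℝ := fun p => deriv (fun t => u (p.1, t, p.2.2)) p.2.1

/-- Partial derivative with respect to the third coordinate `y₂`. -/
noncomputable def dy₂ (u : R3 → ℝ) : R3 → ℝ := fun p => deriv (fun t => u (p.1, p.2.1, t)) p.2.2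

/-- The vector field `F = (f, g₁, g₂)`. -/
def field (f g₁ g₂ : R3 → ℝ) : R3 → R3 := fun p => (f p, g₁ p, g₂ p)

/-- The quantity `∂_{y₁}∂_x f(0) ∂_{y₂}∂_x g₁(0) + ∂_{y₂}²∂_x f(0) ∂_x g₂(0)`,
the sign of which is the sign of the cubic term. -/
noncomputable def kappa (f g₁ g₂ : R3 → ℝ) : ℝ :=
  dy₁ (dx f) 0 * dy₂ (dx g₁) 0 + dy₂ (dy₂ (dx f)) 0 * dx g₂ 0

/-- The vector field `F` on `U` is smoothly flow-equivalent to `G` on `V`, with base point `0`: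
a smooth diffeomorphism `U → V` fixing the origin maps trajectories to trajectories and preserves
the direction of time, that is, it transforms `F` into `G` up to a smooth positive factor. -/
def FlowEquivalentOn (F : R3 → R3) (U : Set R3) (G : R3 → R3) (V : Set R3) : Prop :=
  ∃ H : OpenPartialHomeomorph R3 R3, H.source = U ∧ H.target = V ∧ H 0 = 0 ∧
    ContDiffOn ℝ ∞ H U ∧ ContDiffOn ℝ ∞ H.symm V ∧
    ∃ μ : R3 → ℝ, ContDiffOn ℝ ∞ μ U ∧ (∀ p ∈ U, 0 < μ p) ∧
      ∀ p ∈ U, fderiv ℝ H p (F p) = μ p • G (H p)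

/-- The cusp family `ż₂ = a z₂³ + z₁ z₂ + z₀ + r(z)`, with parameters `ż₀ = ż₁ = 0`. -/
def cuspField (a : ℝ) (r : R3 → ℝ) : R3 → R3 :=
  fun z => (0, 0, a * z.2.2 ^ 3 + z.2.1 * z.2.2 + z.1 + r z)

/-- The forward trajectory of `F` through `p` stays in `U` and converges to `q`.
(The fields considered are smooth, so the trajectory is unique.) -/
def ConvergesForward (F : R3 → R3) (U : Set R3) (p q : R3) : Prop :=
  ∃ φ : ℝ → R3, φ 0 = p ∧ IsIntegralCurveOn φ (fun _ => F) (Ici 0) ∧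
    (∀ t ∈ Ici (0 : ℝ), φ t ∈ U) ∧ Tendsto φ atTop (𝓝 q)

/-- The backward trajectory of `F` through `p` stays in `U` and converges to `q`. -/
def ConvergesBackward (F : R3 → R3) (U : Set R3) (p q : R3) : Prop :=
  ∃ φ : ℝ → R3, φ 0 = p ∧ IsIntegralCurveOn φ (fun _ => F) (Iic 0) ∧
    (∀ t ∈ Iic (0 : ℝ), φ t ∈ U) ∧ Tendsto φ atBot (𝓝 q)

/-- The curve `{(0, ϑ(s), s) : s ∈ I}` in the plane `{x = 0}`. -/
def planeGraph (ϑ : ℝ → ℝ) (I : Set ℝ) : Set R3 := (fun s => ((0, ϑ s, s) : R3)) '' I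

/-- `S` is a smooth embedded surface in `ℝ³` with boundary `B ⊆ S`. -/
def IsSmoothSurfaceWithBoundary (S B : Set R3) : Prop :=
  B ⊆ S ∧
  (∀ p ∈ S \ B, ∃ O : Set R3, IsOpen O ∧ p ∈ O ∧ ∃ Ψ : R3 → ℝ, ContDiffOn ℝ ∞ Ψ O ∧
    fderiv ℝ Ψ p ≠ 0 ∧ S ∩ O = {q ∈ O | Ψ q = 0}) ∧
  (∀ p ∈ B, ∃ O : Set R3, IsOpen O ∧ p ∈ O ∧ ∃ Ψ χ : R3 → ℝ,
    ContDiffOn ℝ ∞ Ψ O ∧ ContDiffOn ℝ ∞ χ O ∧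
    LinearIndependent ℝ ![fderiv ℝ Ψ p, fderiv ℝ χ p] ∧
    S ∩ O = {q ∈ O | Ψ q = 0 ∧ 0 ≤ χ q} ∧ B ∩ O = {q ∈ O | Ψ q = 0 ∧ χ q = 0})

/-- The points of `U` that `rel` connects to a point of `γ`: the unstable set of `γ` in `U` if
`rel` is backward convergence, the stable set if `rel` is forward convergence. -/
def limitSet (rel : R3 → R3 → Prop) (U γ : Set R3) : Set R3 := {p ∈ U | ∃ q ∈ γ, rel p q}

/-- The end points, in the time direction of `rel`, of the trajectories through points of `W`. -/
def targets (rel : R3 → R3 → Prop) (W : Set R3) : Set R3 := {q | ∃ p ∈ W, rel p q}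

/-- All points of `W` lie on heteroclinic orbits joining a point of `γ` to a different point
of `σ`, and every point of `γ` is an end point of such an orbit. -/
def IsHeteroclinicFamily (src tgt : R3 → R3 → Prop) (W γ σ : Set R3) : Prop :=
  (∀ p ∈ W, ∃ q ∈ γ, ∃ q' ∈ σ, q ≠ q' ∧ src p q ∧ tgt p q') ∧ ∀ q ∈ γ, ∃ p ∈ W, src p q

/-- The local dynamics in `U` near a plane `{x = 0}` of equilibria with set `T` of
transcritical points, for the two relations `src` and `tgt` of convergence in opposite
directions of time.

All trajectories converge to an equilibrium in the direction `tgt`. The transcritical points in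
`U` form a curve through `0` with branches `γ₁`, `γ₂`. The sets `W₁`, `W₂` of points
converging to them in the direction `src` are surfaces of heteroclinic orbits (with boundary
`γ₁`, `γ₂`) on opposite sides of the plane, and the targets of these orbits are the two branches
`σ₁`, `σ₂` of a curve through `0` which is tangent there to the curve of transcritical points. -/
def LocalDynamics (U T : Set R3) (src tgt : R3 → R3 → Prop) : Prop :=
  (∀ p ∈ U, ∃ y₁ y₂ : ℝ, (0, y₁, y₂) ∈ U ∧ tgt p (0, y₁, y₂)) ∧
  ∃ (ϑ θ : ℝ → ℝ) (α β α' β' : ℝ) (γ₁ γ₂ W₁ W₂ σ₁ σ₂ : Set R3),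
    α < 0 ∧ 0 < β ∧ ContDiffOn ℝ ∞ ϑ (Ioo α β) ∧ ϑ 0 = 0 ∧
    T ∩ U = planeGraph ϑ (Ioo α β) ∧
    γ₁ = planeGraph ϑ (Ioo 0 β) ∧ γ₂ = planeGraph ϑ (Ioo α 0) ∧
    W₁ = limitSet src U γ₁ ∧ W₂ = limitSet src U γ₂ ∧
    IsSmoothSurfaceWithBoundary W₁ γ₁ ∧ IsSmoothSurfaceWithBoundary W₂ γ₂ ∧
    IsHeteroclinicFamily src tgt (W₁ \ γ₁) γ₁ σ₁ ∧
    IsHeteroclinicFamily src tgt (W₂ \ γ₂) γ₂ σ₂ ∧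
    (((∀ p ∈ W₁ \ γ₁, 0 < p.1) ∧ ∀ p ∈ W₂ \ γ₂, p.1 < 0) ∨
      ((∀ p ∈ W₁ \ γ₁, p.1 < 0) ∧ ∀ p ∈ W₂ \ γ₂, 0 < p.1)) ∧
    σ₁ = targets tgt (W₁ \ γ₁) ∧ σ₂ = targets tgt (W₂ \ γ₂) ∧
    α' < 0 ∧ 0 < β' ∧ ContDiffOn ℝ ∞ θ (Ioo α' β') ∧ θ 0 = 0 ∧
    σ₁ = planeGraph θ (Ioo α' 0) ∧ σ₂ = planeGraph θ (Ioo 0 β') ∧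
    σ₁ ∪ {0} ∪ σ₂ = planeGraph θ (Ioo α' β') ∧
    deriv θ 0 = deriv ϑ 0

end DriftSing

/-!
Since `F` vanishes on the plane `x = 0`, it is `F = x • G` with a smooth field `G`, and
`G 0 = (0, 0, ∂ₓg₂(0)) ≠ 0`. In flow box coordinates `w = (u₀, u₁, τ)` of `G` the field `F` becomes
`X ∂_τ`, where `X w` is the coordinate `x` of the point `w`. The hypotheses say that
`X = X_τ = X_ττ = 0` at `0`, that `X_τττ(0) = ∂ₓg₂(0) κ ≠ 0`, and that the parameters `u` unfold
this cusp versally.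

For the normal form, divide `t ↦ X (u, s + t)` by the generic cubic `a t³ + z₁ t + z₀` with a
remainder of high order in `t`. The implicit function theorem yields `s`, `z₀`, `z₁` as functions of
`u` that annihilate the three coefficients of the polynomial part of the remainder. The quotient is
positive; dividing `X` by it leaves the cusp and a remainder of high order.

For the dynamics, time reversal `F ↦ -F` reduces to `κ < 0`. On each line `u = const` the field `X`
is scalar. The transcritical points are its double zeros, which form a curve `t ↦ (a t, b t, t)`.
The third zero `ρ t` on the line through a double zero is the target of its heteroclinic orbit. Both
curves are tangent to `∂_τ` at `0`, since the parameters `(a, b)` are stationary there.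
-/

namespace DriftSing

/-! ### Inverse and implicit functions -/

section InverseFunction

variable {E F G : Type*} [NormedAddCommGroup E] [NormedSpace ℝ E] [NormedAddCommGroup F]
  [NormedSpace ℝ F] [NormedAddCommGroup G] [NormedSpace ℝ G]

lemma isInvertible_of_ker_eq_bot [FiniteDimensional ℝ E] {T : E →L[ℝ] E}
    (hT : ∀ v, T v = 0 → v = 0) : T.IsInvertible :=
  ⟨(LinearEquiv.ofInjectiveEndo (T : E →ₗ[ℝ] E)
    ((injective_iff_map_eq_zero _).2 hT)).toContinuousLinearEquiv, by ext; rfl⟩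

lemma isOpen_setOf_isInvertible [CompleteSpace E] :
    IsOpen {T : E →L[ℝ] F | T.IsInvertible} :=
  ContinuousLinearEquiv.isOpen

lemma exists_openPartialHomeomorph_contDiffOn_symm [CompleteSpace E] {f : E → F}
    (hf : ContDiff ℝ ∞ f) {a : E} (ha : (fderiv ℝ f a).IsInvertible) :
    ∃ e : OpenPartialHomeomorph E F, a ∈ e.source ∧ ⇑e = f ∧ ContDiffOn ℝ ∞ e.symm e.target := by
  obtain ⟨L, hL⟩ := ha
  have hL' : HasFDerivAt f (L : E →L[ℝ] F) a :=
    hL ▸ (hf.differentiable (by simp) a).hasFDerivAt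
  have hopen : IsOpen {x | (fderiv ℝ f x).IsInvertible} :=
    isOpen_setOf_isInvertible.preimage (hf.continuous_fderiv (by simp))
  refine ⟨(hf.contDiffAt.toOpenPartialHomeomorph f hL' (by simp)).restrOpen _ hopen,
    ⟨hf.contDiffAt.mem_toOpenPartialHomeomorph_source hL' (by simp), L, hL⟩, rfl, fun y hy => ?_⟩
  obtain ⟨M, hM⟩ := (OpenPartialHomeomorph.map_target _ hy).2
  refine (OpenPartialHomeomorph.contDiffAt_symm _ (f₀' := M) hy ?_ hf.contDiffAt).contDiffWithinAt
  rw [hM]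
  exact (hf.differentiable (by simp) _).hasFDerivAt

lemma exists_contDiff_eventuallyEq [FiniteDimensional ℝ E] {f : E → F} {s : Set E} {a : E}
    (hs : s ∈ 𝓝 a) (hf : ContDiffOn ℝ ∞ f s) : ∃ g : E → F, ContDiff ℝ ∞ g ∧ g =ᶠ[𝓝 a] f := by
  obtain ⟨ε, hε, hεs⟩ := Metric.mem_nhds_iff.1 hs
  let b : ContDiffBump a := ⟨ε / 4, ε / 2, by positivity, by linarith⟩
  have hsupp : tsupport b ⊆ Metric.ball a ε := by
    rw [b.tsupport_eq]
    exact Metric.closedBall_subset_ball (half_lt_self hε)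
  refine ⟨fun x => b x • f x, contDiff_iff_contDiffAt.2 fun x => ?_,
    b.eventuallyEq_one.mono fun x hx => by simp [hx]⟩
  by_cases hx : x ∈ tsupport b
  · exact b.contDiffAt.smul
      (hf.contDiffAt (mem_of_superset (Metric.isOpen_ball.mem_nhds (hsupp hx)) hεs))
  · refine (contDiffAt_const (c := (0 : F))).congr_of_eventuallyEq ?_
    filter_upwards [notMem_tsupport_iff_eventuallyEq.1 hx] with y hy
    rw [hy, Pi.zero_apply, zero_smul]

lemma fderiv_apply_fderiv_of_eventually_eq_zero {Q : E × F → G} {ψ : E → F} {a : E}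
    (hQ : DifferentiableAt ℝ Q (a, ψ a)) (hψ : DifferentiableAt ℝ ψ a)
    (h : ∀ᶠ x in 𝓝 a, Q (x, ψ x) = 0) (v : E) :
    fderiv ℝ Q (a, ψ a) (v, fderiv ℝ ψ a v) = 0 := by
  have hcomp := hQ.hasFDerivAt.comp a ((hasFDerivAt_id a).prodMk hψ.hasFDerivAt)
  have hzero := hcomp.unique ((hasFDerivAt_const (0 : G) a).congr_of_eventuallyEq h)
  exact DFunLike.congr_fun hzero v

variable [CompleteSpace E] [CompleteSpace F] [CompleteSpace G]

lemma eventually_contDiffAt_implicitFunction {Q : E × F → G} (hQ : ContDiff ℝ ∞ Q) {u : E × F}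
    (hinv : (fderiv ℝ Q u ∘L .inr ℝ E F).IsInvertible) :
    ∀ᶠ x in 𝓝 u.1, ContDiffAt ℝ ∞ (hQ.contDiffAt.implicitFunction (by simp) hinv) x := by
  set ψ := hQ.contDiffAt.implicitFunction (by simp) hinv
  have hψu : ψ u.1 = u.2 := hQ.contDiffAt.implicitFunction_apply_self (by simp) hinv
  have hψ : ContDiffAt ℝ 1 ψ u.1 :=
    (hQ.contDiffAt.contDiffAt_implicitFunction (by simp) hinv).of_le (by simp)
  have hgraph : Tendsto (fun x => (x, ψ x)) (𝓝 u.1) (𝓝 u) := by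
    have := continuousAt_id.prodMk hψ.continuousAt
    rwa [ContinuousAt, id, hψu] at this
  have hopen : IsOpen {p | (fderiv ℝ Q p ∘L .inr ℝ E F).IsInvertible} :=
    isOpen_setOf_isInvertible.preimage
      ((hQ.continuous_fderiv (by simp)).clm_comp continuous_const)
  filter_upwards [hgraph.eventually (hopen.mem_nhds hinv), hψ.eventually (by simp),
    (hQ.contDiffAt.eventually_apply_implicitFunction (by simp) hinv).eventually_nhds]
    with x hx hψx hQx
  -- By uniqueness `ψ` is also the implicit function based at the nearby point `(x, ψ x)`.
  refine (hQ.contDiffAt.contDiffAt_implicitFunction (u := (x, ψ x)) (by simp) hx)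
    |>.congr_of_eventuallyEq ?_
  have hgraph' : Tendsto (fun x' => (x', ψ x')) (𝓝 x) (𝓝 (x, ψ x)) :=
    continuousAt_id.prodMk hψx.continuousAt
  filter_upwards [hQx, hgraph'.eventually
    (hQ.contDiffAt.eventually_apply_eq_iff_implicitFunction (by simp) hx)] with x' hx' hiff
  exact (hiff.1 (hx'.trans hQx.self_of_nhds.symm)).symm

lemma exists_contDiff_implicitFunction {E : Type*} [NormedAddCommGroup E] [NormedSpace ℝ E]
    [FiniteDimensional ℝ E] {Q : E × F → G} (hQ : ContDiff ℝ ∞ Q) {u : E × F}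
    (hu : Q u = 0) (hinv : (fderiv ℝ Q u ∘L .inr ℝ E F).IsInvertible) :
    ∃ ψ : E → F, ContDiff ℝ ∞ ψ ∧ ψ u.1 = u.2 ∧ ∀ᶠ p in 𝓝 u, Q p = 0 ↔ p.2 = ψ p.1 := by
  have : CompleteSpace E := FiniteDimensional.complete ℝ E
  obtain ⟨ψ, hψ, heq⟩ := exists_contDiff_eventuallyEq
    (f := hQ.contDiffAt.implicitFunction (by simp) hinv)
    (eventually_contDiffAt_implicitFunction hQ hinv) fun x hx => ContDiffAt.contDiffWithinAt hx
  refine ⟨ψ, hψ, ?_, ?_⟩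
  · rw [heq.self_of_nhds, ContDiffAt.implicitFunction_apply_self]
  · filter_upwards [hQ.contDiffAt.eventually_apply_eq_iff_implicitFunction (by simp) hinv,
      (continuous_fst.tendsto u).eventually heq] with p hp hψp
    rw [hψp, ← hu, hp, eq_comm]

end InverseFunction

/-! ### Superposition operators and parametric integrals -/

section Superposition

universe u

variable {K : Type*} [TopologicalSpace K] [CompactSpace K]
  {E : Type u} [NormedAddCommGroup E] [NormedSpace ℝ E]

/-- Pointwise application `(A, h) ↦ (x ↦ A x (h x))` as a continuous bilinear map; the derivative
of a superposition operator takes its values in such maps. -/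
noncomputable def pointwiseApply (K E F : Type*) [TopologicalSpace K] [CompactSpace K]
    [NormedAddCommGroup E] [NormedSpace ℝ E] [NormedAddCommGroup F] [NormedSpace ℝ F] :
    C(K, E →L[ℝ] F) →L[ℝ] C(K, E) →L[ℝ] C(K, F) :=
  LinearMap.mkContinuous₂
    (LinearMap.mk₂ ℝ (fun (A : C(K, E →L[ℝ] F)) (h : C(K, E)) =>
        (⟨fun x => A x (h x), by fun_prop⟩ : C(K, F)))
      (by intros; ext; simp) (by intros; ext; simp) (by intros; ext; simp) (by intros; ext; simp))
    1 fun A h => by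
      refine (ContinuousMap.norm_le _ (by positivity)).2 fun x => ?_
      rw [one_mul]
      exact (A x).le_of_opNorm_le_of_le (A.norm_coe_le_norm x) (h.norm_coe_le_norm x)

lemma hasFDerivAt_superposition {F : Type*} [NormedAddCommGroup F] [NormedSpace ℝ F]
    {g : E → F} (hg : ContDiff ℝ 1 g) (γ : C(K, E)) :
    HasFDerivAt (fun γ : C(K, E) => (⟨g, hg.continuous⟩ : C(E, F)).comp γ)
      (pointwiseApply K E F ((⟨fderiv ℝ g, hg.continuous_fderiv (by simp)⟩ :
        C(E, E →L[ℝ] F)).comp γ)) γ := by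
  set g' : C(E, E →L[ℝ] F) := ⟨fderiv ℝ g, hg.continuous_fderiv (by simp)⟩
  rw [hasFDerivAt_iff_isLittleO_nhds_zero, Asymptotics.isLittleO_iff]
  intro ε hε
  obtain ⟨δ, hδ, hδε⟩ := (Metric.continuousAt_iff (a := γ)
    (f := fun γ : C(K, E) => g'.comp γ)).1 g'.continuous_postcomp.continuousAt ε hε
  have hg'ε : ∀ x, ∀ z ∈ Metric.ball (γ x) δ, ‖fderiv ℝ g z - fderiv ℝ g (γ x)‖ ≤ ε := by
    intro x z hz
    have hdist : dist (γ + ContinuousMap.const K (z - γ x)) γ < δ := by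
      rw [dist_eq_norm, add_sub_cancel_left, ContinuousMap.norm_lt_iff _ hδ]
      intro y
      simpa [dist_eq_norm] using hz
    simpa [g', dist_eq_norm] using
      (ContinuousMap.dist_apply_le_dist x).trans (hδε hdist).le
  filter_upwards [Metric.ball_mem_nhds (0 : C(K, E)) hδ] with h hh
  refine (ContinuousMap.norm_le _ (by positivity)).2 fun x => ?_
  have hx : ‖h x‖ < δ := (h.norm_coe_le_norm x).trans_lt (by simpa using hh)
  have hmean := (convex_ball (γ x) δ).norm_image_sub_le_of_norm_fderiv_le' (𝕜 := ℝ)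
    (y := γ x + h x) (fun z _ => hg.differentiable (by simp) z) (hg'ε x)
    (Metric.mem_ball_self hδ) (by simpa [dist_eq_norm] using hx)
  rw [add_sub_cancel_left] at hmean
  exact hmean.trans (mul_le_mul_of_nonneg_left (h.norm_coe_le_norm x) hε.le)

lemma contDiff_superposition_nat (n : ℕ) {F : Type u} [NormedAddCommGroup F] [NormedSpace ℝ F]
    {g : E → F} (hg : ContDiff ℝ ∞ g) :
    ContDiff ℝ n fun γ : C(K, E) => (⟨g, hg.continuous⟩ : C(E, F)).comp γ := by
  induction n generalizing F with
  | zero => exact contDiff_zero.2 (ContinuousMap.continuous_postcomp _)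
  | succ n ih =>
    refine contDiff_succ_iff_hasFDerivAt.2
      ⟨_, ?_, hasFDerivAt_superposition (hg.of_le (by simp) : ContDiff ℝ 1 g)⟩
    exact (pointwiseApply K E F).contDiff.comp (ih (hg.fderiv_right (by simp)))

lemma contDiff_superposition {F : Type u} [NormedAddCommGroup F] [NormedSpace ℝ F]
    {g : E → F} (hg : ContDiff ℝ ∞ g) :
    ContDiff ℝ ∞ fun γ : C(K, E) => (⟨g, hg.continuous⟩ : C(E, F)).comp γ :=
  contDiff_infty.2 fun n => contDiff_superposition_nat n hg

end Superposition

section ParametricIntegral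

open scoped unitInterval

universe u

/-- Integration over the unit interval as a continuous linear map on `C(I, F)`. -/
noncomputable def unitIntervalIntegral (F : Type*) [NormedAddCommGroup F] [NormedSpace ℝ F] :
    C(I, F) →L[ℝ] F :=
  LinearMap.mkContinuous
    { toFun := fun γ => ∫ t in (0 : ℝ)..1, IccExtend zero_le_one γ t
      map_add' := fun γ η => intervalIntegral.integral_add
        ((γ.continuous.Icc_extend' (h := zero_le_one)).intervalIntegrable _ _)
        ((η.continuous.Icc_extend' (h := zero_le_one)).intervalIntegrable _ _)
      map_smul' := fun c γ => intervalIntegral.integral_smul c _ } 1 fun γ => by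
    have := intervalIntegral.norm_integral_le_of_norm_le_const (a := 0) (b := 1)
      (f := IccExtend zero_le_one γ) fun t _ => γ.norm_coe_le_norm _
    rwa [sub_zero, abs_one, mul_one, ← one_mul ‖γ‖] at this

lemma unitIntervalIntegral_eq {F : Type*} [NormedAddCommGroup F] [NormedSpace ℝ F] {γ : C(I, F)}
    {f : ℝ → F} (h : ∀ s : I, γ s = f s) : unitIntervalIntegral F γ = ∫ t in (0 : ℝ)..1, f t := by
  refine intervalIntegral.integral_congr fun t ht => ?_
  rw [uIcc_of_le zero_le_one] at ht
  exact (IccExtend_of_mem zero_le_one γ ht).trans (h ⟨t, ht⟩)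

lemma contDiff_parametric_integral {E F : Type u} [NormedAddCommGroup E] [NormedSpace ℝ E]
    [NormedAddCommGroup F] [NormedSpace ℝ F] {g : E × ℝ → F} (hg : ContDiff ℝ ∞ g) :
    ContDiff ℝ ∞ fun x => ∫ s in (0 : ℝ)..1, g (x, s) := by
  let segment (x : E) : C(I, E × ℝ) :=
    ContinuousLinearMap.const ℝ I (x, (0 : ℝ)) + ⟨fun s => (0, s), by fun_prop⟩
  have hsegment : ContDiff ℝ ∞ segment :=
    ((ContinuousLinearMap.const ℝ I ∘L .inl ℝ E ℝ).contDiff).add contDiff_const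
  convert (unitIntervalIntegral F).contDiff.comp ((contDiff_superposition hg).comp hsegment)
    using 1
  funext x
  exact (unitIntervalIntegral_eq fun s => by simp [segment]).symm

end ParametricIntegral

/-! ### Taylor expansion along lines -/

section DirDeriv

variable {E F : Type*} [NormedAddCommGroup E] [NormedSpace ℝ E] [NormedAddCommGroup F]
  [NormedSpace ℝ F]

/-- The derivative of `f` in the direction `v`, as a function of the base point, so that it can be
iterated. -/
noncomputable def dirDeriv (v : E) (f : E → F) : E → F := fun x => fderiv ℝ f x v

lemma contDiff_dirDeriv {f : E → F} (hf : ContDiff ℝ ∞ f) (v : E) :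
    ContDiff ℝ ∞ (dirDeriv v f) :=
  (hf.fderiv_right (by simp)).clm_apply contDiff_const

lemma dirDeriv_neg (v : E) (f : E → F) :
    dirDeriv v (fun x => -f x) = fun x => -dirDeriv v f x := by
  funext x
  rw [dirDeriv, fderiv_fun_neg]
  rfl

lemma hasDerivAt_add_smul {f : E → F} {x v : E} {t : ℝ} (hf : DifferentiableAt ℝ f (x + t • v)) :
    HasDerivAt (fun t : ℝ => f (x + t • v)) (dirDeriv v f (x + t • v)) t :=
  hf.hasFDerivAt.comp_hasDerivAt t (by simpa using ((hasDerivAt_id t).smul_const v).const_add x)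

lemma add_smul_eq_add_integral_dirDeriv [CompleteSpace F] {f : E → F} (hf : ContDiff ℝ 1 f)
    (x v : E) (t : ℝ) :
    f (x + t • v) = f x + t • ∫ s in (0 : ℝ)..1, dirDeriv v f (x + (s * t) • v) := by
  have hderiv : ∀ s ∈ uIcc (0 : ℝ) 1,
      HasDerivAt (fun s : ℝ => f (x + (s * t) • v)) (t • dirDeriv v f (x + (s * t) • v)) s :=
    fun s _ => (hasDerivAt_add_smul (hf.differentiable one_ne_zero _)).scomp s
      (hasDerivAt_mul_const t)
  have hcont : Continuous fun s : ℝ => t • dirDeriv v f (x + (s * t) • v) :=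
    (((hf.continuous_fderiv one_ne_zero).comp (by fun_prop)).clm_apply
      continuous_const).const_smul t
  rw [← intervalIntegral.integral_smul,
    intervalIntegral.integral_eq_sub_of_hasDerivAt hderiv (hcont.intervalIntegrable _ _)]
  simp

end DirDeriv

section Taylor

open scoped Nat

universe u

lemma exists_taylor_remainder {E F : Type u} [NormedAddCommGroup E] [NormedSpace ℝ E]
    [NormedAddCommGroup F] [NormedSpace ℝ F] [CompleteSpace F] (v : E) (n : ℕ) {f : E → F}
    (hf : ContDiff ℝ ∞ f) :
    ∃ R : E × ℝ → F, ContDiff ℝ ∞ R ∧ ∀ x (t : ℝ), f (x + t • v) =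
      ∑ k ∈ Finset.range n, (t ^ k / k !) • (dirDeriv v)^[k] f x + t ^ n • R (x, t) := by
  induction n generalizing f with
  | zero => exact ⟨fun p => f (p.1 + p.2 • v), by fun_prop, fun x t => by simp⟩
  | succ n ih =>
    obtain ⟨R, hR, hfR⟩ := ih (contDiff_dirDeriv hf v)
    refine ⟨fun p => ∫ s in (0 : ℝ)..1, s ^ n • R (p.1, s * p.2),
      contDiff_parametric_integral (g := fun q : (E × ℝ) × ℝ => q.2 ^ n • R (q.1.1, q.2 * q.1.2))
        (by fun_prop), fun x t => ?_⟩
    have hR' : Continuous R := hR.continuous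
    have hterm (k : ℕ) : ∫ s in (0 : ℝ)..1, ((s * t) ^ k / k !) • (dirDeriv v)^[k + 1] f x =
        (t ^ k / (k + 1)!) • (dirDeriv v)^[k + 1] f x := by
      simp only [mul_pow, mul_div_assoc]
      rw [intervalIntegral.integral_smul_const, intervalIntegral.integral_mul_const, integral_pow,
        Nat.factorial_succ]
      congr 1
      push_cast
      field_simp
      simp
    have hrem : ∫ s in (0 : ℝ)..1, (s * t) ^ n • R (x, s * t) =
        t ^ n • ∫ s in (0 : ℝ)..1, s ^ n • R (x, s * t) := by
      simp only [← intervalIntegral.integral_smul, smul_smul, mul_pow, mul_comm]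
    calc f (x + t • v)
        = f x + t • ∫ s in (0 : ℝ)..1, (∑ k ∈ Finset.range n,
            ((s * t) ^ k / k !) • (dirDeriv v)^[k + 1] f x + (s * t) ^ n • R (x, s * t)) := by
          rw [add_smul_eq_add_integral_dirDeriv (hf.of_le (by simp))]
          simp only [hfR, Function.iterate_succ_apply]
      _ = f x + t • (∑ k ∈ Finset.range n, (t ^ k / (k + 1)!) • (dirDeriv v)^[k + 1] f x +
            t ^ n • ∫ s in (0 : ℝ)..1, s ^ n • R (x, s * t)) := by
          rw [intervalIntegral.integral_add (Continuous.intervalIntegrable (by fun_prop) _ _)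
            (Continuous.intervalIntegrable (by fun_prop) _ _), intervalIntegral.integral_finsetSum
            fun k _ => Continuous.intervalIntegrable (by fun_prop) _ _, hrem]
          simp only [hterm]
      _ = _ := by
          rw [Finset.sum_range_succ', smul_add, Finset.smul_sum, smul_smul, pow_succ' t n]
          simp only [smul_smul, pow_succ' t, mul_div_assoc]
          simp [add_comm, add_left_comm]

lemma coeff_eq_zero_of_sum_eq_zero {F : Type*} [NormedAddCommGroup F] [NormedSpace ℝ F] {n : ℕ}
    {c : ℕ → F} {r : ℝ → F} (hr : ContinuousAt r 0)
    (h : ∀ᶠ t in 𝓝[≠] (0 : ℝ), ∑ k ∈ Finset.range n, t ^ k • c k + t ^ n • r t = 0) :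
    ∀ k < n, c k = 0 := by
  induction n generalizing c with
  | zero => simp
  | succ n ih =>
    have hcont : ContinuousAt
        (fun t : ℝ => ∑ k ∈ Finset.range (n + 1), t ^ k • c k + t ^ (n + 1) • r t) 0 := by
      fun_prop
    have hzero : c 0 = 0 := by
      have := tendsto_nhds_unique (hcont.tendsto.mono_left nhdsWithin_le_nhds)
        (tendsto_const_nhds.congr' (h.mono fun t ht => ht.symm))
      simpa [Finset.sum_range_succ'] using this
    have hshift : ∀ᶠ t in 𝓝[≠] (0 : ℝ),
        ∑ k ∈ Finset.range n, t ^ k • c (k + 1) + t ^ n • r t = 0 := by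
      filter_upwards [h, self_mem_nhdsWithin] with t ht ht0
      refine (smul_eq_zero_iff_right (ht0 : t ≠ 0)).1 ?_
      rw [← ht, Finset.sum_range_succ', hzero, smul_zero, add_zero, smul_add, Finset.smul_sum]
      simp only [smul_smul, pow_succ' t]
    rintro (_ | k) hk
    · exact hzero
    · exact ih hshift k (by lia)

end Taylor

/-! ### Smoothness of flows -/

section Flow

open scoped unitInterval

/-- The Volterra operator `γ ↦ (s ↦ ∫₀ˢ γ)` on paths `[0, 1] → F`. -/
noncomputable def volterra (F : Type*) [NormedAddCommGroup F] [NormedSpace ℝ F] :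
    C(I, F) →L[ℝ] C(I, F) :=
  LinearMap.mkContinuous
    { toFun := fun γ => ⟨fun s => ∫ t in (0 : ℝ)..s, IccExtend zero_le_one γ t,
        (intervalIntegral.continuous_primitive (fun _ _ =>
          (γ.continuous.Icc_extend' (h := zero_le_one)).intervalIntegrable _ _) 0).comp
          continuous_subtype_val⟩
      map_add' := fun γ η => ContinuousMap.ext fun s => intervalIntegral.integral_add
        ((γ.continuous.Icc_extend' (h := zero_le_one)).intervalIntegrable _ _)
        ((η.continuous.Icc_extend' (h := zero_le_one)).intervalIntegrable _ _)
      map_smul' := fun c γ => ContinuousMap.ext fun s => intervalIntegral.integral_smul c _ } 1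
    fun γ => by
      refine (ContinuousMap.norm_le _ (by positivity)).2 fun s => ?_
      have hnorm := intervalIntegral.norm_integral_le_of_norm_le_const (a := 0) (b := s)
        (f := IccExtend zero_le_one γ) fun t _ => γ.norm_coe_le_norm _
      rw [sub_zero, abs_of_nonneg s.2.1, mul_comm] at hnorm
      exact hnorm.trans (mul_le_mul_of_nonneg_right s.2.2 (norm_nonneg _))

variable {E : Type*} [NormedAddCommGroup E] [NormedSpace ℝ E]

/-- The defect of the integral equation `γ s = p + τ ∫₀ˢ G ∘ γ` at `((τ, p), γ)`; its zeros are the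
solutions `γ` of `γ' = τ G(γ)` on `[0, 1]` which start at `p`. Scaling time by the parameter `τ`
keeps the interval fixed. -/
noncomputable def flowDefect (G : C(E, E)) (q : (ℝ × E) × C(I, E)) : C(I, E) :=
  q.2 - ContinuousLinearMap.const ℝ I q.1.2 - q.1.1 • volterra E (G.comp q.2)

lemma flowDefect_eq_zero_iff {G : C(E, E)} {q : ℝ × E} {γ : C(I, E)} :
    flowDefect G (q, γ) = 0 ↔
      ∀ s : I, γ s = q.2 + q.1 • ∫ t in (0 : ℝ)..s, G (IccExtend zero_le_one γ t) := by
  rw [flowDefect, sub_sub, sub_eq_zero, ContinuousMap.ext_iff]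
  rfl

lemma flowDefect_comp_mul {G : C(E, E)} {q : ℝ × E} {γ : C(I, E)} (h : flowDefect G (q, γ) = 0)
    (s : I) : flowDefect G ((s * q.1, q.2), γ.comp ⟨fun r => s * r, by fun_prop⟩) = 0 := by
  rw [flowDefect_eq_zero_iff] at h ⊢
  intro r
  have hscale : ∫ t in (0 : ℝ)..r, G (IccExtend zero_le_one
        (γ.comp ⟨fun r => s * r, by fun_prop⟩) t) =
      ∫ t in (0 : ℝ)..r, G (IccExtend zero_le_one γ (s * t)) := by
    refine intervalIntegral.integral_congr fun t ht => ?_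
    rw [uIcc_of_le r.2.1] at ht
    have ht1 : t ∈ Icc (0 : ℝ) 1 := ⟨ht.1, ht.2.trans r.2.2⟩
    have hst : (s : ℝ) * t ∈ Icc (0 : ℝ) 1 := (s * ⟨t, ht1⟩ : I).2
    simp only [IccExtend_of_mem zero_le_one _ ht1, IccExtend_of_mem zero_le_one _ hst]
    rfl
  refine (h (s * r)).trans ?_
  rw [hscale, mul_comm (s : ℝ) q.1, mul_smul,
    intervalIntegral.smul_integral_comp_mul_left
      (fun t => G (IccExtend zero_le_one γ t)) (s : ℝ), mul_zero]
  rfl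

lemma fderiv_flowDefect_comp_inr {G : C(E, E)} (hQ : DifferentiableAt ℝ (flowDefect G) 0) :
    fderiv ℝ (flowDefect G) 0 ∘L .inr ℝ (ℝ × E) C(I, E) = .id ℝ C(I, E) := by
  have hid : (fun γ => flowDefect G (0, γ)) = id := by
    funext γ
    simp [flowDefect]
  refine ((hQ.hasFDerivAt (x := ((0 : ℝ × E), (0 : C(I, E)))).comp 0
    (hasFDerivAt_prodMk_right 0 0)).unique ?_)
  exact (hasFDerivAt_id (0 : C(I, E))).congr_of_eventuallyEq (Eventually.of_forall (congrFun hid))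

end Flow

section SmoothFlow

open scoped unitInterval

universe u

variable {E : Type u} [NormedAddCommGroup E] [NormedSpace ℝ E]

lemma contDiff_flowDefect {G : C(E, E)} (hG : ContDiff ℝ ∞ G) : ContDiff ℝ ∞ (flowDefect G) :=
  (contDiff_snd.sub ((ContinuousLinearMap.const ℝ I).contDiff.comp contDiff_fst.snd)).sub
    (contDiff_fst.fst.smul ((volterra E).contDiff.comp
      ((contDiff_superposition hG).comp contDiff_snd)))

variable [FiniteDimensional ℝ E]

lemma exists_contDiff_flowPath {G : C(E, E)} (hG : ContDiff ℝ ∞ G) :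
    ∃ Γ : ℝ × E → C(I, E), ContDiff ℝ ∞ Γ ∧ ∀ᶠ q in 𝓝 (0 : ℝ × E),
      flowDefect G (q, Γ q) = 0 ∧ ∀ s : I, Γ q s = Γ (s * q.1, q.2) 1 := by
  have : CompleteSpace E := FiniteDimensional.complete ℝ E
  have hQ := contDiff_flowDefect hG
  obtain ⟨Γ, hΓ, hΓ0, hiff⟩ := exists_contDiff_implicitFunction hQ (u := 0)
    (by simp [flowDefect]) (by
      rw [fderiv_flowDefect_comp_inr (hQ.differentiable (by simp) 0)]
      exact ⟨.refl ℝ _, rfl⟩)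
  refine ⟨Γ, hΓ, ?_⟩
  obtain ⟨δ, hδ, hunique⟩ := Metric.eventually_nhds_iff_ball.1 hiff
  have hsmall : ∀ᶠ q in 𝓝 (0 : ℝ × E), ‖Γ q‖ < δ := by
    refine hΓ.continuous.norm.continuousAt.eventually_lt continuousAt_const ?_
    rwa [show Γ 0 = 0 from hΓ0, norm_zero]
  filter_upwards [hsmall, Metric.ball_mem_nhds 0 hδ] with q hΓq hq
  rw [mem_ball_zero_iff] at hq
  have hsolution (q' : ℝ × E) (hq' : ‖q'‖ < δ) (γ : C(I, E)) (hγ : ‖γ‖ < δ) :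
      flowDefect G (q', γ) = 0 ↔ γ = Γ q' :=
    hunique (q', γ) (by simpa using ⟨hq', hγ⟩)
  have hdefect := (hsolution q hq _ hΓq).2 rfl
  refine ⟨hdefect, fun s => ?_⟩
  have hsq : ‖((s : ℝ) * q.1, q.2)‖ < δ := by
    rw [Prod.norm_def, max_lt_iff] at hq ⊢
    rw [norm_mul, Real.norm_of_nonneg s.2.1]
    exact ⟨(mul_le_of_le_one_left (norm_nonneg _) s.2.2).trans_lt hq.1, hq.2⟩
  have hγ := (hsolution _ hsq _ ((ContinuousMap.norm_lt_iff _ hδ).2 fun r =>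
    ((Γ q).norm_coe_le_norm (s * r)).trans_lt hΓq)).1 (flowDefect_comp_mul hdefect s)
  simpa using DFunLike.congr_fun hγ 1

lemma exists_contDiff_flow_integral {G : E → E} (hG : ContDiff ℝ ∞ G) :
    ∃ φ : ℝ × E → E, ContDiff ℝ ∞ φ ∧
      ∀ᶠ q in 𝓝 (0 : ℝ × E), φ q = q.2 + ∫ t in (0 : ℝ)..q.1, G (φ (t, q.2)) := by
  obtain ⟨Γ, hΓ, hpath⟩ := exists_contDiff_flowPath (G := ⟨G, hG.continuous⟩) hG
  refine ⟨fun q => Γ q 1,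
    (ContinuousMap.evalCLM ℝ (1 : I) : C(I, E) →L[ℝ] E).contDiff.comp hΓ, ?_⟩
  filter_upwards [hpath] with q hq
  have hint : ∫ t in (0 : ℝ)..1, G (IccExtend zero_le_one (Γ q) t) =
      ∫ t in (0 : ℝ)..1, G (Γ (t * q.1, q.2) 1) := by
    refine intervalIntegral.integral_congr fun t ht => ?_
    rw [uIcc_of_le zero_le_one] at ht
    simp only [IccExtend_of_mem zero_le_one _ ht, hq.2 ⟨t, ht⟩]
  refine (flowDefect_eq_zero_iff.1 hq.1 1).trans ?_
  simp only [ContinuousMap.coe_mk, Icc.coe_one]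
  rw [hint, intervalIntegral.smul_integral_comp_mul_right (fun t => G (Γ (t, q.2) 1)), zero_mul,
    one_mul]

lemma exists_contDiff_flow {G : E → E} (hG : ContDiff ℝ ∞ G) :
    ∃ φ : ℝ × E → E, ContDiff ℝ ∞ φ ∧ (∀ᶠ p in 𝓝 (0 : E), φ (0, p) = p) ∧
      ∀ᶠ q in 𝓝 (0 : ℝ × E), HasDerivAt (fun t => φ (t, q.2)) (G (φ q)) q.1 := by
  have : CompleteSpace E := FiniteDimensional.complete ℝ E
  obtain ⟨φ, hφ, hint⟩ := exists_contDiff_flow_integral hG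
  refine ⟨φ, hφ, ?_, ?_⟩
  · have hline : Tendsto (fun p : E => ((0 : ℝ), p)) (𝓝 0) (𝓝 0) :=
      (Continuous.prodMk_right (0 : ℝ)).tendsto 0
    filter_upwards [hline.eventually hint] with p hp
    simpa using hp
  · filter_upwards [hint.eventually_nhds] with q hq
    have hcont : Continuous fun t => G (φ (t, q.2)) :=
      hG.continuous.comp (hφ.continuous.comp (Continuous.prodMk_left q.2))
    have hline : Tendsto (fun t => (t, q.2)) (𝓝 q.1) (𝓝 q) :=
      (Continuous.prodMk_left q.2).tendsto q.1
    exact ((hcont.integral_hasStrictDerivAt 0 q.1).hasDerivAt.const_add q.2).congr_of_eventuallyEq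
      (hline.eventually hq)

end SmoothFlow

section PartialDerivatives

variable {u : R3 → ℝ}

lemma dx_eq_dirDeriv (hu : Differentiable ℝ u) : dx u = dirDeriv (1, 0, 0) u := by
  funext p
  exact ((hu p).hasFDerivAt.comp_hasDerivAt p.1 ((hasDerivAt_id p.1).prodMk
    ((hasDerivAt_const _ _).prodMk (hasDerivAt_const _ _)))).deriv

lemma dy₁_eq_dirDeriv (hu : Differentiable ℝ u) : dy₁ u = dirDeriv (0, 1, 0) u := by
  funext p
  exact ((hu p).hasFDerivAt.comp_hasDerivAt p.2.1 ((hasDerivAt_const _ _).prodMk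
    ((hasDerivAt_id p.2.1).prodMk (hasDerivAt_const _ _)))).deriv

lemma hasDerivAt_dy₂ {p : R3} (hu : DifferentiableAt ℝ u p) :
    HasDerivAt (fun t => u (p.1, p.2.1, t)) (dirDeriv (0, 0, 1) u p) p.2.2 :=
  hu.hasFDerivAt.comp_hasDerivAt p.2.2 ((hasDerivAt_const _ _).prodMk
    ((hasDerivAt_const _ _).prodMk (hasDerivAt_id p.2.2)))

lemma dy₂_eq_dirDeriv (hu : Differentiable ℝ u) : dy₂ u = dirDeriv (0, 0, 1) u :=
  funext fun p => (hasDerivAt_dy₂ (hu p)).deriv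

lemma contDiff_dx (hu : ContDiff ℝ ∞ u) : ContDiff ℝ ∞ (dx u) :=
  dx_eq_dirDeriv (hu.differentiable (by simp)) ▸ contDiff_dirDeriv hu _

lemma contDiff_dy₁ (hu : ContDiff ℝ ∞ u) : ContDiff ℝ ∞ (dy₁ u) :=
  dy₁_eq_dirDeriv (hu.differentiable (by simp)) ▸ contDiff_dirDeriv hu _

lemma contDiff_dy₂ (hu : ContDiff ℝ ∞ u) : ContDiff ℝ ∞ (dy₂ u) :=
  dy₂_eq_dirDeriv (hu.differentiable (by simp)) ▸ contDiff_dirDeriv hu _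

lemma fderiv_R3_apply {F : Type*} [NormedAddCommGroup F] [NormedSpace ℝ F] (u : R3 → F) (p v : R3) :
    fderiv ℝ u p v = v.1 • dirDeriv (1, 0, 0) u p + v.2.1 • dirDeriv (0, 1, 0) u p +
      v.2.2 • dirDeriv (0, 0, 1) u p := by
  simp only [dirDeriv, ← map_smul, ← map_add]
  congr 1
  ext <;> simp

lemma fderiv_apply_eq_sum_partials (hu : Differentiable ℝ u) (p v : R3) :
    fderiv ℝ u p v = v.1 * dx u p + v.2.1 * dy₁ u p + v.2.2 * dy₂ u p := by
  rw [fderiv_R3_apply, dx_eq_dirDeriv hu, dy₁_eq_dirDeriv hu, dy₂_eq_dirDeriv hu]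
  simp only [smul_eq_mul]

end PartialDerivatives

section Hadamard

universe u

lemma exists_eq_smul_of_eq_zero_on_ker {E F : Type u} [NormedAddCommGroup E] [NormedSpace ℝ E]
    [NormedAddCommGroup F] [NormedSpace ℝ F] [CompleteSpace F] {f : E → F} (hf : ContDiff ℝ ∞ f)
    {ℓ : E →L[ℝ] ℝ} {v : E} (hv : ℓ v = 1) (hf0 : ∀ p, ℓ p = 0 → f p = 0) :
    ∃ G : E → F, ContDiff ℝ ∞ G ∧ (∀ p, f p = ℓ p • G p) ∧ ∀ p, ℓ p = 0 → G p = dirDeriv v f p := by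
  obtain ⟨R, hR, hfR⟩ := exists_taylor_remainder v 1 hf
  simp only [Finset.sum_range_one, pow_zero, Nat.factorial_zero, Nat.cast_one, div_one, one_smul,
    Function.iterate_zero_apply, pow_one] at hfR
  have hker (p : E) (hp : ℓ p = 0) (t : ℝ) : f (p + t • v) = t • R (p, t) := by
    rw [hfR, hf0 p hp, zero_add]
  refine ⟨fun p => R (p - ℓ p • v, ℓ p), by fun_prop, fun p => ?_, fun p hp => ?_⟩
  · rw [← hker _ (by simp [hv]), sub_add_cancel]
  · have hline := hasDerivAt_add_smul (x := p) (v := v) (t := 0) (hf.differentiable (by simp) _)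
    have hRp : HasDerivAt (fun t : ℝ => R (p, t)) (deriv (fun t : ℝ => R (p, t)) 0) 0 :=
      ((hR.differentiable (by simp)).comp (by fun_prop : Differentiable ℝ fun t : ℝ => (p, t)) 0
        ).hasDerivAt
    have hprod := (hasDerivAt_id (0 : ℝ)).smul hRp
    simp only [hker p hp, zero_smul, add_zero] at hline
    simpa [hp] using hprod.unique hline

/-- The quotient `F / x`, a field with the same trajectories as `F = (f, g₁, g₂)` off the plane
`{x = 0}` of equilibria, and transverse to that plane only where `∂ₓf ≠ 0`. -/
structure IsHadamardQuotient (f g₁ g₂ : R3 → ℝ) (G : R3 → R3) : Prop where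
  smooth : ContDiff ℝ ∞ G
  field_eq_smul : ∀ p, field f g₁ g₂ p = p.1 • G p
  eq_of_fst_eq_zero : ∀ p : R3, p.1 = 0 → G p = (dx f p, dx g₁ p, dx g₂ p)

lemma exists_isHadamardQuotient {f g₁ g₂ : R3 → ℝ} (hf : ContDiff ℝ ∞ f) (hg₁ : ContDiff ℝ ∞ g₁)
    (hg₂ : ContDiff ℝ ∞ g₂) (h0 : ∀ y₁ y₂ : ℝ, field f g₁ g₂ (0, y₁, y₂) = 0) :
    ∃ G, IsHadamardQuotient f g₁ g₂ G := by
  obtain ⟨G, hG, hFG, hG0⟩ := exists_eq_smul_of_eq_zero_on_ker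
    (hf.prodMk (hg₁.prodMk hg₂) : ContDiff ℝ ∞ (field f g₁ g₂))
    (ℓ := .fst ℝ ℝ (ℝ × ℝ)) (v := (1, 0, 0)) rfl (by rintro ⟨x, y⟩ (rfl : x = 0); exact h0 _ _)
  refine ⟨G, hG, hFG, fun p hp => ?_⟩
  have hderiv : HasFDerivAt (field f g₁ g₂) _ p :=
    (hf.differentiable (by simp) p).hasFDerivAt.prodMk
      ((hg₁.differentiable (by simp) p).hasFDerivAt.prodMk
        (hg₂.differentiable (by simp) p).hasFDerivAt)
  rw [hG0 p hp, dx_eq_dirDeriv (hf.differentiable (by simp)),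
    dx_eq_dirDeriv (hg₁.differentiable (by simp)), dx_eq_dirDeriv (hg₂.differentiable (by simp)),
    dirDeriv]
  exact DFunLike.congr_fun hderiv.fderiv _

end Hadamard

section FlowBox

universe u

variable {E : Type u} [NormedAddCommGroup E] [NormedSpace ℝ E]

lemma hasDerivAt_fst_of_differentiableAt {φ : ℝ × E → E} {q : ℝ × E} (hφ : DifferentiableAt ℝ φ q) :
    HasDerivAt (fun t => φ (t, q.2)) (fderiv ℝ φ q (1, 0)) q.1 :=
  hφ.hasFDerivAt.comp_hasDerivAt q.1 ((hasDerivAt_id q.1).prodMk (hasDerivAt_const q.1 q.2))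

lemma fderiv_flow_zero {G : E → E} {φ : ℝ × E → E} (hφ : DifferentiableAt ℝ φ 0)
    (hφ0 : ∀ᶠ p in 𝓝 (0 : E), φ (0, p) = p)
    (hφt : HasDerivAt (fun t => φ (t, 0)) (G (φ 0)) 0) (t : ℝ) (p : E) :
    fderiv ℝ φ 0 (t, p) = p + t • G 0 := by
  have hspace : fderiv ℝ φ 0 ∘L .inr ℝ ℝ E = .id ℝ E :=
    ((hφ.hasFDerivAt (x := ((0 : ℝ), (0 : E)))).comp (0 : E)
      (hasFDerivAt_prodMk_right _ _)).unique
      ((hasFDerivAt_id (0 : E)).congr_of_eventuallyEq hφ0)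
  have htime : fderiv ℝ φ 0 (1, 0) = G 0 := by
    rw [show φ 0 = 0 from hφ0.self_of_nhds] at hφt
    exact (hasDerivAt_fst_of_differentiableAt hφ).unique hφt
  calc fderiv ℝ φ 0 (t, p) = fderiv ℝ φ 0 (0, p) + t • fderiv ℝ φ 0 (1, 0) := by
        rw [← map_smul, ← map_add]
        simp
    _ = p + t • G 0 := by
        rw [htime]
        exact congrArg (· + t • G 0) (DFunLike.congr_fun hspace p)

lemma exists_flowBox_openPartialHomeomorph [FiniteDimensional ℝ E] {G : E → E}
    (hG : ContDiff ℝ ∞ G) {ℓ : E →L[ℝ] ℝ} {v : E} (hv : ℓ v = 1) (hℓ : ℓ (G 0) ≠ 0) :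
    ∃ e : OpenPartialHomeomorph E E, 0 ∈ e.source ∧ e 0 = 0 ∧ ContDiff ℝ ∞ e ∧
      ContDiffOn ℝ ∞ e.symm e.target ∧ (∀ w ∈ e.source, dirDeriv v e w = G (e w)) ∧
      ∀ w, fderiv ℝ e 0 w = w - ℓ w • v + ℓ w • G 0 := by
  have : CompleteSpace E := FiniteDimensional.complete ℝ E
  obtain ⟨φ, hφ, hφ0, hφt⟩ := exists_contDiff_flow hG
  let A : E →L[ℝ] ℝ × E := ℓ.prod (.id ℝ E - ℓ.smulRight v)
  have hA (w : E) : A w = (ℓ w, w - ℓ w • v) := rfl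
  have hP : ContDiff ℝ ∞ (φ ∘ A) := hφ.comp A.contDiff
  have hderiv (w v' : E) : fderiv ℝ (φ ∘ A) w v' = fderiv ℝ φ (A w) (A v') := by
    rw [fderiv_comp w (hφ.differentiable (by simp) _) A.differentiableAt, A.fderiv]
    rfl
  have hP0 (w : E) : fderiv ℝ (φ ∘ A) 0 w = w - ℓ w • v + ℓ w • G 0 := by
    rw [hderiv, map_zero, hA]
    exact fderiv_flow_zero (hφ.differentiable (by simp) 0) hφ0 hφt.self_of_nhds _ _
  have hflow : ∀ᶠ w in 𝓝 (0 : E), dirDeriv v (φ ∘ A) w = G (φ (A w)) := by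
    have hAt : Tendsto A (𝓝 0) (𝓝 0) := by simpa using A.continuous.tendsto 0
    filter_upwards [hAt.eventually hφt] with w hw
    rw [dirDeriv, hderiv, show A v = (1, 0) by simp [hA, hv]]
    exact (hasDerivAt_fst_of_differentiableAt (hφ.differentiable (by simp) _)).unique hw
  obtain ⟨s, hs, hso, h0s⟩ := eventually_nhds_iff.1 hflow
  obtain ⟨e, h0e, he, hsymm⟩ := exists_openPartialHomeomorph_contDiffOn_symm hP
    (a := 0) (isInvertible_of_ker_eq_bot fun w hw => by
      rw [hP0] at hw
      have hℓw : ℓ w = 0 := by simpa [hv, hℓ] using congrArg ℓ hw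
      simpa [hℓw] using hw)
  have he' : ⇑(e.restrOpen s hso) = φ ∘ A := he
  refine ⟨e.restrOpen s hso, ⟨h0e, h0s⟩, ?_, he' ▸ hP, hsymm.mono inter_subset_left, ?_, ?_⟩ <;>
    rw [he']
  · rw [Function.comp_apply, map_zero]
    exact hφ0.self_of_nhds
  · exact fun w hw => hs w hw.2
  · exact hP0

lemma fderiv_symm_apply_of_fderiv_apply_eq {F : Type*} [NormedAddCommGroup F] [NormedSpace ℝ F]
    {e : OpenPartialHomeomorph E F} {w a : E} {b : F} (hw : w ∈ e.source)
    (he : DifferentiableAt ℝ e w) (hsymm : DifferentiableAt ℝ e.symm (e w))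
    (h : fderiv ℝ e w a = b) : fderiv ℝ e.symm (e w) b = a := by
  have hid := (hsymm.hasFDerivAt.comp w he.hasFDerivAt).unique
    ((hasFDerivAt_id w).congr_of_eventuallyEq (e.eventually_left_inverse hw))
  rw [← h]
  exact DFunLike.congr_fun hid a

/-- The Lie derivative of the function `u` along the vector field `G`. -/
noncomputable def lieDeriv (G : E → E) (u : E → ℝ) : E → ℝ := fun p => fderiv ℝ u p (G p)

lemma contDiff_iterate_lieDeriv {G : E → E} (hG : ContDiff ℝ ∞ G) {u : E → ℝ}
    (hu : ContDiff ℝ ∞ u) (n : ℕ) : ContDiff ℝ ∞ ((lieDeriv G)^[n] u) := by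
  induction n with
  | zero => exact hu
  | succ n ih =>
    rw [Function.iterate_succ_apply']
    exact (ih.fderiv_right (by simp)).clm_apply hG

lemma iterate_dirDeriv_comp_eq_iterate_lieDeriv {G P : E → E} {v : E} {s : Set E} {u : E → ℝ}
    (hG : ContDiff ℝ ∞ G) (hu : ContDiff ℝ ∞ u) (hP : Differentiable ℝ P) (hs : IsOpen s)
    (hPG : ∀ w ∈ s, dirDeriv v P w = G (P w)) (n : ℕ) :
    ∀ w ∈ s, (dirDeriv v)^[n] (u ∘ P) w = (lieDeriv G)^[n] u (P w) := by
  induction n with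
  | zero => exact fun w _ => rfl
  | succ n ih =>
    intro w hw
    have heq : (dirDeriv v)^[n] (u ∘ P) =ᶠ[𝓝 w] (lieDeriv G)^[n] u ∘ P :=
      eventually_of_mem (hs.mem_nhds hw) ih
    rw [Function.iterate_succ_apply', Function.iterate_succ_apply', dirDeriv, heq.fderiv_eq,
      fderiv_comp w ((contDiff_iterate_lieDeriv hG hu n).differentiable (by simp) _) (hP w),
      ContinuousLinearMap.comp_apply, lieDeriv, ← hPG w hw, dirDeriv]

end FlowBox

/-! ### Flow boxes and cusp unfoldings -/

section Unfolding

/-- The derivative with respect to the first of the coordinates `w = (u₀, u₁, τ)` on `ℝ³`, in which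
`u₀`, `u₁` are parameters and `τ` is a phase variable. -/
noncomputable abbrev du₀ (X : R3 → ℝ) : R3 → ℝ := dirDeriv (1, 0, 0) X

/-- The derivative with respect to the second of the coordinates `w = (u₀, u₁, τ)`. -/
noncomputable abbrev du₁ (X : R3 → ℝ) : R3 → ℝ := dirDeriv (0, 1, 0) X

/-- The derivative with respect to the phase variable `τ` of the coordinates `w = (u₀, u₁, τ)`. -/
noncomputable abbrev dτ (X : R3 → ℝ) : R3 → ℝ := dirDeriv (0, 0, 1) X

/-- The family `τ ↦ X (u₀, u₁, τ)` is a versal unfolding of a cusp singularity at `0`, with third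
derivative `m` there. -/
structure IsCuspUnfolding (X : R3 → ℝ) (m : ℝ) : Prop where
  smooth : ContDiff ℝ ∞ X
  zero : X 0 = 0
  du₀_ne : du₀ X 0 ≠ 0
  du₁_zero : du₁ X 0 = 0
  dτ_zero : dτ X 0 = 0
  dτ₂_zero : dτ (dτ X) 0 = 0
  dτ₃ : dτ (dτ (dτ X)) 0 = m
  du₁_dτ_ne : du₁ (dτ X) 0 ≠ 0

lemma IsCuspUnfolding.neg {X : R3 → ℝ} {m : ℝ} (hX : IsCuspUnfolding X m) :
    IsCuspUnfolding (fun w => -X w) (-m) where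
  smooth := hX.smooth.neg
  zero := by rw [hX.zero, neg_zero]
  du₀_ne := by simpa only [dirDeriv_neg, neg_ne_zero] using hX.du₀_ne
  du₁_zero := by simp only [dirDeriv_neg, hX.du₁_zero, neg_zero]
  dτ_zero := by simp only [dirDeriv_neg, hX.dτ_zero, neg_zero]
  dτ₂_zero := by simp only [dirDeriv_neg, hX.dτ₂_zero, neg_zero]
  dτ₃ := by simp only [dirDeriv_neg, hX.dτ₃]
  du₁_dτ_ne := by simpa only [dirDeriv_neg, neg_ne_zero] using hX.du₁_dτ_ne

end Unfolding

section FlowBoxStructure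

/-- Coordinates `w = (u₀, u₁, τ)` near `0` in which the trajectories of `F` are contained in the
lines `u = const`: the chart `Φ`, from these coordinates to phase space, takes `(0, 0, Y)` to
`F`. -/
structure IsFlowBox (Φ : OpenPartialHomeomorph R3 R3) (Y : R3 → ℝ) (F : R3 → R3) : Prop where
  zero_mem : (0 : R3) ∈ Φ.source
  map_zero : Φ 0 = 0
  smooth : ContDiff ℝ ∞ Φ
  smooth_symm : ContDiffOn ℝ ∞ Φ.symm Φ.target
  fderiv_apply : ∀ w ∈ Φ.source, fderiv ℝ Φ w (0, 0, Y w) = F (Φ w)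

variable {Φ : OpenPartialHomeomorph R3 R3} {Y : R3 → ℝ} {F : R3 → R3}

lemma IsFlowBox.fderiv_symm_apply (h : IsFlowBox Φ Y F) {w : R3} (hw : w ∈ Φ.source) :
    fderiv ℝ Φ.symm (Φ w) (F (Φ w)) = (0, 0, Y w) :=
  fderiv_symm_apply_of_fderiv_apply_eq hw (h.smooth.differentiable (by simp) w)
    ((h.smooth_symm.contDiffAt (Φ.open_target.mem_nhds (Φ.map_source hw))).differentiableAt
      (by simp)) (h.fderiv_apply w hw)

end FlowBoxStructure

section HadamardQuotient

variable {f g₁ g₂ : R3 → ℝ} {G : R3 → R3}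

lemma lieDeriv_fst (G : R3 → R3) : lieDeriv G Prod.fst = fun p => (G p).1 := by
  funext p
  rw [lieDeriv, fderiv_fst]
  rfl

lemma IsHadamardQuotient.lieDeriv_fst_eq (hG : IsHadamardQuotient f g₁ g₂ G) (y₁ y₂ : ℝ) :
    lieDeriv G Prod.fst (0, y₁, y₂) = dx f (0, y₁, y₂) := by
  simp only [lieDeriv_fst, hG.eq_of_fst_eq_zero (0, y₁, y₂) rfl]

lemma IsHadamardQuotient.dy₁_lieDeriv_fst (hG : IsHadamardQuotient f g₁ g₂ G) (y₁ y₂ : ℝ) :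
    dy₁ (lieDeriv G Prod.fst) (0, y₁, y₂) = dy₁ (dx f) (0, y₁, y₂) := by
  simp only [dy₁, hG.lieDeriv_fst_eq]

lemma IsHadamardQuotient.dy₂_lieDeriv_fst (hG : IsHadamardQuotient f g₁ g₂ G) (y₁ y₂ : ℝ) :
    dy₂ (lieDeriv G Prod.fst) (0, y₁, y₂) = dy₂ (dx f) (0, y₁, y₂) := by
  simp only [dy₂, hG.lieDeriv_fst_eq]

lemma IsHadamardQuotient.lieDeriv_lieDeriv_fst (hG : IsHadamardQuotient f g₁ g₂ G) (t : ℝ) :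
    lieDeriv G (lieDeriv G Prod.fst) (0, 0, t) =
      dx f (0, 0, t) * dx (lieDeriv G Prod.fst) (0, 0, t) +
        dx g₁ (0, 0, t) * dy₁ (dx f) (0, 0, t) + dx g₂ (0, 0, t) * dy₂ (dx f) (0, 0, t) := by
  have hdiff : Differentiable ℝ (lieDeriv G Prod.fst) :=
    (contDiff_iterate_lieDeriv hG.smooth contDiff_fst 1).differentiable (by simp)
  rw [lieDeriv, fderiv_apply_eq_sum_partials hdiff, hG.eq_of_fst_eq_zero _ rfl,
    hG.dy₁_lieDeriv_fst, hG.dy₂_lieDeriv_fst]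

lemma IsHadamardQuotient.dy₂_lieDeriv_lieDeriv_fst (hG : IsHadamardQuotient f g₁ g₂ G)
    (hf : ContDiff ℝ ∞ f) (hg₁ : ContDiff ℝ ∞ g₁) (hg₂ : ContDiff ℝ ∞ g₂) (h_ii : dx f 0 = 0)
    (h_iii : dy₂ (dx f) 0 = 0) (h_iv : dx g₁ 0 = 0) :
    dy₂ (lieDeriv G (lieDeriv G Prod.fst)) 0 = kappa f g₁ g₂ := by
  have haxis {u : R3 → ℝ} (hu : ContDiff ℝ ∞ u) :
      HasDerivAt (fun t : ℝ => u (0, 0, t)) (dy₂ u 0) 0 := by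
    rw [dy₂_eq_dirDeriv (hu.differentiable (by simp))]
    exact hasDerivAt_dy₂ (hu.differentiable (by simp) 0)
  have hlie : ContDiff ℝ ∞ (lieDeriv G Prod.fst) :=
    contDiff_iterate_lieDeriv hG.smooth contDiff_fst 1
  have hsum := (((haxis (contDiff_dx hf)).mul (haxis (contDiff_dx hlie))).add
    ((haxis (contDiff_dx hg₁)).mul (haxis (contDiff_dy₁ (contDiff_dx hf))))).add
    ((haxis (contDiff_dx hg₂)).mul (haxis (contDiff_dy₂ (contDiff_dx hf))))
  have heq := (haxis (contDiff_iterate_lieDeriv hG.smooth contDiff_fst 2)).unique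
    (hsum.congr_of_eventuallyEq (Eventually.of_forall hG.lieDeriv_lieDeriv_fst))
  simp only [Prod.mk_zero_zero, h_ii, h_iii, h_iv] at heq
  refine heq.trans ?_
  rw [kappa]
  ring

lemma dirDeriv_comp_of_fderiv_apply_eq {u : R3 → ℝ} {P : R3 → R3} {v : R3} (hP0 : P 0 = 0)
    (hu : DifferentiableAt ℝ u 0) (hP : DifferentiableAt ℝ P 0) (hv : fderiv ℝ P 0 v = v) :
    dirDeriv v (fun w => u (P w)) 0 = dirDeriv v u 0 := by
  rw [← hP0] at hu
  rw [dirDeriv, fderiv_fun_comp 0 hu hP, ContinuousLinearMap.comp_apply, hv, hP0, ← dirDeriv]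

lemma IsHadamardQuotient.isCuspUnfolding (hG : IsHadamardQuotient f g₁ g₂ G)
    (hf : ContDiff ℝ ∞ f) (hg₁ : ContDiff ℝ ∞ g₁) (hg₂ : ContDiff ℝ ∞ g₂) (h_ii : dx f 0 = 0)
    (h_iii : dy₁ (dx f) 0 ≠ 0 ∧ dy₂ (dx f) 0 = 0) (h_iv : dx g₁ 0 = 0) {P : R3 → R3} {s : Set R3}
    (hP : ContDiff ℝ ∞ P) (hP0 : P 0 = 0) (hs : IsOpen s) (h0 : (0 : R3) ∈ s)
    (hPG : ∀ w ∈ s, dirDeriv (0, 0, 1) P w = G (P w))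
    (hP' : ∀ w : R3, fderiv ℝ P 0 w = w - w.2.2 • (0, 0, 1) + w.2.2 • G 0) :
    IsCuspUnfolding (fun w => (P w).1) (dx g₂ 0 * kappa f g₁ g₂) := by
  have hPd := hP.differentiable (by simp)
  have hlie (n : ℕ) := contDiff_iterate_lieDeriv hG.smooth contDiff_fst n
  have hiter (n : ℕ) {w : R3} (hw : w ∈ s) :
      (dirDeriv (0, 0, 1))^[n] (fun w => (P w).1) w = (lieDeriv G)^[n] Prod.fst (P w) :=
    iterate_dirDeriv_comp_eq_iterate_lieDeriv hG.smooth contDiff_fst hPd hs hPG n w hw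
  have hG0 : G 0 = (0, 0, dx g₂ 0) := by rw [hG.eq_of_fst_eq_zero 0 rfl, h_ii, h_iv]
  have hu {u : R3 → ℝ} (hu : ContDiff ℝ ∞ u) {v : R3} (hv : v.2.2 = 0) :
      dirDeriv v (fun w => u (P w)) 0 = dirDeriv v u 0 :=
    dirDeriv_comp_of_fderiv_apply_eq hP0 (hu.differentiable (by simp) 0) (hPd 0)
      (by rw [hP', hv]; simp)
  have hL₀ := hG.lieDeriv_fst_eq 0 0
  have hL₂ := hG.lieDeriv_lieDeriv_fst 0
  have hL₁ := hG.dy₁_lieDeriv_fst 0 0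
  simp only [Prod.mk_zero_zero, h_ii, h_iii.2, h_iv, zero_mul, mul_zero, add_zero] at hL₀ hL₂ hL₁
  have hdτ : (dτ fun w => (P w).1) =ᶠ[𝓝 0] fun w => lieDeriv G Prod.fst (P w) :=
    eventually_of_mem (hs.mem_nhds h0) fun w hw => hiter 1 hw
  exact {
    smooth := contDiff_fst.comp hP
    zero := by rw [hP0]; rfl
    du₀_ne := by rw [du₀, hu contDiff_fst rfl, dirDeriv, fderiv_fst]; simp
    du₁_zero := by rw [du₁, hu contDiff_fst rfl, dirDeriv, fderiv_fst]; simp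
    dτ_zero := (hiter 1 h0).trans (by rw [hP0]; exact hL₀)
    dτ₂_zero := (hiter 2 h0).trans (by rw [hP0]; exact hL₂)
    dτ₃ := by
      refine (hiter 3 h0).trans ?_
      rw [hP0, ← hG.dy₂_lieDeriv_lieDeriv_fst hf hg₁ hg₂ h_ii h_iii.2 h_iv]
      exact (fderiv_apply_eq_sum_partials ((hlie 2).differentiable (by simp)) 0 (G 0)).trans
        (by rw [hG0]; simp)
    du₁_dτ_ne := by
      have hL : ContDiff ℝ ∞ (lieDeriv G Prod.fst) := hlie 1
      rw [du₁, dirDeriv, hdτ.fderiv_eq, ← dirDeriv.eq_1 (0, 1, 0), hu hL rfl,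
        ← dy₁_eq_dirDeriv (hL.differentiable (by simp))]
      exact hL₁ ▸ h_iii.1 }

lemma exists_flowBox (hf : ContDiff ℝ ∞ f) (hg₁ : ContDiff ℝ ∞ g₁) (hg₂ : ContDiff ℝ ∞ g₂)
    (h_i : ∀ y₁ y₂ : ℝ, field f g₁ g₂ (0, y₁, y₂) = 0) (h_ii : dx f 0 = 0)
    (h_iii : dy₁ (dx f) 0 ≠ 0 ∧ dy₂ (dx f) 0 = 0) (h_iv : dx g₁ 0 = 0) (h_vi : dx g₂ 0 ≠ 0) :
    ∃ Φ : OpenPartialHomeomorph R3 R3, IsFlowBox Φ (fun w => (Φ w).1) (field f g₁ g₂) ∧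
      IsCuspUnfolding (fun w => (Φ w).1) (dx g₂ 0 * kappa f g₁ g₂) ∧
      (∀ w ∈ Φ.source, (Φ w).1 = 0 → dτ (fun w => (Φ w).1) w = dx f (Φ w)) ∧
      fderiv ℝ Φ 0 (0, 0, 1) = (0, 0, dx g₂ 0) := by
  obtain ⟨G, hG⟩ := exists_isHadamardQuotient hf hg₁ hg₂ h_i
  have hG0 : G 0 = (0, 0, dx g₂ 0) := by rw [hG.eq_of_fst_eq_zero 0 rfl, h_ii, h_iv]
  obtain ⟨Φ, h0, hΦ0, hΦ, hΦsymm, hΦG, hΦ'⟩ :=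
    exists_flowBox_openPartialHomeomorph (E := R3) hG.smooth (v := (0, 0, 1))
      (ℓ := (ContinuousLinearMap.snd ℝ ℝ ℝ).comp (ContinuousLinearMap.snd ℝ ℝ (ℝ × ℝ))) (by simp)
      (by rw [hG0]; exact h_vi)
  refine ⟨Φ, ⟨h0, hΦ0, hΦ, hΦsymm, fun w hw => ?_⟩,
    hG.isCuspUnfolding hf hg₁ hg₂ h_ii h_iii h_iv hΦ hΦ0 Φ.open_source h0 hΦG hΦ',
    fun w hw hX => ?_, ?_⟩
  · rw [hG.field_eq_smul, ← hΦG w hw, dirDeriv, ← map_smul]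
    simp
  · have hdir : dτ (fun w => (Φ w).1) w = (dirDeriv (0, 0, 1) Φ w).1 :=
      congrArg (· (0, 0, 1)) (hΦ.differentiable (by simp) w).hasFDerivAt.fst.fderiv
    rw [hdir, hΦG w hw, hG.eq_of_fst_eq_zero _ hX]
  · rw [hΦ', hG0]
    simp

end HadamardQuotient

/-! ### Division by a cubic -/

section CubicDivision

variable {Λ : Type} [NormedAddCommGroup Λ] [NormedSpace ℝ Λ]

/-- Division with remainder of `A (l, ·)` by the cubic `a t³ + z₁ t + z₀` depending on the parameter
`l`, up to terms of order `n` in `t`: the quotient is `D (l, ·)`, and the remainder is the quadratic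
polynomial with coefficients `q l`. -/
structure IsCubicDivision (a : ℝ) (z₀ z₁ : Λ → ℝ) (n : ℕ) (A D : Λ × ℝ → ℝ) (q : Λ → R3)
    (R : Λ × ℝ → ℝ) : Prop where
  smooth_quotient : ContDiff ℝ ∞ D
  smooth_remainder : ContDiff ℝ ∞ q
  smooth_error : ContDiff ℝ ∞ R
  eq : ∀ l t, A (l, t) = D (l, t) * (a * t ^ 3 + z₁ l * t + z₀ l) +
    ((q l).1 + (q l).2.1 * t + (q l).2.2 * t ^ 2) + t ^ n * R (l, t)

lemma exists_isCubicDivision_pow {z₀ z₁ : Λ → ℝ} (hz₀ : ContDiff ℝ ∞ z₀) (hz₁ : ContDiff ℝ ∞ z₁)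
    {a : ℝ} (ha : a ≠ 0) (n m : ℕ) :
    ∃ D q, IsCubicDivision a z₀ z₁ m (fun p => p.2 ^ n) D q fun _ => 0 := by
  induction n with
  | zero =>
    exact ⟨fun _ => 0, fun _ => (1, 0, 0), contDiff_const, contDiff_const, contDiff_const,
      fun l t => by simp⟩
  | succ n ih =>
    obtain ⟨D, q, h⟩ := ih
    have hD := h.smooth_quotient
    have hq := h.smooth_remainder
    refine ⟨fun p => p.2 * D p + (q p.1).2.2 / a,
      fun l => (-(q l).2.2 * z₀ l / a, (q l).1 - (q l).2.2 * z₁ l / a, (q l).2.1),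
      by fun_prop, by fun_prop, contDiff_const, fun l t => ?_⟩
    have heq := h.eq l t
    simp only at heq ⊢
    rw [pow_succ, heq]
    field_simp
    ring

lemma exists_isCubicDivision {z₀ z₁ : Λ → ℝ} (hz₀ : ContDiff ℝ ∞ z₀) (hz₁ : ContDiff ℝ ∞ z₁)
    {a : ℝ} (ha : a ≠ 0) {A : Λ × ℝ → ℝ} (hA : ContDiff ℝ ∞ A) (n : ℕ) :
    ∃ D q R, IsCubicDivision a z₀ z₁ n A D q R := by
  induction n with
  | zero =>
    exact ⟨fun _ => 0, fun _ => 0, A, contDiff_const, contDiff_const, hA, fun l t => by simp⟩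
  | succ n ih =>
    obtain ⟨D, q, R, h⟩ := ih
    obtain ⟨D', q', h'⟩ := exists_isCubicDivision_pow hz₀ hz₁ ha n n
    obtain ⟨S, hS, hRS⟩ := exists_taylor_remainder ((0, 1) : Λ × ℝ) 1 h.smooth_error
    have hR₀ : ContDiff ℝ ∞ fun l : Λ => R (l, 0) := h.smooth_error.comp (by fun_prop)
    refine ⟨fun p => D p + R (p.1, 0) * D' p, fun l => q l + R (l, 0) • q' l,
      fun p => S ((p.1, 0), p.2),
      h.smooth_quotient.add ((hR₀.comp contDiff_fst).mul h'.smooth_quotient),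
      h.smooth_remainder.add (hR₀.smul h'.smooth_remainder), hS.comp (by fun_prop),
      fun l t => ?_⟩
    have hpow := h'.eq l t
    have hR : R (l, t) = R (l, 0) + t * S ((l, 0), t) := by simpa using hRS (l, 0) t
    rw [h.eq l t, hR]
    simp only [Prod.fst_add, Prod.snd_add, Prod.smul_fst, Prod.smul_snd, smul_eq_mul] at hpow ⊢
    linear_combination R (l, 0) * hpow

variable {E : Type} [NormedAddCommGroup E] [NormedSpace ℝ E] {X : E → ℝ} {e : E} {π : Λ →L[ℝ] E}
  {z₀ z₁ : Λ → ℝ} {a : ℝ} {N : ℕ} {D R : Λ × ℝ → ℝ} {q : Λ → R3}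

lemma coeff_eq_zero_of_cubic_add_eq_zero {c₀ c₁ c₂ c₃ : ℝ} {r : ℝ → ℝ} (hr : ContinuousAt r 0)
    (h : ∀ t, c₀ + c₁ * t + c₂ * t ^ 2 + c₃ * t ^ 3 + t ^ 4 * r t = 0) :
    c₀ = 0 ∧ c₁ = 0 ∧ c₂ = 0 ∧ c₃ = 0 := by
  have hcoeff := coeff_eq_zero_of_sum_eq_zero (n := 4) (c := fun k => [c₀, c₁, c₂, c₃].getD k 0) hr
    (Eventually.of_forall fun t => by
      rw [← h t]
      simp only [Finset.sum_range_succ, Finset.sum_range_zero, List.getD_cons_zero,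
        List.getD_cons_succ, smul_eq_mul]
      ring)
  exact ⟨hcoeff 0 (by simp), hcoeff 1 (by simp), hcoeff 2 (by simp), hcoeff 3 (by simp)⟩

lemma exists_cubic_taylor_remainder (hX : ContDiff ℝ ∞ X) (e : E) :
    ∃ T : E × ℝ → ℝ, ContDiff ℝ ∞ T ∧ ∀ x t, X (x + t • e) = X x + dirDeriv e X x * t +
      (dirDeriv e)^[2] X x / 2 * t ^ 2 + (dirDeriv e)^[3] X x / 6 * t ^ 3 + t ^ 4 * T (x, t) := by
  obtain ⟨T, hT, hXT⟩ := exists_taylor_remainder e 4 hX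
  refine ⟨T, hT, fun x t => ?_⟩
  rw [hXT]
  simp only [Finset.sum_range_succ, Finset.sum_range_zero, Nat.factorial, smul_eq_mul,
    Function.iterate_zero, Function.iterate_one, id]
  push_cast
  ring

lemma IsCubicDivision.coeff_eq
    (h : IsCubicDivision a z₀ z₁ (N + 4) (fun p => X (π p.1 + p.2 • e)) D q R)
    (hX : ContDiff ℝ ∞ X) (l : Λ) :
    q l = (X (π l) - D (l, 0) * z₀ l,
      dirDeriv e X (π l) - dirDeriv (0, 1) D (l, 0) * z₀ l - D (l, 0) * z₁ l,
      (dirDeriv e)^[2] X (π l) / 2 - (dirDeriv (0, 1))^[2] D (l, 0) / 2 * z₀ l -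
        dirDeriv (0, 1) D (l, 0) * z₁ l) ∧
    (dirDeriv e)^[3] X (π l) / 6 = a * D (l, 0) + (dirDeriv (0, 1))^[2] D (l, 0) / 2 * z₁ l +
      (dirDeriv (0, 1))^[3] D (l, 0) / 6 * z₀ l := by
  obtain ⟨T, hT, hXT⟩ := exists_cubic_taylor_remainder hX e
  obtain ⟨S, hS, hDS⟩ := exists_cubic_taylor_remainder h.smooth_quotient (0, 1)
  set d₁ := dirDeriv (0, 1) D (l, 0)
  set d₂ := (dirDeriv (0, 1))^[2] D (l, 0) / 2
  set d₃ := (dirDeriv (0, 1))^[3] D (l, 0) / 6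
  have hDt (t : ℝ) :
      D (l, t) = D (l, 0) + d₁ * t + d₂ * t ^ 2 + d₃ * t ^ 3 + t ^ 4 * S ((l, 0), t) := by
    rw [← hDS (l, 0) t]
    simp
  have hcont : Continuous fun t => T (π l, t) - t ^ N * R (l, t) -
      (a * (d₁ + d₂ * t + d₃ * t ^ 2 + t ^ 3 * S ((l, 0), t)) +
        z₁ l * (d₃ + t * S ((l, 0), t)) + z₀ l * S ((l, 0), t)) := by
    have hTc := hT.continuous
    have hRc := h.smooth_error.continuous
    have hSc := hS.continuous
    fun_prop
  obtain ⟨h₀, h₁, h₂, h₃⟩ := coeff_eq_zero_of_cubic_add_eq_zero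
    (c₀ := X (π l) - D (l, 0) * z₀ l - (q l).1)
    (c₁ := dirDeriv e X (π l) - d₁ * z₀ l - D (l, 0) * z₁ l - (q l).2.1)
    (c₂ := (dirDeriv e)^[2] X (π l) / 2 - d₂ * z₀ l - d₁ * z₁ l - (q l).2.2)
    (c₃ := (dirDeriv e)^[3] X (π l) / 6 - (a * D (l, 0) + d₂ * z₁ l + d₃ * z₀ l))
    hcont.continuousAt fun t => by
      have heq := h.eq l t
      simp only [hXT, hDt t, pow_add] at heq
      linear_combination heq
  exact ⟨Prod.ext (sub_eq_zero.1 h₀).symm (Prod.ext (sub_eq_zero.1 h₁).symm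
    (sub_eq_zero.1 h₂).symm), sub_eq_zero.1 h₃⟩

lemma hasFDerivAt_mul_of_eq_zero {c z : Λ → ℝ} (hc : ContDiff ℝ ∞ c) (hz : ContDiff ℝ ∞ z)
    (hz0 : z 0 = 0) : HasFDerivAt (fun l => c l * z l) (c 0 • fderiv ℝ z 0) 0 := by
  have := (hc.differentiable (by simp) 0).hasFDerivAt.mul
    (hz.differentiable (by simp) 0).hasFDerivAt
  rw [hz0, zero_smul, add_zero] at this
  exact this

lemma IsCubicDivision.fderiv_remainder {z₀ z₁ : Λ →L[ℝ] ℝ}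
    (h : IsCubicDivision a z₀ z₁ (N + 4) (fun p => X (π p.1 + p.2 • e)) D q R)
    (hX : ContDiff ℝ ∞ X) (v : Λ) :
    fderiv ℝ q 0 v = (fderiv ℝ X 0 (π v) - D 0 * z₀ v,
      fderiv ℝ (dirDeriv e X) 0 (π v) - dirDeriv (0, 1) D 0 * z₀ v - D 0 * z₁ v,
      fderiv ℝ ((dirDeriv e)^[2] X) 0 (π v) / 2 - (dirDeriv (0, 1))^[2] D 0 / 2 * z₀ v -
        dirDeriv (0, 1) D 0 * z₁ v) := by
  have hX₁ := contDiff_dirDeriv hX e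
  have hX₂ := contDiff_dirDeriv hX₁ e
  have hD := h.smooth_quotient
  have hD₁ := contDiff_dirDeriv hD (0, 1)
  have hD₂ := contDiff_dirDeriv hD₁ (0, 1)
  have hcomp {Y : E → ℝ} (hY : ContDiff ℝ ∞ Y) :
      HasFDerivAt (fun l => Y (π l)) (fderiv ℝ Y 0 ∘L π) 0 := by
    rw [← map_zero π]
    exact (hY.differentiable (by simp) _).hasFDerivAt.comp 0 π.hasFDerivAt
  have hmul {B : Λ × ℝ → ℝ} (hB : ContDiff ℝ ∞ B) (z : Λ →L[ℝ] ℝ) :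
      HasFDerivAt (fun l => B (l, 0) * z l) (B 0 • z) 0 := by
    have := hasFDerivAt_mul_of_eq_zero (c := fun l => B (l, 0)) (hB.comp (by fun_prop))
      z.contDiff (map_zero z)
    rwa [z.fderiv] at this
  have hq := funext fun l => (h.coeff_eq hX l).1
  have hq' := ((hcomp hX).sub (hmul hD z₀)).prodMk
      ((((hcomp hX₁).sub (hmul hD₁ z₀)).sub (hmul hD z₁)).prodMk
      ((((hcomp hX₂).mul_const 2⁻¹).sub (hmul (hD₂.div_const 2) z₀)).sub (hmul hD₁ z₁)))
  rw [hq]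
  refine (congrArg (· v) hq'.fderiv).trans ?_
  simp [div_eq_inv_mul]

end CubicDivision

/-! ### The cusp chart -/

section CuspDivision

/-- The base point `(u₀, u₁, s)` of the parameter `((u₀, u₁), (s, z₀, z₁))`. -/
def divisionBase : (ℝ × ℝ) × R3 →L[ℝ] R3 :=
  (ContinuousLinearEquiv.prodAssoc ℝ ℝ ℝ ℝ : (ℝ × ℝ) × ℝ →L[ℝ] R3) ∘L
    (ContinuousLinearMap.id ℝ (ℝ × ℝ)).prodMap (.fst ℝ ℝ (ℝ × ℝ))

/-- The constant coefficient `z₀` of the parameter `((u₀, u₁), (s, z₀, z₁))`. -/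
def divisionCoeff₀ : (ℝ × ℝ) × R3 →L[ℝ] ℝ :=
  .fst ℝ ℝ ℝ ∘L .snd ℝ ℝ (ℝ × ℝ) ∘L .snd ℝ (ℝ × ℝ) R3

/-- The linear coefficient `z₁` of the parameter `((u₀, u₁), (s, z₀, z₁))`. -/
def divisionCoeff₁ : (ℝ × ℝ) × R3 →L[ℝ] ℝ :=
  .snd ℝ ℝ ℝ ∘L .snd ℝ ℝ (ℝ × ℝ) ∘L .snd ℝ (ℝ × ℝ) R3

/-- Division with remainder of `t ↦ X (u₀, u₁, s + t)` by `a t³ + z₁ t + z₀`, with all of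
`((u₀, u₁), (s, z₀, z₁))` as parameters. -/
abbrev IsCuspDivision (X : R3 → ℝ) (a : ℝ) (N : ℕ) (D : ((ℝ × ℝ) × R3) × ℝ → ℝ)
    (q : (ℝ × ℝ) × R3 → R3) (R : ((ℝ × ℝ) × R3) × ℝ → ℝ) : Prop :=
  IsCubicDivision a divisionCoeff₀ divisionCoeff₁ (N + 4)
    (fun p => X (divisionBase p.1 + p.2 • (0, 0, 1))) D q R

variable {X : R3 → ℝ} {m a : ℝ} {N : ℕ} {D R : ((ℝ × ℝ) × R3) × ℝ → ℝ}
  {q : (ℝ × ℝ) × R3 → R3}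

lemma IsCuspDivision.quotient_zero_pos (h : IsCuspDivision X a N D q R)
    (hX : IsCuspUnfolding X m) (ham : 0 < m / a) : 0 < D 0 := by
  have ha : a ≠ 0 := by rintro rfl; simp at ham
  have hcoeff := (h.coeff_eq hX.smooth 0).2
  have hm : (dτ)^[3] X 0 = m := hX.dτ₃
  simp only [map_zero, hm, mul_zero, add_zero] at hcoeff
  have hD : D 0 = m / a / 6 := by
    rw [← Prod.mk_zero_zero]
    field_simp
    linarith
  rw [hD]
  positivity

lemma IsCuspDivision.remainder_zero (h : IsCuspDivision X a N D q R) (hX : IsCuspUnfolding X m) :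
    q 0 = 0 := by
  have hτ₂ : (dτ)^[2] X 0 = 0 := hX.dτ₂_zero
  rw [(h.coeff_eq hX.smooth 0).1]
  simp only [map_zero, hX.zero, hX.dτ_zero, hτ₂, zero_div, mul_zero, sub_zero, Prod.mk_zero_zero]

lemma IsCuspDivision.fderiv_remainder_apply (h : IsCuspDivision X a N D q R)
    (hX : IsCuspUnfolding X m) (v₀ v₁ s z₀ z₁ : ℝ) :
    fderiv ℝ q 0 ((v₀, v₁), (s, z₀, z₁)) = (v₀ * du₀ X 0 - D 0 * z₀,
      v₀ * du₀ (dτ X) 0 + v₁ * du₁ (dτ X) 0 - dirDeriv (0, 1) D 0 * z₀ - D 0 * z₁,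
      (v₀ * du₀ (dτ (dτ X)) 0 + v₁ * du₁ (dτ (dτ X)) 0 + s * m) / 2 -
        (dirDeriv (0, 1))^[2] D 0 / 2 * z₀ - dirDeriv (0, 1) D 0 * z₁) := by
  have hbase : divisionBase ((v₀, v₁), (s, z₀, z₁)) = (v₀, v₁, s) := rfl
  have hcoeff₀ : divisionCoeff₀ ((v₀, v₁), (s, z₀, z₁)) = z₀ := rfl
  have hcoeff₁ : divisionCoeff₁ ((v₀, v₁), (s, z₀, z₁)) = z₁ := rfl
  rw [h.fderiv_remainder hX.smooth, hbase, hcoeff₀, hcoeff₁]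
  simp only [fderiv_R3_apply, smul_eq_mul, hX.du₁_zero, hX.dτ_zero, hX.dτ₂_zero, hX.dτ₃,
    Function.iterate_succ_apply, Function.iterate_zero, id, mul_zero, add_zero]

lemma IsCuspDivision.isInvertible_fderiv_remainder (h : IsCuspDivision X a N D q R)
    (hX : IsCuspUnfolding X m) (ham : 0 < m / a) :
    (fderiv ℝ q 0 ∘L .inr ℝ (ℝ × ℝ) R3).IsInvertible := by
  have hD := (h.quotient_zero_pos hX ham).ne'
  have hm : m ≠ 0 := by rintro rfl; simp at ham
  refine isInvertible_of_ker_eq_bot ?_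
  rintro ⟨s, z₀, z₁⟩ hv
  have hv' := (h.fderiv_remainder_apply hX 0 0 s z₀ z₁).symm.trans hv
  simp only [zero_mul, add_zero, zero_sub, zero_add, Prod.mk_eq_zero] at hv'
  obtain ⟨h₀, h₁, h₂⟩ := hv'
  obtain rfl : z₀ = 0 := by simpa [hD] using h₀
  obtain rfl : z₁ = 0 := by simpa [hD] using h₁
  obtain rfl : s = 0 := by simpa [hm] using h₂
  rfl

lemma IsCuspDivision.exists_remainder_eq_zero (h : IsCuspDivision X a N D q R)
    (hX : IsCuspUnfolding X m) (ham : 0 < m / a) :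
    ∃ ψ : ℝ × ℝ → R3, ContDiff ℝ ∞ ψ ∧ ψ 0 = 0 ∧ (∀ᶠ u in 𝓝 0, q (u, ψ u) = 0) ∧
      ∀ v, (fderiv ℝ ψ 0 v).2 = 0 → v = 0 := by
  obtain ⟨ψ, hψ, hψ0, hψq⟩ := exists_contDiff_implicitFunction h.smooth_remainder
    (h.remainder_zero hX) (h.isInvertible_fderiv_remainder hX ham)
  have hψ0 : ψ 0 = 0 := hψ0
  have hcont : Tendsto (fun u => (u, ψ u)) (𝓝 0) (𝓝 (0 : (ℝ × ℝ) × R3)) := by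
    have : ContinuousAt (fun u => (u, ψ u)) 0 := (continuous_id.prodMk hψ.continuous).continuousAt
    rwa [ContinuousAt, hψ0] at this
  have hq : ∀ᶠ u in 𝓝 0, q (u, ψ u) = 0 := (hcont.eventually hψq).mono fun u hu => hu.2 rfl
  refine ⟨ψ, hψ, hψ0, hq, ?_⟩
  rintro ⟨v₀, v₁⟩ hv
  have hqψ := fderiv_apply_fderiv_of_eventually_eq_zero
    (h.smooth_remainder.differentiable (by simp) _) (hψ.differentiable (by simp) 0) hq (v₀, v₁)
  have hv' : fderiv ℝ ψ 0 (v₀, v₁) = ((fderiv ℝ ψ 0 (v₀, v₁)).1, 0, 0) := Prod.ext rfl hv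
  rw [hψ0, Prod.mk_zero_zero, hv', h.fderiv_remainder_apply hX] at hqψ
  simp only [mul_zero, sub_zero, Prod.mk_eq_zero, mul_eq_zero, hX.du₀_ne, or_false] at hqψ
  obtain ⟨rfl, h₁, -⟩ := hqψ
  obtain rfl : v₁ = 0 := by simpa [hX.du₁_dτ_ne] using h₁
  rfl

end CuspDivision

section CuspChart

/-- The change of coordinates `(u, τ) ↦ (z₀ u, z₁ u, τ - s u)`, where `ψ = (s, z₀, z₁)`. -/
def cuspCoord (ψ : ℝ × ℝ → R3) (w : R3) : R3 :=
  ((ψ (w.1, w.2.1)).2.1, (ψ (w.1, w.2.1)).2.2, w.2.2 - (ψ (w.1, w.2.1)).1)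

variable {ψ : ℝ × ℝ → R3}

lemma cuspCoord_zero (hψ0 : ψ 0 = 0) : cuspCoord ψ 0 = 0 := by
  have hψ00 : ψ (0, 0) = 0 := hψ0
  simp [cuspCoord, hψ00]

lemma contDiff_cuspCoord (hψ : ContDiff ℝ ∞ ψ) : ContDiff ℝ ∞ (cuspCoord ψ) := by
  unfold cuspCoord
  fun_prop

lemma fderiv_cuspCoord_apply (hψ : Differentiable ℝ ψ) (w v : R3) :
    fderiv ℝ (cuspCoord ψ) w v = ((fderiv ℝ ψ (w.1, w.2.1) (v.1, v.2.1)).2.1,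
      (fderiv ℝ ψ (w.1, w.2.1) (v.1, v.2.1)).2.2,
      v.2.2 - (fderiv ℝ ψ (w.1, w.2.1) (v.1, v.2.1)).1) := by
  have hsnd : HasFDerivAt Prod.snd (.snd ℝ ℝ (ℝ × ℝ)) w := hasFDerivAt_snd
  have hu : HasFDerivAt (fun w : R3 => (w.1, w.2.1)) _ w := hasFDerivAt_fst.prodMk hsnd.fst
  have hψu := (hψ (w.1, w.2.1)).hasFDerivAt.comp w hu
  exact congrArg (· v) (hψu.snd.fst.prodMk
    (hψu.snd.snd.prodMk (hsnd.snd.sub hψu.fst))).fderiv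

lemma fderiv_cuspCoord_vertical (hψ : Differentiable ℝ ψ) (w : R3) (t : ℝ) :
    fderiv ℝ (cuspCoord ψ) w (0, 0, t) = (0, 0, t) := by
  rw [fderiv_cuspCoord_apply hψ, Prod.mk_zero_zero, ContinuousLinearMap.map_zero]
  simp

lemma isInvertible_fderiv_cuspCoord (hψ : Differentiable ℝ ψ)
    (hψ' : ∀ v, (fderiv ℝ ψ 0 v).2 = 0 → v = 0) :
    (fderiv ℝ (cuspCoord ψ) 0).IsInvertible := by
  refine isInvertible_of_ker_eq_bot ?_
  rintro ⟨v₀, v₁, t⟩ hv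
  rw [fderiv_cuspCoord_apply hψ] at hv
  simp only [Prod.fst_zero, Prod.snd_zero, Prod.mk_zero_zero, Prod.mk_eq_zero] at hv
  obtain ⟨h₀, h₁, h₂⟩ := hv
  obtain ⟨rfl, rfl⟩ := Prod.mk_eq_zero.1 (hψ' (v₀, v₁) (Prod.ext h₀ h₁))
  rw [Prod.mk_zero_zero, ContinuousLinearMap.map_zero, Prod.fst_zero, sub_zero] at h₂
  rw [h₂]
  rfl

/-- The chart `H` transforms the vector field `(0, 0, X)` into the cusp normal form with remainder
`r = O(z₂ ^ N)`, up to the positive factor `μ`. -/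
structure IsCuspChart (X : R3 → ℝ) (a : ℝ) (N : ℕ) (H : OpenPartialHomeomorph R3 R3)
    (μ r : R3 → ℝ) : Prop where
  zero_mem : (0 : R3) ∈ H.source
  map_zero : H 0 = 0
  smooth : ContDiffOn ℝ ∞ H H.source
  smooth_symm : ContDiffOn ℝ ∞ H.symm H.target
  smooth_factor : ContDiffOn ℝ ∞ μ H.source
  factor_pos : ∀ w ∈ H.source, 0 < μ w
  smooth_remainder : ContDiffOn ℝ ∞ r H.target
  abs_remainder_le : ∀ z ∈ H.target, |r z| ≤ |z.2.2| ^ N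
  fderiv_apply : ∀ w ∈ H.source, fderiv ℝ H w (0, 0, X w) = μ w • cuspField a r (H w)

variable {X : R3 → ℝ} {m a : ℝ}

lemma IsCuspUnfolding.exists_eq_mul_cusp_add (hX : IsCuspUnfolding X m) (ham : 0 < m / a)
    (N : ℕ) : ∃ (ψ : ℝ × ℝ → R3) (μ ρ : R3 → ℝ), ContDiff ℝ ∞ ψ ∧ ContDiff ℝ ∞ μ ∧
      ContDiff ℝ ∞ ρ ∧ ψ 0 = 0 ∧ (∀ v, (fderiv ℝ ψ 0 v).2 = 0 → v = 0) ∧ 0 < μ 0 ∧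
      ∀ᶠ w in 𝓝 0, X w = μ w * (a * (cuspCoord ψ w).2.2 ^ 3 +
        (cuspCoord ψ w).2.1 * (cuspCoord ψ w).2.2 + (cuspCoord ψ w).1) +
          (cuspCoord ψ w).2.2 ^ (N + 4) * ρ w := by
  have ha : a ≠ 0 := by rintro rfl; simp at ham
  have hXs := hX.smooth
  obtain ⟨D, q, R, h⟩ : ∃ D q R, IsCuspDivision X a N D q R :=
    exists_isCubicDivision divisionCoeff₀.contDiff divisionCoeff₁.contDiff ha
      (hXs.comp (by fun_prop)) (N + 4)
  obtain ⟨ψ, hψ, hψ0, hψq, hψ'⟩ := h.exists_remainder_eq_zero hX ham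
  let point : R3 → ((ℝ × ℝ) × R3) × ℝ :=
    fun w => (((w.1, w.2.1), ψ (w.1, w.2.1)), (cuspCoord ψ w).2.2)
  have hpoint : ContDiff ℝ ∞ point := by
    have := contDiff_cuspCoord hψ
    fun_prop
  refine ⟨ψ, fun w => D (point w), fun w => R (point w), hψ, h.smooth_quotient.comp hpoint,
    h.smooth_error.comp hpoint, hψ0, hψ', ?_, ?_⟩
  · have : point 0 = 0 := by
      change (((0, 0), ψ 0), (cuspCoord ψ 0).2.2) = 0
      rw [cuspCoord_zero hψ0, hψ0]
      rfl
    simpa only [this] using h.quotient_zero_pos hX ham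
  have hproj : Tendsto (fun w : R3 => (w.1, w.2.1)) (𝓝 0) (𝓝 0) :=
    (by fun_prop : Continuous fun w : R3 => (w.1, w.2.1)).tendsto 0
  filter_upwards [hproj.eventually hψq] with w hw
  have hbase : divisionBase (point w).1 + (point w).2 • (0, 0, 1) = w := by
    change (w.1, w.2.1, (ψ (w.1, w.2.1)).1) + (w.2.2 - (ψ (w.1, w.2.1)).1) • (0, 0, 1) = w
    simp
  have heq := h.eq (point w).1 (point w).2
  simp only [hbase, point, hw, Prod.fst_zero, Prod.snd_zero, zero_mul, add_zero] at heq
  exact heq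

lemma exists_isCuspChart (hX : IsCuspUnfolding X m) (ham : 0 < m / a) (N : ℕ) :
    ∃ H μ r, IsCuspChart X a N H μ r := by
  obtain ⟨ψ, μ, ρ, hψ, hμ, hρ, hψ0, hψ', hμ0, heq⟩ := hX.exists_eq_mul_cusp_add ham N
  have hψd := hψ.differentiable (by simp)
  have hcoord := contDiff_cuspCoord hψ
  have hcoord0 := cuspCoord_zero hψ0
  obtain ⟨e, h0e, hec, hesymm⟩ := exists_openPartialHomeomorph_contDiffOn_symm hcoord
    (isInvertible_fderiv_cuspCoord hψd hψ')
  have hsmall : ∀ᶠ w in 𝓝 0, |(cuspCoord ψ w).2.2 ^ 4 * ρ w / μ w| < 1 := by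
    refine ContinuousAt.eventually_lt
      (ContinuousAt.abs (.div ?_ hμ.continuous.continuousAt hμ0.ne')) continuousAt_const
      (by simp [hcoord0])
    exact ((hcoord.continuous.snd.snd.pow 4).mul hρ.continuous).continuousAt
  obtain ⟨s, hs, hso, h0s⟩ := eventually_nhds_iff.1
    ((hμ.continuous.continuousAt.eventually (lt_mem_nhds hμ0)).and (hsmall.and heq))
  let H := e.restrOpen s hso
  have hH : ⇑H = cuspCoord ψ := hec
  let r : R3 → ℝ := fun w => (cuspCoord ψ w).2.2 ^ (N + 4) * ρ w / μ w
  have hsymm : ContDiffOn ℝ ∞ H.symm H.target := hesymm.mono inter_subset_left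
  have hr : ContDiffOn ℝ ∞ r H.source := ((hcoord.snd.snd.pow _).mul hρ).contDiffOn.div
    hμ.contDiffOn fun w hw => (hs w hw.2).1.ne'
  exact ⟨H, μ, fun z => r (H.symm z), {
    zero_mem := ⟨h0e, h0s⟩
    map_zero := by rw [hH, hcoord0]
    smooth := hH ▸ hcoord.contDiffOn
    smooth_symm := hsymm
    smooth_factor := hμ.contDiffOn
    factor_pos := fun w hw => (hs w hw.2).1
    smooth_remainder := hr.comp hsymm fun z hz => H.map_target hz
    abs_remainder_le := fun z hz => by
      have hz2 : (cuspCoord ψ (H.symm z)).2.2 = z.2.2 := by rw [← hH, H.right_inv hz]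
      rw [← hz2]
      simp only [r]
      rw [pow_add, mul_assoc, mul_div_assoc, abs_mul, abs_pow]
      exact mul_le_of_le_one_right (by positivity) (hs _ (H.map_target hz).2).2.1.le
    fderiv_apply := fun w hw => by
      obtain ⟨hμw, -, hw'⟩ := hs w hw.2
      rw [hH, fderiv_cuspCoord_vertical hψd, cuspField, hw', ← hH, H.left_inv hw, hH]
      refine Prod.ext (by simp) (Prod.ext (by simp) ?_)
      simp only [Prod.smul_mk, smul_eq_mul, r]
      field_simp }⟩

end CuspChart

/-! ### Scalar differential equations -/

section ODE

lemma exists_lipschitzOnWith_union_image {E : Type*} [PseudoMetricSpace E] {F : E → E}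
    {φ ψ : ℝ → E} (hF : LocallyLipschitz F) {a b : ℝ}
    (hφ : ContinuousOn φ (Icc a b)) (hψ : ContinuousOn ψ (Icc a b)) :
    ∃ K, LipschitzOnWith K F (φ '' Icc a b ∪ ψ '' Icc a b) :=
  hF.locallyLipschitzOn.exists_lipschitzOnWith_of_compact
    ((isCompact_Icc.image_of_continuousOn hφ).union (isCompact_Icc.image_of_continuousOn hψ))

variable {E : Type*} [NormedAddCommGroup E] [NormedSpace ℝ E] {F : E → E} {φ ψ : ℝ → E}

lemma eqOn_Icc_of_isIntegralCurveOn_of_eq_left (hF : LocallyLipschitz F) {a b : ℝ}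
    (hφ : IsIntegralCurveOn φ (fun _ => F) (Icc a b))
    (hψ : IsIntegralCurveOn ψ (fun _ => F) (Icc a b)) (h : φ a = ψ a) : EqOn φ ψ (Icc a b) := by
  obtain ⟨K, hK⟩ := exists_lipschitzOnWith_union_image hF hφ.continuousOn hψ.continuousOn
  exact ODE_solution_unique_of_mem_Icc_right (v := fun _ => F) (fun _ _ => hK) hφ.continuousOn
    (fun t ht => (hφ t (Ico_subset_Icc_self ht)).mono_of_mem_nhdsWithin (Icc_mem_nhdsGE_of_mem ht))
    (fun t ht => .inl (mem_image_of_mem _ (Ico_subset_Icc_self ht))) hψ.continuousOn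
    (fun t ht => (hψ t (Ico_subset_Icc_self ht)).mono_of_mem_nhdsWithin (Icc_mem_nhdsGE_of_mem ht))
    (fun t ht => .inr (mem_image_of_mem _ (Ico_subset_Icc_self ht))) h

lemma eqOn_Icc_of_isIntegralCurveOn_of_eq_right (hF : LocallyLipschitz F) {a b : ℝ}
    (hφ : IsIntegralCurveOn φ (fun _ => F) (Icc a b))
    (hψ : IsIntegralCurveOn ψ (fun _ => F) (Icc a b)) (h : φ b = ψ b) : EqOn φ ψ (Icc a b) := by
  obtain ⟨K, hK⟩ := exists_lipschitzOnWith_union_image hF hφ.continuousOn hψ.continuousOn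
  exact ODE_solution_unique_of_mem_Icc_left (v := fun _ => F) (fun _ _ => hK) hφ.continuousOn
    (fun t ht => (hφ t (Ioc_subset_Icc_self ht)).mono_of_mem_nhdsWithin (Icc_mem_nhdsLE_of_mem ht))
    (fun t ht => .inl (mem_image_of_mem _ (Ioc_subset_Icc_self ht))) hψ.continuousOn
    (fun t ht => (hψ t (Ioc_subset_Icc_self ht)).mono_of_mem_nhdsWithin (Icc_mem_nhdsLE_of_mem ht))
    (fun t ht => .inr (mem_image_of_mem _ (Ioc_subset_Icc_self ht))) h

lemma eqOn_Ici_of_isIntegralCurveOn (hF : LocallyLipschitz F)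
    (hφ : IsIntegralCurveOn φ (fun _ => F) (Ici 0)) (hψ : IsIntegralCurveOn ψ (fun _ => F) (Ici 0))
    (h : φ 0 = ψ 0) : EqOn φ ψ (Ici 0) := fun _ hT =>
  eqOn_Icc_of_isIntegralCurveOn_of_eq_left hF (hφ.mono Icc_subset_Ici_self)
    (hψ.mono Icc_subset_Ici_self) h ⟨hT, le_rfl⟩

lemma isIntegralCurveOn_Ici_of_forall_nat {v : ℝ → E → E}
    (h : ∀ n : ℕ, IsIntegralCurveOn φ v (Icc 0 n)) : IsIntegralCurveOn φ v (Ici 0) := by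
  intro t ht
  obtain ⟨n, hn⟩ := exists_nat_gt t
  refine (h n t ⟨ht, hn.le⟩).mono_of_mem_nhdsWithin ?_
  rw [← Ici_inter_Iic]
  exact inter_mem_nhdsWithin _ (Iic_mem_nhds hn)

lemma exists_isIntegralCurveOn_Ici [CompleteSpace E] {K M : NNReal} (hK : LipschitzWith K F)
    (hM : ∀ x, ‖F x‖ ≤ M) (x₀ : E) :
    ∃ φ : ℝ → E, φ 0 = x₀ ∧ IsIntegralCurveOn φ (fun _ => F) (Ici 0) := by
  have hlocal : ∀ n : ℕ, ∃ α : ℝ → E, α 0 = x₀ ∧ IsIntegralCurveOn α (fun _ => F) (Icc 0 n) := by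
    intro n
    have : IsPicardLindelof (fun _ => F) (⟨0, le_rfl, Nat.cast_nonneg n⟩ : Icc (0 : ℝ) n) x₀
        (M * n) 0 M K :=
      IsPicardLindelof.of_time_independent (fun x _ => hM x) hK.lipschitzOnWith (by simp)
    exact this.exists_eq_forall_mem_Icc_hasDerivWithinAt₀
  choose α hα0 hα using hlocal
  have hagree : ∀ {n m : ℕ}, n ≤ m → EqOn (α n) (α m) (Icc 0 n) := fun hnm =>
    eqOn_Icc_of_isIntegralCurveOn_of_eq_left hK.locallyLipschitz (hα _)
      ((hα _).mono (Icc_subset_Icc_right (Nat.cast_le.2 hnm))) ((hα0 _).trans (hα0 _).symm)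
  have hglue : ∀ n : ℕ, EqOn (fun t => α ⌈t⌉₊ t) (α n) (Icc 0 n) := fun n t ht =>
    hagree (Nat.ceil_le.2 ht.2) ⟨ht.1, Nat.le_ceil t⟩
  refine ⟨fun t => α ⌈t⌉₊ t, by simp [hα0], isIntegralCurveOn_Ici_of_forall_nat fun n t ht => ?_⟩
  have := (hα n t ht).congr (hglue n) (hglue n ht)
  rwa [← hglue n ht] at this

lemma eq_zero_of_isIntegralCurveOn_of_tendsto {q : E} (hF : ContinuousAt F q)
    (hφ : IsIntegralCurveOn φ (fun _ => F) (Ici 0)) (hlim : Tendsto φ atTop (𝓝 q)) : F q = 0 := by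
  refine norm_le_zero_iff.1 (le_of_forall_pos_le_add fun ε hε => ?_)
  rw [zero_add]
  have hnear : ∀ᶠ t in atTop, ‖F (φ t) - F q‖ < ε := by
    simpa only [dist_eq_norm, Function.comp_apply] using
      Metric.tendsto_nhds.1 (hF.tendsto.comp hlim) ε hε
  obtain ⟨T, hT⟩ := eventually_atTop.1 (hnear.and (eventually_ge_atTop 0))
  have hderiv : ∀ t ∈ Ici T,
      HasDerivWithinAt (fun t => φ t - t • F q) (F (φ t) - F q) (Ici T) t := by
    intro t ht
    have hφt := (hφ t (hT t ht).2).mono (Ici_subset_Ici.2 (hT T le_rfl).2)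
    have hlin : HasDerivWithinAt (fun t : ℝ => t • F q) (F q) (Ici T) t := by
      simpa using (hasDerivWithinAt_id t (Ici T)).smul_const (F q)
    exact hφt.sub hlin
  have hstep : ∀ t ∈ Ici T, ‖φ (t + 1) - φ t - F q‖ ≤ ε := by
    intro t ht
    have := (convex_Ici T).norm_image_sub_le_of_norm_hasDerivWithin_le hderiv
      (fun s hs => (hT s hs).1.le) ht (mem_Ici.2 (le_add_of_le_of_nonneg ht zero_le_one))
    rw [add_sub_cancel_left, norm_one, mul_one] at this
    convert this using 2
    rw [add_smul, one_smul]
    abel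
  have hlim' : Tendsto (fun t => ‖φ (t + 1) - φ t - F q‖) atTop (𝓝 ‖q - q - F q‖) :=
    (((hlim.comp (tendsto_atTop_add_const_right _ 1 tendsto_id)).sub hlim).sub_const _).norm
  rw [sub_self, zero_sub, norm_neg] at hlim'
  exact le_of_tendsto hlim' ((eventually_ge_atTop T).mono hstep)

end ODE

section Scalar

variable {g y : ℝ → ℝ} {r t δ y₀ L : ℝ}

lemma ne_equilibrium_of_isIntegralCurveOn (hg : LocallyLipschitz g) (hr : g r = 0)
    (hy : IsIntegralCurveOn y (fun _ => g) (Ici 0)) (h0 : y 0 ≠ r) {s : ℝ} (hs : 0 ≤ s) :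
    y s ≠ r := fun h =>
  h0 (eqOn_Icc_of_isIntegralCurveOn_of_eq_right hg (hy.mono Icc_subset_Ici_self)
    ((isIntegralCurve_const (v := fun _ => g) fun _ => hr).isIntegralCurveOn _) h ⟨le_rfl, hs⟩)

lemma lt_equilibrium_of_isIntegralCurveOn (hg : LocallyLipschitz g) (hr : g r = 0)
    (hy : IsIntegralCurveOn y (fun _ => g) (Ici 0)) (h0 : y 0 < r) {s : ℝ} (hs : 0 ≤ s) :
    y s < r := by
  by_contra! hle
  obtain ⟨s', hs', hrs'⟩ := intermediate_value_Icc hs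
    (hy.continuousOn.mono Icc_subset_Ici_self) ⟨h0.le, hle⟩
  exact ne_equilibrium_of_isIntegralCurveOn hg hr hy h0.ne hs'.1 hrs'

lemma equilibrium_lt_of_isIntegralCurveOn (hg : LocallyLipschitz g) (hr : g r = 0)
    (hy : IsIntegralCurveOn y (fun _ => g) (Ici 0)) (h0 : r < y 0) {s : ℝ} (hs : 0 ≤ s) :
    r < y s := by
  by_contra! hle
  obtain ⟨s', hs', hrs'⟩ := intermediate_value_Icc' hs
    (hy.continuousOn.mono Icc_subset_Ici_self) ⟨hle, h0.le⟩
  exact ne_equilibrium_of_isIntegralCurveOn hg hr hy h0.ne' hs'.1 hrs'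

lemma le_equilibrium_of_isIntegralCurveOn (hg : LocallyLipschitz g) (hr : g r = 0)
    (hy : IsIntegralCurveOn y (fun _ => g) (Ici 0)) (h0 : y 0 ≤ r) {s : ℝ} (hs : 0 ≤ s) :
    y s ≤ r := by
  rcases h0.lt_or_eq with hlt | heq
  · exact (lt_equilibrium_of_isIntegralCurveOn hg hr hy hlt hs).le
  · exact (eqOn_Ici_of_isIntegralCurveOn hg hy
      ((isIntegralCurve_const (v := fun _ => g) fun _ => hr).isIntegralCurveOn _) heq hs).le

lemma monotoneOn_of_isIntegralCurveOn (hy : IsIntegralCurveOn y (fun _ => g) (Ici 0))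
    (h : ∀ s, 0 ≤ s → 0 ≤ g (y s)) : MonotoneOn y (Ici 0) := by
  have hderiv : ∀ s ∈ interior (Ici 0), HasDerivAt y (g (y s)) s := by
    intro s hs
    rw [interior_Ici] at hs
    exact (hy s (Ioi_subset_Ici_self hs)).hasDerivAt (Ici_mem_nhds hs)
  refine monotoneOn_of_deriv_nonneg (convex_Ici 0) hy.continuousOn
    (fun s hs => (hderiv s hs).differentiableAt.differentiableWithinAt) fun s hs => ?_
  rw [(hderiv s hs).deriv]
  exact h s (interior_subset hs)

lemma exists_isIntegralCurveOn_mem_Icc {a b : ℝ} (hab : a ≤ b) {K : NNReal}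
    (hg : LipschitzOnWith K g (Icc a b)) (hnonneg : ∀ x ∈ Icc a b, 0 ≤ g x) (hb : g b = 0) :
    ∃ y : ℝ → ℝ, y 0 = a ∧ IsIntegralCurveOn y (fun _ => g) (Ici 0) ∧
      ∀ s, 0 ≤ s → y s ∈ Icc a b := by
  let clamp : ℝ → ℝ := fun x => projIcc a b hab x
  have hclamp : ∀ x, clamp x ∈ Icc a b := fun x => (projIcc a b hab x).2
  have hclamp_eq : ∀ x ∈ Icc a b, clamp x = x := fun x hx => by
    simp only [clamp, projIcc_of_mem hab hx]
  have hlip : LipschitzWith K (g ∘ clamp) := by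
    have := hg.comp (((LipschitzWith.subtype_val _).comp
      (LipschitzWith.projIcc hab)).lipschitzOnWith (s := univ)) fun x _ => hclamp x
    rwa [lipschitzOnWith_univ, mul_one, mul_one] at this
  obtain ⟨M, hM⟩ := isCompact_Icc.exists_bound_of_continuousOn hg.continuousOn
  lift M to NNReal using (norm_nonneg _).trans (hM b ⟨hab, le_rfl⟩)
  obtain ⟨y, hy0, hy⟩ := exists_isIntegralCurveOn_Ici hlip (fun x => hM _ (hclamp x)) a
  have hmem : ∀ s, 0 ≤ s → y s ∈ Icc a b := fun s hs =>
    ⟨hy0 ▸ monotoneOn_of_isIntegralCurveOn hy (fun s _ => hnonneg _ (hclamp _)) self_mem_Ici hs hs,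
      le_equilibrium_of_isIntegralCurveOn hlip.locallyLipschitz
        ((congrArg g (hclamp_eq b ⟨hab, le_rfl⟩)).trans hb) hy (hy0.trans_le hab) hs⟩
  refine ⟨y, hy0, fun s hs => ?_, hmem⟩
  simpa only [Function.comp_apply, hclamp_eq _ (hmem s hs)] using hy s hs

lemma exists_tendsto_of_monotoneOn_Ici {a b : ℝ} (hmono : MonotoneOn y (Ici 0))
    (hmem : ∀ s, 0 ≤ s → y s ∈ Icc a b) : ∃ L ∈ Icc a b, Tendsto y atTop (𝓝 L) := by
  have hmono' : Monotone fun s => y (max s 0) := fun s s' hs =>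
    hmono (le_max_right s 0) (le_max_right s' 0) (max_le_max_right 0 hs)
  have hlim := tendsto_atTop_ciSup hmono'
    ⟨b, forall_mem_range.2 fun s => (hmem _ (le_max_right s 0)).2⟩
  refine ⟨_, isClosed_Icc.mem_of_tendsto hlim (.of_forall fun s => hmem _ (le_max_right s 0)),
    hlim.congr' ?_⟩
  filter_upwards [eventually_ge_atTop 0] with s hs
  rw [max_eq_left hs]

/-- The forward trajectory of `y₀` under the scalar field `g` stays in `(-δ, δ)` and converges
to `L`. -/
def ScalarConverges (g : ℝ → ℝ) (δ y₀ L : ℝ) : Prop :=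
  ∃ y : ℝ → ℝ, y 0 = y₀ ∧ IsIntegralCurveOn y (fun _ => g) (Ici 0) ∧
    (∀ s, 0 ≤ s → |y s| < δ) ∧ Tendsto y atTop (𝓝 L)

lemma ScalarConverges.of_eq_zero (h : g y₀ = 0) (hy₀ : |y₀| < δ) : ScalarConverges g δ y₀ y₀ :=
  ⟨fun _ => y₀, rfl, (isIntegralCurve_const (v := fun _ => g) fun _ => h).isIntegralCurveOn _,
    fun _ _ => hy₀, tendsto_const_nhds⟩

lemma ScalarConverges.of_pos (hg : ContDiff ℝ 1 g) (hy₀ : -δ < y₀) (hyr : y₀ ≤ r) (hrδ : r < δ)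
    (hpos : ∀ x ∈ Ico y₀ r, 0 < g x) (hr : g r = 0) : ScalarConverges g δ y₀ r := by
  obtain ⟨K, hK⟩ := hg.locallyLipschitz.locallyLipschitzOn.exists_lipschitzOnWith_of_compact
    (isCompact_Icc (a := y₀) (b := r))
  have hnonneg : ∀ x ∈ Icc y₀ r, 0 ≤ g x := fun x hx => by
    rcases hx.2.lt_or_eq with hlt | rfl
    exacts [(hpos x ⟨hx.1, hlt⟩).le, hr.ge]
  obtain ⟨y, hy0, hy, hmem⟩ := exists_isIntegralCurveOn_mem_Icc hyr hK hnonneg hr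
  obtain ⟨L, hL, hlim⟩ := exists_tendsto_of_monotoneOn_Ici
    (monotoneOn_of_isIntegralCurveOn hy fun s hs => hnonneg _ (hmem s hs)) hmem
  have hgL := eq_zero_of_isIntegralCurveOn_of_tendsto hg.continuous.continuousAt hy hlim
  obtain rfl : L = r := hL.2.eq_of_not_lt fun hlt => (hpos L ⟨hL.1, hlt⟩).ne' hgL
  exact ⟨y, hy0, hy, fun s hs => abs_lt.2 ⟨hy₀.trans_le (hmem s hs).1, (hmem s hs).2.trans_lt hrδ⟩,
    hlim⟩

lemma ScalarConverges.reflect (h : ScalarConverges g δ y₀ L) :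
    ScalarConverges (fun x => -g (-x)) δ (-y₀) (-L) := by
  obtain ⟨y, hy0, hy, hmem, hlim⟩ := h
  refine ⟨fun s => -y s, congrArg Neg.neg hy0, fun s hs => ?_,
    fun s hs => by rw [abs_neg]; exact hmem s hs, hlim.neg⟩
  simp only [neg_neg]
  exact (hy s hs).fun_neg

lemma scalarConverges_reflect_iff :
    ScalarConverges (fun x => -g (-x)) δ (-y₀) (-L) ↔ ScalarConverges g δ y₀ L :=
  ⟨fun h => by simpa only [neg_neg] using h.reflect, .reflect⟩

lemma exists_scalarConverges_of_pos (hg : ContDiff ℝ 1 g) (hδ : g δ < 0) (hy₀ : |y₀| < δ)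
    (hpos : 0 < g y₀) : ∃ L, |L| < δ ∧ ScalarConverges g δ y₀ L := by
  rw [abs_lt] at hy₀
  let Z : Set ℝ := {x ∈ Icc y₀ δ | g x ≤ 0}
  have hZ : IsClosed Z := isClosed_Icc.inter (isClosed_le hg.continuous continuous_const)
  obtain ⟨L, ⟨hLmem, hgL⟩, hLmin⟩ := (isCompact_Icc.of_isClosed_subset hZ fun x hx =>
    hx.1).exists_isLeast ⟨δ, ⟨hy₀.2.le, le_rfl⟩, hδ.le⟩
  have hposL : ∀ x ∈ Ico y₀ L, 0 < g x := fun x hx => by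
    by_contra! hle
    exact hx.2.not_ge (hLmin ⟨⟨hx.1, hx.2.le.trans hLmem.2⟩, hle⟩)
  have hyL : y₀ < L := hLmem.1.lt_of_ne fun h => hgL.not_gt (h ▸ hpos)
  have hgL0 : g L = 0 := hgL.antisymm <| ge_of_tendsto
    (hg.continuous.continuousWithinAt (s := Iio L)) <| by
      filter_upwards [Ioo_mem_nhdsLT hyL] with x hx using (hposL x (Ioo_subset_Ico_self hx)).le
  have hLδ : L < δ := hLmem.2.lt_of_ne fun h => (h ▸ hδ).ne hgL0
  exact ⟨L, abs_lt.2 ⟨hy₀.1.trans hyL, hLδ⟩, .of_pos hg hy₀.1 hyL.le hLδ hposL hgL0⟩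

lemma exists_scalarConverges (hg : ContDiff ℝ 1 g) (hδ : g δ < 0) (hδ' : 0 < g (-δ))
    (hy₀ : |y₀| < δ) : ∃ L, |L| < δ ∧ g L = 0 ∧ ScalarConverges g δ y₀ L := by
  suffices ∃ L, |L| < δ ∧ ScalarConverges g δ y₀ L by
    obtain ⟨L, hLδ, h⟩ := this
    obtain ⟨y, -, hy, -, hlim⟩ := id h
    exact ⟨L, hLδ, eq_zero_of_isIntegralCurveOn_of_tendsto hg.continuous.continuousAt hy hlim, h⟩
  rcases lt_trichotomy (g y₀) 0 with h | h | h
  · obtain ⟨L, hLδ, hL⟩ := exists_scalarConverges_of_pos (g := fun x => -g (-x)) (δ := δ)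
      (y₀ := -y₀) (hg.comp contDiff_neg).neg (by linarith) (by rwa [abs_neg]) (by simpa using h)
    exact ⟨-L, by rwa [abs_neg], scalarConverges_reflect_iff.1 (by rwa [neg_neg])⟩
  · exact ⟨y₀, hy₀, .of_eq_zero h hy₀⟩
  · exact exists_scalarConverges_of_pos hg hδ hy₀ h

/-- The scalar field `g` on `(-δ, δ)` has a zero `r` and exactly one further zero `t` on the side of
`r` given by the sign `ε = ±1`; on that side it points towards `r`, so that `t` is half-stable. -/
structure IsHalfStablePair (g : ℝ → ℝ) (δ r t ε : ℝ) : Prop where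
  contDiff : ContDiff ℝ 1 g
  eq_one_or : ε = 1 ∨ ε = -1
  abs_sink_lt : |r| < δ
  abs_source_lt : |t| < δ
  side : 0 < ε * (t - r)
  sink_eq_zero : g r = 0
  eq_zero : g t = 0
  neg : ∀ x, |x| < δ → x ≠ t → 0 < ε * (x - r) → ε * g x < 0

lemma IsHalfStablePair.reflect {ε : ℝ} (h : IsHalfStablePair g δ r t ε) :
    IsHalfStablePair (fun x => -g (-x)) δ (-r) (-t) (-ε) where
  contDiff := (h.contDiff.comp contDiff_neg).neg
  eq_one_or := h.eq_one_or.symm.imp (by rintro rfl; simp) (by rintro rfl; rfl)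
  abs_sink_lt := by rw [abs_neg]; exact h.abs_sink_lt
  abs_source_lt := by rw [abs_neg]; exact h.abs_source_lt
  side := by linarith [h.side]
  sink_eq_zero := by rw [neg_neg, h.sink_eq_zero, neg_zero]
  eq_zero := by rw [neg_neg, h.eq_zero, neg_zero]
  neg := fun x hx hxt hxr => by
    have := h.neg (-x) (by rwa [abs_neg]) (fun h => hxt (by rw [← h, neg_neg])) (by linarith)
    linarith

lemma IsHalfStablePair.neg_of_mem_Ioo (h : IsHalfStablePair g δ r t 1) {x : ℝ} (hx : x ∈ Ioo r δ)
    (hxt : x ≠ t) : g x < 0 := by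
  simpa using h.neg x (abs_lt.2 ⟨(abs_lt.1 h.abs_sink_lt).1.trans hx.1, hx.2⟩) hxt
    (by linarith [hx.1])

lemma IsHalfStablePair.lt_of_scalarConverges (h : IsHalfStablePair g δ r t 1)
    (hconv : ScalarConverges (fun x => -g x) δ y₀ t) : r < y₀ := by
  obtain ⟨y, rfl, hy, -, hlim⟩ := hconv
  by_contra! hle
  have htr : t ≤ r := le_of_tendsto hlim <| (eventually_ge_atTop 0).mono fun s =>
    le_equilibrium_of_isIntegralCurveOn h.contDiff.neg.locallyLipschitz
      (neg_eq_zero.2 h.sink_eq_zero) hy hle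
  linarith [h.side]

lemma IsHalfStablePair.le_of_scalarConverges (h : IsHalfStablePair g δ r t 1)
    (hconv : ScalarConverges (fun x => -g x) δ y₀ t) : y₀ ≤ t := by
  obtain ⟨y, rfl, hy, hmem, hlim⟩ := hconv
  by_contra! hlt
  have habove : ∀ s, 0 ≤ s → t < y s := fun s => equilibrium_lt_of_isIntegralCurveOn
    h.contDiff.neg.locallyLipschitz (neg_eq_zero.2 h.eq_zero) hy hlt
  have hmono : MonotoneOn y (Ici 0) := monotoneOn_of_isIntegralCurveOn hy fun s hs => by
    have hrt := h.side
    have := h.neg_of_mem_Ioo ⟨by linarith [habove s hs], (abs_lt.1 (hmem s hs)).2⟩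
      (habove s hs).ne'
    linarith
  exact hlt.not_ge (ge_of_tendsto hlim ((eventually_ge_atTop 0).mono fun s hs =>
    hmono self_mem_Ici hs hs))

lemma IsHalfStablePair.scalarConverges_neg_iff {ε : ℝ} (h : IsHalfStablePair g δ r t ε) :
    ScalarConverges (fun x => -g x) δ y₀ t ↔ 0 < ε * (y₀ - r) ∧ 0 ≤ ε * (t - y₀) := by
  wlog hε : ε = 1 generalizing g r t ε y₀
  · have := this (y₀ := -y₀) h.reflect (by rw [h.eq_one_or.resolve_left hε, neg_neg])
    rw [scalarConverges_reflect_iff (g := fun x => -g x)] at this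
    rw [this]
    constructor <;> rintro ⟨h₁, h₂⟩ <;> constructor <;> linarith
  subst hε
  simp only [one_mul, sub_pos, sub_nonneg]
  refine ⟨fun hc => ⟨h.lt_of_scalarConverges hc, h.le_of_scalarConverges hc⟩,
    fun ⟨hr, ht⟩ => .of_pos h.contDiff.neg ((abs_lt.1 h.abs_sink_lt).1.trans hr) ht
      (abs_lt.1 h.abs_source_lt).2 (fun x hx => ?_) (neg_eq_zero.2 h.eq_zero)⟩
  exact neg_pos.2
    (h.neg_of_mem_Ioo ⟨hr.trans_le hx.1, hx.2.trans (abs_lt.1 h.abs_source_lt).2⟩ hx.2.ne)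

lemma IsHalfStablePair.scalarConverges {ε : ℝ} (h : IsHalfStablePair g δ r t ε)
    (hr : 0 < ε * (y₀ - r)) (ht : 0 < ε * (t - y₀)) : ScalarConverges g δ y₀ r := by
  wlog hε : ε = -1 generalizing g r t ε y₀
  · exact scalarConverges_reflect_iff.1 (this h.reflect (by linarith) (by linarith)
      (by rw [h.eq_one_or.resolve_right hε]))
  subst hε
  refine .of_pos h.contDiff (by linarith [(abs_lt.1 h.abs_source_lt).1]) (by linarith)
    (abs_lt.1 h.abs_sink_lt).2 (fun x hx => ?_) h.sink_eq_zero
  have := h.neg x (abs_lt.2 ⟨by linarith [hx.1, (abs_lt.1 h.abs_source_lt).1],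
    hx.2.trans (abs_lt.1 h.abs_sink_lt).2⟩) (by rintro rfl; linarith [hx.1]) (by linarith [hx.2])
  linarith

end Scalar

lemma isIntegralCurveOn_comp_neg {E : Type*} [NormedAddCommGroup E] [NormedSpace ℝ E] {F : E → E}
    {φ : ℝ → E} {s s' : Set ℝ} (hφ : IsIntegralCurveOn φ (fun _ => F) s)
    (hs : MapsTo (fun t => -t) s' s) :
    IsIntegralCurveOn (fun t => φ (-t)) (fun _ x => -F x) s' := fun t ht => by
  have := (hφ (-t) (hs ht)).scomp t (hasDerivWithinAt_neg t s') hs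
  rwa [neg_one_smul] at this

section Convergence

variable {F : R3 → R3} {U : Set R3} {p q q' : R3}

lemma ConvergesForward.comp_neg (h : ConvergesForward F U p q) :
    ConvergesBackward (fun x => -F x) U p q := by
  obtain ⟨φ, hφ0, hφ, hU, hlim⟩ := h
  exact ⟨fun t => φ (-t), by simp only [neg_zero, hφ0],
    isIntegralCurveOn_comp_neg hφ fun _ ht => mem_Ici.2 (neg_nonneg.2 ht),
    fun t ht => hU _ (mem_Ici.2 (neg_nonneg.2 ht)), hlim.comp tendsto_neg_atBot_atTop⟩

lemma ConvergesBackward.comp_neg (h : ConvergesBackward F U p q) :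
    ConvergesForward (fun x => -F x) U p q := by
  obtain ⟨φ, hφ0, hφ, hU, hlim⟩ := h
  exact ⟨fun t => φ (-t), by simp only [neg_zero, hφ0],
    isIntegralCurveOn_comp_neg hφ fun _ ht => mem_Iic.2 (neg_nonpos.2 ht),
    fun t ht => hU _ (mem_Iic.2 (neg_nonpos.2 ht)), hlim.comp tendsto_neg_atTop_atBot⟩

lemma convergesForward_neg_iff :
    ConvergesForward (fun x => -F x) U p q ↔ ConvergesBackward F U p q :=
  ⟨fun h => by simpa only [neg_neg] using h.comp_neg, ConvergesBackward.comp_neg⟩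

lemma convergesBackward_neg_iff :
    ConvergesBackward (fun x => -F x) U p q ↔ ConvergesForward F U p q :=
  ⟨fun h => by simpa only [neg_neg] using h.comp_neg, ConvergesForward.comp_neg⟩

lemma ConvergesForward.unique (hF : LocallyLipschitz F) (h : ConvergesForward F U p q)
    (h' : ConvergesForward F U p q') : q = q' := by
  obtain ⟨φ, hφ0, hφ, -, hlim⟩ := h
  obtain ⟨ψ, hψ0, hψ, -, hlim'⟩ := h'
  refine tendsto_nhds_unique hlim (hlim'.congr' ?_)
  filter_upwards [eventually_ge_atTop 0] with t ht using
    (eqOn_Ici_of_isIntegralCurveOn hF hφ hψ (hφ0.trans hψ0.symm) ht).symm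

end Convergence

/-- The coordinate box `{|u₀| < ε₀, |u₁| < ε₁, |τ| < δ}` around the origin. -/
def box (ε₀ ε₁ δ : ℝ) : Set R3 := {w | |w.1| < ε₀ ∧ |w.2.1| < ε₁ ∧ |w.2.2| < δ}

lemma isOpen_box (ε₀ ε₁ δ : ℝ) : IsOpen (box ε₀ ε₁ δ) :=
  (isOpen_lt (f := fun w : R3 => |w.1|) (by fun_prop) continuous_const).inter
    ((isOpen_lt (f := fun w : R3 => |w.2.1|) (by fun_prop) continuous_const).inter
      (isOpen_lt (f := fun w : R3 => |w.2.2|) (by fun_prop) continuous_const))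

lemma eqOn_Ici_const_of_hasDerivWithinAt_zero {E : Type*} [NormedAddCommGroup E] [NormedSpace ℝ E]
    {c : ℝ → E} (hc : ∀ t ∈ Ici (0 : ℝ), HasDerivWithinAt c 0 (Ici 0) t) :
    EqOn c (fun _ => c 0) (Ici 0) :=
  eqOn_Ici_of_isIntegralCurveOn (F := fun _ => 0) (LipschitzWith.const 0).locallyLipschitz hc
    ((isIntegralCurve_const (v := fun _ _ => (0 : E)) fun _ => rfl).isIntegralCurveOn _) rfl

lemma eq_mk_of_isIntegralCurveOn_vertical {Y : R3 → ℝ} {ψ : ℝ → R3}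
    (hψ : IsIntegralCurveOn ψ (fun _ w => (0, 0, Y w)) (Ici 0)) {t : ℝ} (ht : 0 ≤ t) :
    ψ t = ((ψ 0).1, (ψ 0).2.1, (ψ t).2.2) :=
  Prod.ext (eqOn_Ici_const_of_hasDerivWithinAt_zero (c := fun t => (ψ t).1)
      (fun t ht => (hψ t ht).fst) ht)
    (Prod.ext (eqOn_Ici_const_of_hasDerivWithinAt_zero (c := fun t => (ψ t).2.1)
      (fun t ht => (hψ t ht).snd.fst) ht) rfl)

lemma convergesForward_vertical_iff {Y : R3 → ℝ} {ε₀ ε₁ δ : ℝ} {w w' : R3}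
    (hw : w ∈ box ε₀ ε₁ δ) :
    ConvergesForward (fun w => (0, 0, Y w)) (box ε₀ ε₁ δ) w w' ↔
      w'.1 = w.1 ∧ w'.2.1 = w.2.1 ∧
        ScalarConverges (fun y => Y (w.1, w.2.1, y)) δ w.2.2 w'.2.2 := by
  constructor
  · rintro ⟨ψ, rfl, hψ, hmem, hlim⟩
    have heq := fun t ht => eq_mk_of_isIntegralCurveOn_vertical hψ (t := t) ht
    have hlim' : Tendsto (fun t => ((ψ 0).1, (ψ 0).2.1, (ψ t).2.2)) atTop (𝓝 w') :=
      hlim.congr' ((eventually_ge_atTop 0).mono heq)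
    refine ⟨tendsto_nhds_unique (hlim'.fst_nhds) tendsto_const_nhds,
      tendsto_nhds_unique (hlim'.snd_nhds.fst_nhds) tendsto_const_nhds, fun t => (ψ t).2.2, rfl,
      fun t ht => ?_, fun t ht => (hmem t ht).2.2, hlim'.snd_nhds.snd_nhds⟩
    simp only [← heq t ht]
    exact (hψ t ht).snd.snd
  · rintro ⟨h₀, h₁, y, hy0, hy, hmem, hlim⟩
    refine ⟨fun t => (w.1, w.2.1, y t), by simp only [hy0],
      fun t ht => (hasDerivWithinAt_const _ _ _).prodMk
        ((hasDerivWithinAt_const _ _ _).prodMk (hy t ht)),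
      fun t ht => ⟨hw.1, hw.2.1, hmem t ht⟩, ?_⟩
    rw [← h₀, ← h₁]
    exact tendsto_const_nhds.prodMk_nhds (tendsto_const_nhds.prodMk_nhds hlim)

section FlowBox

variable {F : R3 → R3} {Φ : OpenPartialHomeomorph R3 R3} {Y : R3 → ℝ}

lemma IsFlowBox.convergesForward_image_iff (h : IsFlowBox Φ Y F) {B : Set R3}
    (hB : B ⊆ Φ.source) {w w' : R3} (hw : w ∈ B) (hw' : w' ∈ B) :
    ConvergesForward F (Φ '' B) (Φ w) (Φ w') ↔
      ConvergesForward (fun w => (0, 0, Y w)) B w w' := by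
  constructor
  · rintro ⟨φ, hφ0, hφ, hmem, hlim⟩
    choose! ψ hψB hψ using hmem
    have hsymm : ∀ t ∈ Ici (0 : ℝ), Φ.symm (φ t) = ψ t := fun t ht => by
      rw [← hψ t ht, Φ.left_inv (hB (hψB t ht))]
    refine ⟨fun t => Φ.symm (φ t), by simp only [hφ0, Φ.left_inv (hB hw)], fun t ht => ?_,
      fun t ht => by simpa only [hsymm t ht] using hψB t ht, ?_⟩
    · have hmem : ψ t ∈ Φ.source := hB (hψB t ht)
      have hderiv := ((h.smooth_symm.contDiffAt (Φ.open_target.mem_nhds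
        (Φ.map_source hmem))).differentiableAt (by simp)).hasFDerivAt
      rw [hψ t ht] at hderiv
      have := hderiv.comp_hasDerivWithinAt t (hφ t ht)
      rwa [← hψ t ht, h.fderiv_symm_apply hmem, ← Φ.left_inv hmem, hψ t ht] at this
    · have := (Φ.continuousAt_symm (Φ.map_source (hB hw'))).tendsto.comp hlim
      rwa [Φ.left_inv (hB hw')] at this
  · rintro ⟨ψ, hψ0, hψ, hmem, hlim⟩
    refine ⟨fun t => Φ (ψ t), congrArg Φ hψ0, fun t ht => ?_,
      fun t ht => mem_image_of_mem _ (hmem t ht), (h.smooth.continuous.tendsto _).comp hlim⟩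
    simp only [← h.fderiv_apply _ (hB (hmem t ht))]
    exact ((h.smooth.differentiable (by simp)) _).hasFDerivAt.comp_hasDerivWithinAt t (hψ t ht)

lemma IsFlowBox.convergesForward_iff (h : IsFlowBox Φ Y F) {ε₀ ε₁ δ : ℝ}
    (hB : box ε₀ ε₁ δ ⊆ Φ.source) {w w' : R3} (hw : w ∈ box ε₀ ε₁ δ) (hw' : w' ∈ box ε₀ ε₁ δ) :
    ConvergesForward F (Φ '' box ε₀ ε₁ δ) (Φ w) (Φ w') ↔
      w'.1 = w.1 ∧ w'.2.1 = w.2.1 ∧ ScalarConverges (fun y => Y (w.1, w.2.1, y)) δ w.2.2 w'.2.2 :=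
  (h.convergesForward_image_iff hB hw hw').trans (convergesForward_vertical_iff hw)

lemma IsFlowBox.neg (h : IsFlowBox Φ Y F) : IsFlowBox Φ (fun w => -Y w) fun p => -F p where
  zero_mem := h.zero_mem
  map_zero := h.map_zero
  smooth := h.smooth
  smooth_symm := h.smooth_symm
  fderiv_apply w hw := by
    rw [← h.fderiv_apply w hw, ← map_neg]
    simp

lemma IsFlowBox.convergesBackward_iff (h : IsFlowBox Φ Y F) {ε₀ ε₁ δ : ℝ}
    (hB : box ε₀ ε₁ δ ⊆ Φ.source) {w w' : R3} (hw : w ∈ box ε₀ ε₁ δ) (hw' : w' ∈ box ε₀ ε₁ δ) :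
    ConvergesBackward F (Φ '' box ε₀ ε₁ δ) (Φ w) (Φ w') ↔ w'.1 = w.1 ∧ w'.2.1 = w.2.1 ∧
      ScalarConverges (fun y => -Y (w.1, w.2.1, y)) δ w.2.2 w'.2.2 := by
  rw [← convergesForward_neg_iff, h.neg.convergesForward_iff hB hw hw']

end FlowBox

/-! ### The fold curve -/

section DoubleZeros

variable {X Y : R3 → ℝ} {a b : ℝ → ℝ} {m t : ℝ}

/-- The point at height `t` on the curve `u = (a t, b t)`, `τ = t`. -/
def curvePoint (a b : ℝ → ℝ) (t : ℝ) : R3 := (a t, b t, t)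

lemma contDiff_curvePoint (ha : ContDiff ℝ ∞ a) (hb : ContDiff ℝ ∞ b) :
    ContDiff ℝ ∞ (curvePoint a b) :=
  ha.prodMk (hb.prodMk contDiff_id)

lemma curvePoint_zero (ha0 : a 0 = 0) (hb0 : b 0 = 0) : curvePoint a b 0 = 0 := by
  simp [curvePoint, ha0, hb0]

lemma hasDerivAt_curvePoint (ha : DifferentiableAt ℝ a t) (hb : DifferentiableAt ℝ b t) :
    HasDerivAt (curvePoint a b) (deriv a t, deriv b t, 1) t :=
  ha.hasDerivAt.prodMk (hb.hasDerivAt.prodMk (hasDerivAt_id t))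

lemma hasDerivAt_comp_curvePoint (hX : DifferentiableAt ℝ X (curvePoint a b t))
    (ha : DifferentiableAt ℝ a t) (hb : DifferentiableAt ℝ b t) :
    HasDerivAt (fun t => X (curvePoint a b t)) (deriv a t * du₀ X (curvePoint a b t) +
      deriv b t * du₁ X (curvePoint a b t) + dτ X (curvePoint a b t)) t := by
  refine (hX.hasFDerivAt.comp_hasDerivAt t (hasDerivAt_curvePoint ha hb)).congr_deriv ?_
  simp [fderiv_R3_apply, add_assoc]

lemma eventually_deriv_comp_curvePoint_eq_zero (hX : Differentiable ℝ X) (ha : Differentiable ℝ a)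
    (hb : Differentiable ℝ b) (h : ∀ᶠ t in 𝓝 0, X (curvePoint a b t) = 0) :
    ∀ᶠ t in 𝓝 0, deriv a t * du₀ X (curvePoint a b t) + deriv b t * du₁ X (curvePoint a b t) +
      dτ X (curvePoint a b t) = 0 := by
  have h : (fun t => X (curvePoint a b t)) =ᶠ[𝓝 0] fun _ => 0 := h
  filter_upwards [h.deriv] with t ht
  rw [← (hasDerivAt_comp_curvePoint (hX _) (ha t) (hb t)).deriv, ht, deriv_const]

lemma exists_zeros_eq_curvePoint {Z : R3 → ℝ × ℝ} (hZ : ContDiff ℝ ∞ Z) (hZ0 : Z 0 = 0)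
    (hker : ∀ v₀ v₁ : ℝ, fderiv ℝ Z 0 (v₀, v₁, 0) = 0 → v₀ = 0 ∧ v₁ = 0) :
    ∃ a b : ℝ → ℝ, ContDiff ℝ ∞ a ∧ ContDiff ℝ ∞ b ∧ a 0 = 0 ∧ b 0 = 0 ∧
      ∀ᶠ w in 𝓝 0, Z w = 0 ↔ w = curvePoint a b w.2.2 := by
  let L : R3 →L[ℝ] R3 := .prod (.comp (.fst ℝ ℝ ℝ) (.snd ℝ ℝ (ℝ × ℝ)))
    (.prod (.comp (.snd ℝ ℝ ℝ) (.snd ℝ ℝ (ℝ × ℝ))) (.fst ℝ ℝ (ℝ × ℝ)))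
  have hZ' : HasFDerivAt Z (fderiv ℝ Z 0) (L 0) := by
    rw [map_zero]
    exact (hZ.differentiable (by simp) 0).hasFDerivAt
  have hinv : (fderiv ℝ (Z ∘ L) 0 ∘L .inr ℝ ℝ (ℝ × ℝ)).IsInvertible := by
    refine isInvertible_of_ker_eq_bot ?_
    rintro ⟨v₀, v₁⟩ hv
    rw [(hZ'.comp 0 L.hasFDerivAt).fderiv] at hv
    obtain ⟨rfl, rfl⟩ := hker v₀ v₁ hv
    rfl
  obtain ⟨ψ, hψ, hψ0, hψZ⟩ := exists_contDiff_implicitFunction (hZ.comp L.contDiff)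
    ((congrArg Z (map_zero L)).trans hZ0) hinv
  have hψ0 : ψ 0 = 0 := hψ0
  refine ⟨fun t => (ψ t).1, fun t => (ψ t).2, hψ.fst, hψ.snd, by simp [hψ0], by simp [hψ0], ?_⟩
  have hK : Continuous fun w : R3 => (w.2.2, w.1, w.2.1) := by fun_prop
  filter_upwards [(hK.tendsto 0).eventually hψZ] with w hw
  refine Iff.trans hw ?_
  simp [curvePoint, Prod.ext_iff]

lemma IsCuspUnfolding.exists_doubleZeros_eq_curvePoint (hY : IsCuspUnfolding Y m) :
    ∃ a b : ℝ → ℝ, ContDiff ℝ ∞ a ∧ ContDiff ℝ ∞ b ∧ a 0 = 0 ∧ b 0 = 0 ∧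
      ∀ᶠ w in 𝓝 (0 : R3), (Y w = 0 ∧ dτ Y w = 0) ↔ w = curvePoint a b w.2.2 := by
  have hτ := contDiff_dirDeriv hY.smooth (0, 0, 1)
  simp only [← Prod.mk_eq_zero]
  refine exists_zeros_eq_curvePoint (hY.smooth.prodMk hτ) ?_ fun v₀ v₁ hv => ?_
  · rw [hY.zero, hY.dτ_zero, Prod.mk_zero_zero]
  rw [((hY.smooth.differentiable (by simp) 0).hasFDerivAt.prodMk
    (hτ.differentiable (by simp) 0).hasFDerivAt).fderiv] at hv
  simp only [ContinuousLinearMap.prod_apply, fderiv_R3_apply, Prod.mk_eq_zero] at hv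
  obtain ⟨h₀, h₁⟩ := hv
  obtain rfl : v₀ = 0 := by simpa [hY.du₁_zero, hY.du₀_ne] using h₀
  obtain rfl : v₁ = 0 := by simpa [hY.du₁_dτ_ne] using h₁
  exact ⟨rfl, rfl⟩

lemma IsCuspUnfolding.deriv_eq_zero_of_doubleZeros (hY : IsCuspUnfolding Y m)
    (ha : ContDiff ℝ ∞ a) (hb : ContDiff ℝ ∞ b) (ha0 : a 0 = 0) (hb0 : b 0 = 0)
    (h₀ : ∀ᶠ t in 𝓝 0, Y (curvePoint a b t) = 0)
    (h₁ : ∀ᶠ t in 𝓝 0, dτ Y (curvePoint a b t) = 0) : deriv a 0 = 0 ∧ deriv b 0 = 0 := by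
  have hτ := contDiff_dirDeriv hY.smooth (0, 0, 1)
  have ha' := ha.differentiable (by simp)
  have hb' := hb.differentiable (by simp)
  have e₀ := (eventually_deriv_comp_curvePoint_eq_zero (hY.smooth.differentiable (by simp))
    ha' hb' h₀).self_of_nhds
  have e₁ := (eventually_deriv_comp_curvePoint_eq_zero (hτ.differentiable (by simp))
    ha' hb' h₁).self_of_nhds
  rw [curvePoint_zero ha0 hb0] at e₀ e₁
  have ha₁ : deriv a 0 = 0 := by simpa [hY.du₁_zero, hY.dτ_zero, hY.du₀_ne] using e₀
  exact ⟨ha₁, by simpa [ha₁, hY.dτ₂_zero, hY.du₁_dτ_ne] using e₁⟩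

lemma deriv_deriv_comp_curvePoint_eq_zero (hX : ContDiff ℝ ∞ X) (ha : ContDiff ℝ ∞ a)
    (hb : ContDiff ℝ ∞ b) (ha0 : a 0 = 0) (hb0 : b 0 = 0) (ha₁ : deriv a 0 = 0)
    (hb₁ : deriv b 0 = 0) (h : ∀ᶠ t in 𝓝 0, X (curvePoint a b t) = 0) :
    deriv (deriv a) 0 * du₀ X 0 + deriv (deriv b) 0 * du₁ X 0 + dτ (dτ X) 0 = 0 := by
  have ha' := ha.differentiable (by simp)
  have hb' := hb.differentiable (by simp)
  have hc0 := curvePoint_zero ha0 hb0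
  have hcomp {Z : R3 → ℝ} (hZ : ContDiff ℝ ∞ Z) :
      HasDerivAt (fun t => Z (curvePoint a b t)) (dτ Z 0) 0 := by
    simpa [ha₁, hb₁, hc0] using
      hasDerivAt_comp_curvePoint (hZ.differentiable (by simp) _) (ha' 0) (hb' 0)
  have hda := ((contDiff_infty_iff_deriv.1 ha).2.differentiable (by simp) 0).hasDerivAt
  have hdb := ((contDiff_infty_iff_deriv.1 hb).2.differentiable (by simp) 0).hasDerivAt
  have e : (fun t => deriv a t * du₀ X (curvePoint a b t) +
      deriv b t * du₁ X (curvePoint a b t) + dτ X (curvePoint a b t)) =ᶠ[𝓝 0] fun _ => 0 :=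
    eventually_deriv_comp_curvePoint_eq_zero (hX.differentiable (by simp)) ha' hb' h
  have := (((hda.mul (hcomp (contDiff_dirDeriv hX _))).add
    (hdb.mul (hcomp (contDiff_dirDeriv hX _)))).add (hcomp (contDiff_dirDeriv hX _))).unique
      ((hasDerivAt_const 0 (0 : ℝ)).congr_of_eventuallyEq e)
  simpa only [ha₁, hb₁, hc0, zero_mul, add_zero] using this

lemma IsCuspUnfolding.hasDerivAt_deriv_of_doubleZeros (hY : IsCuspUnfolding Y m)
    (ha : ContDiff ℝ ∞ a) (hb : ContDiff ℝ ∞ b) (ha0 : a 0 = 0) (hb0 : b 0 = 0)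
    (h₀ : ∀ᶠ t in 𝓝 0, Y (curvePoint a b t) = 0)
    (h₁ : ∀ᶠ t in 𝓝 0, dτ Y (curvePoint a b t) = 0) :
    HasDerivAt (deriv b) (-m / du₁ (dτ Y) 0) 0 := by
  obtain ⟨ha₁, hb₁⟩ := hY.deriv_eq_zero_of_doubleZeros ha hb ha0 hb0 h₀ h₁
  have e₀ := deriv_deriv_comp_curvePoint_eq_zero hY.smooth ha hb ha0 hb0 ha₁ hb₁ h₀
  have e₁ := deriv_deriv_comp_curvePoint_eq_zero (contDiff_dirDeriv hY.smooth _) ha hb ha0 hb0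
    ha₁ hb₁ h₁
  have ha₂ : deriv (deriv a) 0 = 0 := by simpa [hY.du₁_zero, hY.dτ₂_zero, hY.du₀_ne] using e₀
  refine ((contDiff_infty_iff_deriv.1 hb).2.differentiable (by simp) 0).hasDerivAt.congr_deriv ?_
  rw [eq_div_iff hY.du₁_dτ_ne]
  rw [ha₂, hY.dτ₃] at e₁
  linarith

lemma eventually_mul_pos_of_hasDerivAt_zero {g : ℝ → ℝ} {k : ℝ} (hg0 : g 0 = 0)
    (hg : HasDerivAt g k 0) (hk : k ≠ 0) : ∀ᶠ t in 𝓝 0, t ≠ 0 → 0 < k * t * g t := by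
  have hslope : ∀ᶠ t in 𝓝[≠] 0, 0 < k * slope g 0 t :=
    (hg.tendsto_slope.const_mul k).eventually (lt_mem_nhds (mul_self_pos.2 hk))
  filter_upwards [eventually_nhdsWithin_iff.1 hslope] with t ht ht0
  specialize ht ht0
  have : k * t * g t = t ^ 2 * (k * slope g 0 t) := by
    rw [slope_def_field, hg0]
    field_simp
    ring
  rw [this]
  positivity

end DoubleZeros

section ThirdZero

lemma exists_strictAntiOn_ball {E : Type*} [NormedAddCommGroup E] [NormedSpace ℝ E]
    {S : E × ℝ → ℝ} (hS : ContDiff ℝ ∞ S) (h : dirDeriv (0, 1) S 0 < 0) :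
    ∃ r > 0, ∀ x, ‖x‖ < r → StrictAntiOn (fun y => S (x, y)) (Metric.ball 0 r) := by
  have hev : ∀ᶠ p in 𝓝 0, dirDeriv (0, 1) S p < 0 :=
    (contDiff_dirDeriv hS (0, 1)).continuous.continuousAt.eventually (gt_mem_nhds h)
  obtain ⟨r, hr, hball⟩ := Metric.eventually_nhds_iff_ball.1 hev
  refine ⟨r, hr, fun x hx => strictAntiOn_of_deriv_neg (convex_ball _ _)
    (hS.continuous.comp (by fun_prop)).continuousOn fun y hy => ?_⟩
  rw [Metric.isOpen_ball.interior_eq, mem_ball_zero_iff] at hy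
  have hline : HasDerivAt (fun y : ℝ => (x, y)) ((0 : E), (1 : ℝ)) y :=
    (hasDerivAt_const y x).prodMk (hasDerivAt_id y)
  have hderiv : HasDerivAt (fun y => S (x, y)) (dirDeriv (0, 1) S (x, y)) y :=
    (hS.differentiable (by simp) (x, y)).hasFDerivAt.comp_hasDerivAt y hline
  rw [hderiv.deriv]
  exact hball _ (by simpa [Prod.norm_def] using ⟨hx, hy⟩)

lemma sign_eq_sign_sub_of_strictAntiOn {g : ℝ → ℝ} {s : Set ℝ} {x y : ℝ} (hg : StrictAntiOn g s)
    (hx : x ∈ s) (hy : y ∈ s) (hgx : g x = 0) : SignType.sign (g y) = SignType.sign (x - y) := by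
  rcases lt_trichotomy y x with h | rfl | h
  · rw [sign_pos (hgx ▸ hg hy hx h), sign_pos (sub_pos.2 h)]
  · rw [hgx, sub_self]
  · rw [sign_neg (hgx ▸ hg hx hy h), sign_neg (sub_neg.2 h)]

lemma exists_sign_eq_sign_sub {E : Type*} [NormedAddCommGroup E] [NormedSpace ℝ E]
    [FiniteDimensional ℝ E] {S : E × ℝ → ℝ} (hS : ContDiff ℝ ∞ S) (hS0 : S 0 = 0)
    (hS' : dirDeriv (0, 1) S 0 < 0) :
    ∃ η : E → ℝ, ContDiff ℝ ∞ η ∧ η 0 = 0 ∧ (∀ v, fderiv ℝ S 0 (v, fderiv ℝ η 0 v) = 0) ∧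
      ∀ᶠ p in 𝓝 0, SignType.sign (S p) = SignType.sign (η p.1 - p.2) := by
  have hinv : (fderiv ℝ S 0 ∘L .inr ℝ E ℝ).IsInvertible := by
    refine isInvertible_of_ker_eq_bot fun y hy => ?_
    have hy : fderiv ℝ S 0 (0, y) = 0 := hy
    have hsmul : ((0, y) : E × ℝ) = y • (0, 1) := by simp
    rw [hsmul, map_smul, smul_eq_mul] at hy
    exact (mul_eq_zero.1 hy).resolve_right hS'.ne
  obtain ⟨η, hη, hη0, hzero⟩ := exists_contDiff_implicitFunction hS hS0 hinv
  have hη0 : η 0 = 0 := hη0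
  have hgraph : ∀ᶠ x in 𝓝 0, S (x, η x) = 0 := by
    have hcont : Tendsto (fun x => (x, η x)) (𝓝 0) (𝓝 0) :=
      (continuous_id.prodMk hη.continuous).tendsto' _ _ (by simp [hη0])
    exact (hcont.eventually hzero).mono fun x hx => hx.2 rfl
  refine ⟨η, hη, hη0, fun v => ?_, ?_⟩
  · have := fderiv_apply_fderiv_of_eventually_eq_zero (hS.differentiable (by simp) _)
      (hη.differentiable (by simp) 0) hgraph v
    rwa [hη0, Prod.mk_zero_zero] at this
  obtain ⟨r, hr, hanti⟩ := exists_strictAntiOn_ball hS hS'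
  have hη' : ∀ᶠ x in 𝓝 0, η x ∈ Metric.ball 0 r :=
    hη.continuous.continuousAt.eventually (by rw [hη0]; exact Metric.ball_mem_nhds 0 hr)
  have hfst : Tendsto (Prod.fst : E × ℝ → E) (𝓝 0) (𝓝 0) := continuous_fst.tendsto _
  filter_upwards [hfst.eventually hgraph, hfst.eventually hη', Metric.ball_mem_nhds _ hr]
    with p hp hηp hpr
  obtain ⟨hp₁, hp₂⟩ : ‖p.1‖ < r ∧ ‖p.2‖ < r := by simpa [Prod.norm_def] using hpr
  exact sign_eq_sign_sub_of_strictAntiOn (hanti p.1 hp₁) hηp (mem_ball_zero_iff.2 hp₂) hp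

end ThirdZero

section FoldCurve

variable {Y : R3 → ℝ} {a b : ℝ → ℝ} {m : ℝ}

/-- The curve `u = (a t, b t)` of parameters for which `τ = t` is a double zero of
`τ ↦ Y (u, τ)`, which is then of the sign of `(τ - t)² (ρ t - τ)`. -/
structure IsFoldCurve (Y : R3 → ℝ) (a b ρ : ℝ → ℝ) (k : ℝ) : Prop where
  smooth_a : ContDiff ℝ ∞ a
  smooth_b : ContDiff ℝ ∞ b
  smooth_ρ : ContDiff ℝ ∞ ρ
  a_zero : a 0 = 0
  b_zero : b 0 = 0
  ρ_zero : ρ 0 = 0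
  deriv_a : deriv a 0 = 0
  deriv_b : deriv b 0 = 0
  deriv_ρ : deriv ρ 0 < 0
  doubleZero_iff : ∀ᶠ w in 𝓝 0, (Y w = 0 ∧ dτ Y w = 0) ↔ w = curvePoint a b w.2.2
  deriv_b_sign : ∀ᶠ t in 𝓝 0, t ≠ 0 → 0 < k * t * deriv b t
  sign_eq : ∀ᶠ p in 𝓝 (0 : ℝ × ℝ), SignType.sign (Y (a p.1, b p.1, p.2)) =
    SignType.sign ((p.2 - p.1) ^ 2 * (ρ p.1 - p.2))

lemma IsCuspUnfolding.exists_doubleZero_factorization (hY : IsCuspUnfolding Y m)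
    (ha : ContDiff ℝ ∞ a) (hb : ContDiff ℝ ∞ b) (ha0 : a 0 = 0) (hb0 : b 0 = 0)
    (h₀ : ∀ᶠ t in 𝓝 0, Y (curvePoint a b t) = 0)
    (h₁ : ∀ᶠ t in 𝓝 0, dτ Y (curvePoint a b t) = 0) :
    ∃ S : ℝ × ℝ → ℝ, ContDiff ℝ ∞ S ∧ S 0 = 0 ∧
      (∀ v, fderiv ℝ S 0 v = m / 2 * v.1 + m / 6 * v.2) ∧
      ∀ᶠ t in 𝓝 0, ∀ h, Y (a t, b t, t + h) = h ^ 2 * S (t, h) := by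
  obtain ⟨T, hT, hYT⟩ := exists_cubic_taylor_remainder hY.smooth ((0, 0, 1) : R3)
  have hc0 := curvePoint_zero ha0 hb0
  have hc := contDiff_curvePoint ha hb
  have h₂ := contDiff_dirDeriv (contDiff_dirDeriv hY.smooth (0, 0, 1)) (0, 0, 1)
  have h₃ := contDiff_dirDeriv h₂ (0, 0, 1)
  let K : ℝ × ℝ → ℝ := fun p =>
    dτ (dτ (dτ Y)) (curvePoint a b p.1) / 6 + p.2 * T (curvePoint a b p.1, p.2)
  have hK : ContDiff ℝ ∞ K := ((h₃.comp (hc.comp contDiff_fst)).div_const 6).add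
    (contDiff_snd.mul (hT.comp ((hc.comp contDiff_fst).prodMk contDiff_snd)))
  obtain ⟨hda, hdb⟩ := hY.deriv_eq_zero_of_doubleZeros ha hb ha0 hb0 h₀ h₁
  have hA : HasDerivAt (fun t => dτ (dτ Y) (curvePoint a b t) / 2) (m / 2) (0 : ℝ × ℝ).1 := by
    have := hasDerivAt_comp_curvePoint (h₂.differentiable (by simp) (curvePoint a b 0))
      (ha.differentiable (by simp) 0) (hb.differentiable (by simp) 0)
    rw [hda, hdb, hc0, hY.dτ₃, zero_mul, zero_mul, zero_add, zero_add] at this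
    exact this.div_const 2
  have hS := (hA.comp_hasFDerivAt (0 : ℝ × ℝ) hasFDerivAt_fst).add
    (hasFDerivAt_mul_of_eq_zero hK contDiff_snd rfl)
  refine ⟨fun p => dτ (dτ Y) (curvePoint a b p.1) / 2 + K p * p.2,
    ((h₂.comp (hc.comp contDiff_fst)).div_const 2).add (hK.mul contDiff_snd), ?_, fun v => ?_, ?_⟩
  · simp [hc0, hY.dτ₂_zero]
  · refine (congrArg (· v) hS.fderiv).trans ?_
    simp [K, hc0, hY.dτ₃, fderiv_snd]
  · filter_upwards [h₀, h₁] with t ht₀ (ht₁ : dirDeriv (0, 0, 1) Y (curvePoint a b t) = 0) h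
    have := hYT (curvePoint a b t) h
    have hline : curvePoint a b t + h • ((0, 0, 1) : R3) = (a t, b t, t + h) := by
      simp [curvePoint]
    rw [hline, ht₀, ht₁] at this
    rw [this]
    simp only [Function.iterate_succ, Function.iterate_zero, Function.comp_apply, id_eq, K]
    ring

lemma IsCuspUnfolding.exists_isFoldCurve (hY : IsCuspUnfolding Y m) (hm : m < 0) :
    ∃ (a b ρ : ℝ → ℝ) (k : ℝ), k ≠ 0 ∧ IsFoldCurve Y a b ρ k := by
  obtain ⟨a, b, ha, hb, ha0, hb0, hzero⟩ := hY.exists_doubleZeros_eq_curvePoint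
  have hc : Tendsto (curvePoint a b) (𝓝 0) (𝓝 0) :=
    (contDiff_curvePoint ha hb).continuous.tendsto' _ _ (curvePoint_zero ha0 hb0)
  have hon : ∀ᶠ t in 𝓝 0, Y (curvePoint a b t) = 0 ∧ dτ Y (curvePoint a b t) = 0 :=
    (hc.eventually hzero).mono fun t ht => ht.2 rfl
  have h₀ := hon.mono fun _ => And.left
  have h₁ := hon.mono fun _ => And.right
  have hb₁ := hY.hasDerivAt_deriv_of_doubleZeros ha hb ha0 hb0 h₀ h₁
  obtain ⟨S, hS, hS0, hS', hYS⟩ := hY.exists_doubleZero_factorization ha hb ha0 hb0 h₀ h₁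
  obtain ⟨η, hη, hη0, hη', hsign⟩ := exists_sign_eq_sign_sub hS hS0
    (by rw [dirDeriv, hS']; linarith)
  obtain ⟨hda, hdb⟩ := hY.deriv_eq_zero_of_doubleZeros ha hb ha0 hb0 h₀ h₁
  have hk : -m / du₁ (dτ Y) 0 ≠ 0 := div_ne_zero (neg_ne_zero.2 hm.ne) hY.du₁_dτ_ne
  have hdη : deriv η 0 = -3 := by
    have := hη' 1
    rw [hS', fderiv_apply_one_eq_deriv] at this
    have : m * (deriv η 0 + 3) = 0 := by linarith
    linarith [(mul_eq_zero.1 this).resolve_left hm.ne]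
  have hdρ : HasDerivAt (fun t => t + η t) (-2) 0 :=
    ((hasDerivAt_id' 0).add (hη.differentiable (by simp) 0).hasDerivAt).congr_deriv
      (by rw [hdη]; norm_num)
  refine ⟨a, b, fun t => t + η t, _, hk, ha, hb, contDiff_id.add hη, ha0, hb0, by simp [hη0],
    hda, hdb, by rw [hdρ.deriv]; norm_num, hzero,
    eventually_mul_pos_of_hasDerivAt_zero hdb hb₁ hk, ?_⟩
  have hfst : Tendsto (Prod.fst : ℝ × ℝ → ℝ) (𝓝 0) (𝓝 0) := continuous_fst.tendsto _
  have hsub : Tendsto (fun p : ℝ × ℝ => (p.1, p.2 - p.1)) (𝓝 0) (𝓝 0) :=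
    Continuous.tendsto' (by fun_prop) _ _ (by simp)
  filter_upwards [hfst.eventually hYS, hsub.eventually hsign] with p hp hp'
  specialize hp (p.2 - p.1)
  rw [add_sub_cancel] at hp
  rw [hp, sign_mul, hp', sign_mul]
  congr 2
  ring

end FoldCurve

section Sublevel

lemma exists_forall_lt_iff_lt_of_strictMonoOn {g : ℝ → ℝ} {r T ε : ℝ} (hg : Continuous g)
    (hg0 : g 0 = 0) (hmono : StrictMonoOn g (Icc 0 r)) (hT : 0 ≤ T) (hTr : T ≤ r) (hε : 0 < ε)
    (hεT : ε ≤ g T) : ∃ t₀ ∈ Ioc 0 T, ∀ t ∈ Icc 0 r, g t < ε ↔ t < t₀ := by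
  obtain ⟨t₀, ht₀, rfl⟩ := intermediate_value_Icc hT hg.continuousOn
    (show ε ∈ Icc (g 0) (g T) from ⟨by linarith, hεT⟩)
  have ht₀' : t₀ ≠ 0 := by rintro rfl; linarith
  exact ⟨t₀, ⟨ht₀.1.lt_of_ne' ht₀', ht₀.2⟩,
    fun t ht => hmono.lt_iff_lt ht ⟨ht₀.1, ht₀.2.trans hTr⟩⟩

lemma exists_forall_lt_iff_mem_Ioo {g : ℝ → ℝ} {r T : ℝ} (hg : Continuous g) (hg0 : g 0 = 0)
    (hmono : StrictMonoOn g (Icc 0 r)) (hanti : StrictAntiOn g (Icc (-r) 0)) (hT : 0 < T)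
    (hTr : T ≤ r) : ∃ s > 0, ∀ ε, 0 < ε → ε ≤ s →
      ∃ t₁ ∈ Ico (-T) 0, ∃ t₂ ∈ Ioc 0 T, ∀ t, |t| ≤ r → (g t < ε ↔ t ∈ Ioo t₁ t₂) := by
  have hmono' : StrictMonoOn (fun t => g (-t)) (Icc 0 r) := fun s hs t ht hst =>
    hanti ⟨by linarith [ht.2], by linarith [ht.1]⟩ ⟨by linarith [hs.2], by linarith [hs.1]⟩
      (neg_lt_neg hst)
  have hg0' : g (-0) = 0 := by rw [neg_zero, hg0]
  have hpos : 0 < g T :=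
    hg0 ▸ hmono ⟨le_rfl, hT.le.trans hTr⟩ ⟨hT.le, hTr⟩ hT
  have hpos' : 0 < g (-T) :=
    hg0'.symm.trans_lt (hmono' ⟨le_rfl, hT.le.trans hTr⟩ ⟨hT.le, hTr⟩ hT)
  refine ⟨min (g T) (g (-T)), lt_min hpos hpos', fun ε hε hεs => ?_⟩
  obtain ⟨t₂, ht₂, h₂⟩ := exists_forall_lt_iff_lt_of_strictMonoOn hg hg0 hmono hT.le hTr hε
    (hεs.trans (min_le_left _ _))
  obtain ⟨t₁, ht₁, h₁⟩ := exists_forall_lt_iff_lt_of_strictMonoOn (hg.comp continuous_neg) hg0'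
    hmono' hT.le hTr hε (hεs.trans (min_le_right _ _))
  refine ⟨-t₁, ⟨by linarith [ht₁.2], by linarith [ht₁.1]⟩, t₂, ht₂, fun t ht => ?_⟩
  rw [abs_le] at ht
  rcases le_total 0 t with h0 | h0
  · rw [h₂ t ⟨h0, ht.2⟩]
    exact ⟨fun h => ⟨by linarith [ht₁.1], h⟩, And.right⟩
  · have := h₁ (-t) ⟨by linarith, by linarith⟩
    rw [Function.comp_apply, neg_neg] at this
    rw [this]
    exact ⟨fun h => ⟨by linarith, by linarith [ht₂.1]⟩, fun h => by linarith [h.1]⟩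

lemma exists_forall_abs_lt_iff_mem_Ioo {b : ℝ → ℝ} {k r T : ℝ} (hb : Differentiable ℝ b)
    (hb0 : b 0 = 0) (hk : k ≠ 0) (hT : 0 < T) (hTr : T ≤ r)
    (hb' : ∀ t, |t| ≤ r → t ≠ 0 → 0 < k * t * deriv b t) : ∃ s > 0, ∀ ε, 0 < ε → ε ≤ s →
      ∃ t₁ ∈ Ico (-T) 0, ∃ t₂ ∈ Ioc 0 T, ∀ t, |t| ≤ r → (|b t| < ε ↔ t ∈ Ioo t₁ t₂) := by
  have hr : 0 < r := hT.trans_le hTr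
  have hg : Continuous fun t => k * b t := continuous_const.mul hb.continuous
  have hderiv (t : ℝ) : deriv (fun t => k * b t) t = k * deriv b t := deriv_const_mul k (hb t)
  have hmono : StrictMonoOn (fun t => k * b t) (Icc 0 r) := by
    refine strictMonoOn_of_deriv_pos (convex_Icc _ _) hg.continuousOn fun t ht => ?_
    rw [interior_Icc] at ht
    have := hb' t (abs_le.2 ⟨by linarith [ht.1], ht.2.le⟩) ht.1.ne'
    rw [hderiv]
    exact pos_of_mul_pos_right (by linarith : 0 < t * (k * deriv b t)) ht.1.le
  have hanti : StrictAntiOn (fun t => k * b t) (Icc (-r) 0) := by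
    refine strictAntiOn_of_deriv_neg (convex_Icc _ _) hg.continuousOn fun t ht => ?_
    rw [interior_Icc] at ht
    have := hb' t (abs_le.2 ⟨ht.1.le, by linarith [ht.2]⟩) ht.2.ne
    rw [hderiv]
    exact neg_of_mul_pos_right (by linarith : 0 < t * (k * deriv b t)) ht.2.le
  have hnonneg (t : ℝ) (ht : |t| ≤ r) : 0 ≤ k * b t := by
    rw [abs_le] at ht
    rw [show (0 : ℝ) = k * b 0 by rw [hb0, mul_zero]]
    rcases le_total 0 t with h0 | h0
    · exact hmono.monotoneOn ⟨le_rfl, hr.le⟩ ⟨h0, ht.2⟩ h0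
    · exact hanti.antitoneOn ⟨ht.1, h0⟩ ⟨by linarith, le_rfl⟩ h0
  have hk' := abs_pos.2 hk
  obtain ⟨s, hs, h⟩ := exists_forall_lt_iff_mem_Ioo hg (by rw [hb0, mul_zero]) hmono hanti hT hTr
  refine ⟨s / |k|, by positivity, fun ε hε hεs => ?_⟩
  obtain ⟨t₁, ht₁, t₂, ht₂, hiff⟩ := h (|k| * ε) (by positivity) (by rwa [le_div_iff₀' hk'] at hεs)
  refine ⟨t₁, ht₁, t₂, ht₂, fun t ht => ?_⟩
  rw [← hiff t ht, ← abs_of_nonneg (hnonneg t ht), abs_mul, mul_lt_mul_iff_right₀ hk']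

end Sublevel

section CuspBox

variable {Y : R3 → ℝ} {a b ρ : ℝ → ℝ} {k δ : ℝ} {O : Set R3}

/-- A box adapted to a fold curve: the field `Y` points inwards at the ends `τ = ±δ`, and the part
of the fold curve in the box is parametrized by the interval `(t₁, t₂)`. -/
structure IsCuspBox (Y : R3 → ℝ) (a b ρ : ℝ → ℝ) (k ε₀ ε₁ δ t₁ t₂ : ℝ) : Prop where
  ε₀_pos : 0 < ε₀
  ε₁_pos : 0 < ε₁
  δ_pos : 0 < δ
  t₁_neg : t₁ < 0
  t₂_pos : 0 < t₂
  inward : ∀ u : ℝ × ℝ, |u.1| < ε₀ → |u.2| < ε₁ → Y (u.1, u.2, δ) < 0 ∧ 0 < Y (u.1, u.2, -δ)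
  doubleZero_iff : ∀ w ∈ box ε₀ ε₁ δ, (Y w = 0 ∧ dτ Y w = 0) ↔
    ∃ t ∈ Ioo t₁ t₂, w = curvePoint a b t
  curve_mem : ∀ t ∈ Ioo t₁ t₂, |a t| < ε₀ ∧ |b t| < ε₁ ∧ |t| < δ ∧ |ρ t| < δ
  mul_ρ_neg : ∀ t ∈ Ioo t₁ t₂, t ≠ 0 → t * ρ t < 0
  deriv_b_sign : ∀ t ∈ Ioo t₁ t₂, t ≠ 0 → 0 < k * t * deriv b t
  sign_eq : ∀ t ∈ Ioo t₁ t₂, ∀ τ, |τ| < δ →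
    SignType.sign (Y (a t, b t, τ)) = SignType.sign ((τ - t) ^ 2 * (ρ t - τ))

lemma eventually_forall_norm_le {E : Type*} [SeminormedAddCommGroup E] {p : E → Prop}
    (h : ∀ᶠ x in 𝓝 0, p x) : ∀ᶠ r in 𝓝[>] (0 : ℝ), ∀ x, ‖x‖ ≤ r → p x := by
  obtain ⟨s, hs, h⟩ := Metric.eventually_nhds_iff_ball.1 h
  filter_upwards [Ioo_mem_nhdsGT hs] with r hr x hx
  exact h x (mem_ball_zero_iff.2 (hx.trans_lt hr.2))

lemma norm_R3_le {w : R3} {r : ℝ} : ‖w‖ ≤ r ↔ |w.1| ≤ r ∧ |w.2.1| ≤ r ∧ |w.2.2| ≤ r := by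
  simp [Prod.norm_def]

lemma IsFoldCurve.eventually_mul_ρ_neg (h : IsFoldCurve Y a b ρ k) :
    ∀ᶠ t in 𝓝 0, t ≠ 0 → t * ρ t < 0 := by
  filter_upwards [eventually_mul_pos_of_hasDerivAt_zero h.ρ_zero
    (h.smooth_ρ.differentiable (by simp) 0).hasDerivAt h.deriv_ρ.ne] with t ht ht0
  have := ht ht0
  rw [mul_assoc] at this
  exact neg_of_mul_pos_right this h.deriv_ρ.le

lemma IsFoldCurve.eventually_inward (h : IsFoldCurve Y a b ρ k) (hY : Continuous Y) (hδ : 0 < δ)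
    (hsign : ∀ p : ℝ × ℝ, ‖p‖ ≤ δ → SignType.sign (Y (a p.1, b p.1, p.2)) =
      SignType.sign ((p.2 - p.1) ^ 2 * (ρ p.1 - p.2))) :
    ∀ᶠ u in 𝓝 (0 : ℝ × ℝ), Y (u.1, u.2, δ) < 0 ∧ 0 < Y (u.1, u.2, -δ) := by
  have hsign₀ (τ : ℝ) (hτ : |τ| ≤ δ) :
      SignType.sign (Y (0, 0, τ)) = SignType.sign (τ ^ 2 * (0 - τ)) := by
    simpa [h.a_zero, h.b_zero, h.ρ_zero] using
      hsign (0, τ) (norm_prod_le_iff.2 ⟨by simpa using hδ.le, hτ⟩)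
  have hneg : Y (0, 0, δ) < 0 := by
    rw [← sign_eq_neg_one_iff, hsign₀ δ (abs_of_pos hδ).le, sign_eq_neg_one_iff]
    nlinarith [pow_pos hδ 3]
  have hpos : 0 < Y (0, 0, -δ) := by
    rw [← sign_eq_one_iff, hsign₀ (-δ) (by rw [abs_neg, abs_of_pos hδ]), sign_eq_one_iff]
    nlinarith [pow_pos hδ 3]
  have hcont (τ : ℝ) : ContinuousAt (fun u : ℝ × ℝ => Y (u.1, u.2, τ)) 0 :=
    (hY.comp (by fun_prop)).continuousAt
  exact ((hcont δ).eventually (gt_mem_nhds hneg)).and ((hcont (-δ)).eventually (lt_mem_nhds hpos))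

lemma IsFoldCurve.exists_parameter_interval (h : IsFoldCurve Y a b ρ k) (hk : k ≠ 0) {ε₀ η : ℝ}
    (hε₀ : 0 < ε₀) (hη : 0 < η) (hδ : 0 < δ)
    (hb : ∀ t, |t| ≤ δ → t ≠ 0 → 0 < k * t * deriv b t) : ∃ ε₁ ∈ Ioc 0 ε₀,
      ∃ t₁ ∈ Ioo (-η) 0, ∃ t₂ ∈ Ioo 0 η, (∀ t, |t| ≤ δ → (|b t| < ε₁ ↔ t ∈ Ioo t₁ t₂)) ∧
        ∀ t ∈ Ioo t₁ t₂, |a t| < ε₀ ∧ |t| < δ ∧ |ρ t| < δ := by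
  have hsmall : ∀ᶠ t in 𝓝 0, |a t| < ε₀ ∧ |ρ t| < δ :=
    ((h.smooth_a.continuous.abs.tendsto' 0 0 (by simp [h.a_zero])).eventually
      (gt_mem_nhds hε₀)).and
    ((h.smooth_ρ.continuous.abs.tendsto' 0 0 (by simp [h.ρ_zero])).eventually (gt_mem_nhds hδ))
  obtain ⟨T, hT, hT₀, hTη⟩ := ((eventually_forall_norm_le hsmall).and
    (Ioo_mem_nhdsGT (lt_min hη hδ))).exists
  rw [lt_min_iff] at hTη
  obtain ⟨s, hs, hlevel⟩ := exists_forall_abs_lt_iff_mem_Ioo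
    (h.smooth_b.differentiable (by simp)) h.b_zero hk hT₀ hTη.2.le hb
  obtain ⟨t₁, ht₁, t₂, ht₂, hiff⟩ := hlevel (min ε₀ s) (lt_min hε₀ hs) (min_le_right _ _)
  refine ⟨min ε₀ s, ⟨lt_min hε₀ hs, min_le_left _ _⟩, t₁, ⟨by linarith [ht₁.1], ht₁.2⟩,
    t₂, ⟨ht₂.1, by linarith [ht₂.2]⟩, hiff, fun t ht => ?_⟩
  have htT : |t| < T := abs_lt.2 ⟨ht₁.1.trans_lt ht.1, ht.2.trans_le ht₂.2⟩
  exact ⟨(hT t htT.le).1, htT.trans hTη.2, (hT t htT.le).2⟩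

lemma IsFoldCurve.exists_isCuspBox (h : IsFoldCurve Y a b ρ k) (hk : k ≠ 0) (hY : Continuous Y)
    {η : ℝ} (hη : 0 < η) (hO : O ∈ 𝓝 0) : ∃ ε₀ ε₁ δ t₁ t₂ : ℝ,
      IsCuspBox Y a b ρ k ε₀ ε₁ δ t₁ t₂ ∧ box ε₀ ε₁ δ ⊆ O ∧ -η < t₁ ∧ t₂ < η := by
  obtain ⟨δ, ⟨⟨hδzero, hδsign⟩, hδb⟩, hδ : 0 < δ⟩ :=
    (((eventually_forall_norm_le (h.doubleZero_iff.and hO)).and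
      (eventually_forall_norm_le h.sign_eq)).and (eventually_forall_norm_le
        (h.deriv_b_sign.and h.eventually_mul_ρ_neg))).and self_mem_nhdsWithin |>.exists
  obtain ⟨ε₀, hε₀in, hε₀, hε₀δ⟩ := ((eventually_forall_norm_le
    (h.eventually_inward hY hδ hδsign)).and (Ioc_mem_nhdsGT hδ)).exists
  obtain ⟨ε₁, ⟨hε₁, hε₁₀⟩, t₁, ht₁, t₂, ht₂, hiff, hcurve⟩ :=
    h.exists_parameter_interval hk hε₀ hη hδ fun t ht => (hδb t ht).1
  have hbox (w : R3) (hw : w ∈ box ε₀ ε₁ δ) : ‖w‖ ≤ δ := norm_R3_le.2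
    ⟨hw.1.le.trans hε₀δ, hw.2.1.le.trans (hε₁₀.trans hε₀δ), hw.2.2.le⟩
  refine ⟨ε₀, ε₁, δ, t₁, t₂, ?_, fun w hw => (hδzero w (hbox w hw)).2, ht₁.1, ht₂.2⟩
  exact {
    ε₀_pos := hε₀
    ε₁_pos := hε₁
    δ_pos := hδ
    t₁_neg := ht₁.2
    t₂_pos := ht₂.1
    inward := fun u h₀ h₁ => hε₀in u (norm_prod_le_iff.2 ⟨h₀.le, h₁.le.trans hε₁₀⟩)
    doubleZero_iff := fun w hw => by
      rw [(hδzero w (hbox w hw)).1]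
      refine ⟨fun hw' => ⟨w.2.2, (hiff _ hw.2.2.le).1 ?_, hw'⟩, ?_⟩
      · rw [hw'] at hw
        exact hw.2.1
      · rintro ⟨t, -, rfl⟩
        rfl
    curve_mem := fun t ht => ⟨(hcurve t ht).1, (hiff t (hcurve t ht).2.1.le).2 ht,
      (hcurve t ht).2⟩
    mul_ρ_neg := fun t ht => (hδb t (hcurve t ht).2.1.le).2
    deriv_b_sign := fun t ht => (hδb t (hcurve t ht).2.1.le).1
    sign_eq := fun t ht τ hτ => hδsign (t, τ) (norm_prod_le_iff.2 ⟨(hcurve t ht).2.1.le, hτ.le⟩) }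

end CuspBox

section Graph

variable {b : ℝ → ℝ} {k : ℝ} {J : Set ℝ}

lemma injOn_of_mul_deriv_pos (hb : Differentiable ℝ b) (hJ : Convex ℝ J)
    (hpos : ∀ x ∈ J, 0 < k * deriv b x) : InjOn b J := by
  have hmono : StrictMonoOn (fun x => k * b x) J :=
    strictMonoOn_of_deriv_pos hJ (hb.continuous.const_mul k).continuousOn fun x hx => by
      rw [deriv_const_mul k (hb x)]
      exact hpos x (interior_subset hx)
  exact fun x hx y hy hxy => hmono.injOn hx hy (congrArg (k * ·) hxy)

lemma exists_openPartialHomeomorph_source_eq (hb : ContDiff ℝ ∞ b) (hJo : IsOpen J)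
    (hinj : InjOn b J) (hne : ∀ x ∈ J, deriv b x ≠ 0) :
    ∃ e : OpenPartialHomeomorph ℝ ℝ, e.source = J ∧ ⇑e = b ∧ ContDiffOn ℝ ∞ e.symm e.target := by
  have hderiv (x : ℝ) : HasStrictDerivAt b (deriv b x) x :=
    hb.contDiffAt.hasStrictDerivAt (by simp)
  have hopen : IsOpenMap (J.domRestrict b) := IsOpenMap.of_nhds_le fun x => by
    change 𝓝 (b x) ≤ map (b ∘ Subtype.val) (𝓝 x)
    rw [← map_map, hJo.isOpenEmbedding_subtypeVal.map_nhds_eq,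
      (hderiv x).map_nhds_eq (hne x x.2)]
  refine ⟨.ofContinuousOpenRestrict (hinj.toPartialEquiv b J) hb.continuous.continuousOn hopen hJo,
    rfl, rfl, fun y hy => ?_⟩
  exact (OpenPartialHomeomorph.contDiffAt_symm_deriv _
    (hne _ (OpenPartialHomeomorph.map_target _ hy)) hy (hderiv _).hasDerivAt
    hb.contDiffAt).contDiffWithinAt

/-- The curve `q`, restricted to the interval `(t₁, t₂)` around `0`, runs in the plane `{x = 0}`
from left to right along the graph of the smooth function `θ` on `(α, β)`, passing at time `0`
through the origin with vertical tangent. -/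
structure IsPlaneArc (q : ℝ → R3) (t₁ t₂ : ℝ) (θ : ℝ → ℝ) (α β : ℝ) : Prop where
  α_neg : α < 0
  β_pos : 0 < β
  contDiffOn : ContDiffOn ℝ ∞ θ (Ioo α β)
  zero : θ 0 = 0
  deriv_zero : deriv θ 0 = 0
  image_eq : q '' Ioo t₁ t₂ = planeGraph θ (Ioo α β)
  image_neg_eq : q '' Ioo t₁ 0 = planeGraph θ (Ioo α 0)
  image_pos_eq : q '' Ioo 0 t₂ = planeGraph θ (Ioo 0 β)

variable {q : ℝ → R3} {v : ℝ}

lemma image_eq_planeGraph {e : OpenPartialHomeomorph ℝ ℝ} (he : ∀ t, e t = (q t).2.2) {s₁ s₂ : ℝ}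
    (hs : s₁ ≤ s₂) (hsub : Icc s₁ s₂ ⊆ e.source) (hmono : StrictMonoOn e (Icc s₁ s₂))
    (hplane : ∀ t ∈ Ioo s₁ s₂, (q t).1 = 0) :
    q '' Ioo s₁ s₂ = planeGraph (fun s => (q (e.symm s)).2.1) (Ioo (e s₁) (e s₂)) := by
  rw [planeGraph, ← (e.continuousOn.mono hsub).image_Ioo_of_strictMonoOn hs hmono, image_image]
  refine image_congr fun t ht => ?_
  rw [e.left_inv (hsub (Ioo_subset_Icc_self ht)), he, ← hplane t ht]

lemma deriv_comp_symm_eq_zero {e : OpenPartialHomeomorph ℝ ℝ}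
    (hes : ContDiffOn ℝ ∞ e.symm e.target) (h0 : 0 ∈ e.source) (he0 : e 0 = 0) {A : ℝ → ℝ}
    (hA : HasDerivAt A 0 0) : deriv (fun s => A (e.symm s)) 0 = 0 := by
  have h0t : (0 : ℝ) ∈ e.target := he0 ▸ e.map_source h0
  have hsymm0 : e.symm 0 = 0 := by simpa only [he0] using e.left_inv h0
  have hsymm := ((hes.contDiffAt (e.open_target.mem_nhds h0t)).differentiableAt
    (by simp)).hasDerivAt
  have hA' : HasDerivAt A 0 (e.symm 0) := by rwa [hsymm0]
  exact (hA'.comp (0 : ℝ) hsymm).deriv.trans (zero_mul _)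

lemma isPlaneArc_of_openPartialHomeomorph (hq : ContDiff ℝ ∞ q) (hq0 : q 0 = 0)
    (hq' : HasDerivAt q (0, 0, v) 0) {e : OpenPartialHomeomorph ℝ ℝ}
    (he : ∀ t, e t = (q t).2.2) (hesymm : ContDiffOn ℝ ∞ e.symm e.target) {t₁ t₂ : ℝ}
    (ht₁ : t₁ < 0) (ht₂ : 0 < t₂) (hsub : Icc t₁ t₂ ⊆ e.source)
    (hmono : StrictMonoOn e (Icc t₁ t₂)) (hplane : ∀ t ∈ Ioo t₁ t₂, (q t).1 = 0) :
    IsPlaneArc q t₁ t₂ (fun s => (q (e.symm s)).2.1) (e t₁) (e t₂) := by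
  have h0 : (0 : ℝ) ∈ Icc t₁ t₂ := ⟨ht₁.le, ht₂.le⟩
  have he0 : e 0 = 0 := by simp [he, hq0]
  have hsymm0 : e.symm 0 = 0 := by simpa only [he0] using e.left_inv (hsub h0)
  have himage {s₁ s₂ : ℝ} (hs : s₁ ≤ s₂) (hs₁ : t₁ ≤ s₁) (hs₂ : s₂ ≤ t₂) :=
    have hIcc : Icc s₁ s₂ ⊆ Icc t₁ t₂ := Icc_subset_Icc hs₁ hs₂
    image_eq_planeGraph he hs (hIcc.trans hsub) (hmono.mono hIcc)
      fun t ht => hplane t (Ioo_subset_Ioo hs₁ hs₂ ht)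
  have htarget : Ioo (e t₁) (e t₂) ⊆ e.target := by
    rw [← (e.continuousOn.mono hsub).image_Ioo_of_strictMonoOn (ht₁.trans ht₂).le hmono,
      ← e.image_source_eq_target]
    exact image_mono (Ioo_subset_Icc_self.trans hsub)
  exact
    { α_neg := he0 ▸ hmono ⟨le_rfl, (ht₁.trans ht₂).le⟩ h0 ht₁
      β_pos := he0 ▸ hmono h0 ⟨(ht₁.trans ht₂).le, le_rfl⟩ ht₂
      contDiffOn := (by fun_prop : ContDiff ℝ ∞ fun t => (q t).2.1).comp_contDiffOn
        (hesymm.mono htarget)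
      zero := by simp [hsymm0, hq0]
      deriv_zero := deriv_comp_symm_eq_zero hesymm (hsub h0) he0 hq'.snd.fst
      image_eq := himage (ht₁.trans ht₂).le le_rfl le_rfl
      image_neg_eq := by simpa only [he0] using himage ht₁.le le_rfl ht₂.le
      image_pos_eq := by simpa only [he0] using himage ht₂.le ht₁.le le_rfl }

lemma exists_isPlaneArc (hq : ContDiff ℝ ∞ q) (hq0 : q 0 = 0) (hv : 0 < v)
    (hq' : HasDerivAt q (0, 0, v) 0) :
    ∃ η > 0, ∀ t₁ t₂, -η < t₁ → t₁ < 0 → 0 < t₂ → t₂ < η → (∀ t ∈ Ioo t₁ t₂, (q t).1 = 0) →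
      ∃ θ α β, IsPlaneArc q t₁ t₂ θ α β := by
  have hB : ContDiff ℝ ∞ fun t => (q t).2.2 := by fun_prop
  have hB' : deriv (fun t => (q t).2.2) 0 = v := HasDerivAt.deriv hq'.snd.snd
  obtain ⟨η, hη, hpos⟩ := Metric.eventually_nhds_iff_ball.1 <|
    (hB.continuous_deriv (by simp)).continuousAt.eventually (lt_mem_nhds (hB' ▸ hv))
  have hconv : Convex ℝ (Metric.ball (0 : ℝ) η) := convex_ball _ _
  have hmono : StrictMonoOn (fun t => (q t).2.2) (Metric.ball 0 η) :=
    strictMonoOn_of_deriv_pos hconv hB.continuous.continuousOn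
      fun t ht => hpos t (interior_subset ht)
  obtain ⟨e, hes, he, hesymm⟩ := exists_openPartialHomeomorph_source_eq hB Metric.isOpen_ball
    hmono.injOn fun t ht => (hpos t ht).ne'
  refine ⟨η, hη, fun t₁ t₂ h₁ ht₁ ht₂ h₂ hplane => ?_⟩
  have hsub : Icc t₁ t₂ ⊆ Metric.ball 0 η := fun t ht => by
    rw [mem_ball_zero_iff, Real.norm_eq_abs, abs_lt]
    exact ⟨h₁.trans_le ht.1, ht.2.trans_lt h₂⟩
  exact ⟨_, _, _, isPlaneArc_of_openPartialHomeomorph hq hq0 hq' (congrFun he) hesymm ht₁ ht₂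
    (hes.symm ▸ hsub) (he.symm ▸ hmono.mono hsub) hplane⟩

end Graph

section Surface

variable {S B O N : Set R3} {Ψ χ : R3 → ℝ}

lemma isSmoothSurfaceWithBoundary_of_eq (hNo : IsOpen N) (hΨ : ContDiffOn ℝ ∞ Ψ N)
    (hχ : ContDiffOn ℝ ∞ χ N)
    (hind : ∀ w ∈ N, LinearIndependent ℝ ![fderiv ℝ Ψ w, fderiv ℝ χ w])
    (hS : S = {w ∈ N | Ψ w = 0 ∧ 0 ≤ χ w}) (hB : B = {w ∈ N | Ψ w = 0 ∧ χ w = 0}) :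
    IsSmoothSurfaceWithBoundary S B := by
  subst hS hB
  refine ⟨fun w ⟨hw, h0, h1⟩ => ⟨hw, h0, h1.ge⟩, ?_, fun w ⟨hw, _⟩ =>
    ⟨N, hNo, hw, Ψ, χ, hΨ, hχ, hind w hw, inter_eq_left.2 fun _ h => h.1,
      inter_eq_left.2 fun _ h => h.1⟩⟩
  rintro w ⟨⟨hw, h0, hle⟩, hB⟩
  refine ⟨N ∩ χ ⁻¹' Ioi 0, hχ.continuousOn.isOpen_inter_preimage hNo isOpen_Ioi,
    ⟨hw, hle.lt_of_ne fun h => hB ⟨hw, h0, h.symm⟩⟩, Ψ, hΨ.mono inter_subset_left,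
    (hind w hw).ne_zero 0, ?_⟩
  ext q
  exact ⟨fun h => ⟨h.2, h.1.2.1⟩, fun h => ⟨⟨h.1.1, h.2, h.1.2.le⟩, h.1⟩⟩

section Chart

variable {Φ : OpenPartialHomeomorph R3 R3}

lemma image_inter_chart {A : Set R3} (hA : A ⊆ Φ.source) {P : R3 → Prop}
    (h : A ∩ O = {w ∈ O | P w}) :
    Φ '' A ∩ (Φ.target ∩ Φ.symm ⁻¹' O) = {p ∈ Φ.target ∩ Φ.symm ⁻¹' O | P (Φ.symm p)} := by
  ext p
  rw [mem_sep_iff, inter_comm, mem_inter_iff]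
  refine and_congr_right fun ⟨hp, hpO⟩ => ?_
  have hmem : Φ.symm p ∈ A ∩ O ↔ P (Φ.symm p) := by
    rw [h]
    exact and_iff_right hpO
  rw [← hmem]
  exact ⟨fun ⟨w, hw, hwp⟩ => ⟨by rwa [← hwp, Φ.left_inv (hA hw)], hpO⟩,
    fun hw => ⟨_, hw.1, Φ.right_inv hp⟩⟩

lemma fderiv_comp_symm_comp_fderiv (hΦ : ContDiffOn ℝ ∞ Φ Φ.source)
    (hΦs : ContDiffOn ℝ ∞ Φ.symm Φ.target) {w : R3} (hw : w ∈ Φ.source)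
    (hΨ : DifferentiableAt ℝ Ψ w) :
    (fderiv ℝ (Ψ ∘ Φ.symm) (Φ w)).comp (fderiv ℝ Φ w) = fderiv ℝ Ψ w := by
  have hdΦ : DifferentiableAt ℝ Φ w :=
    (hΦ.contDiffAt (Φ.open_source.mem_nhds hw)).differentiableAt (by simp)
  have hdsymm : DifferentiableAt ℝ Φ.symm (Φ w) :=
    (hΦs.contDiffAt (Φ.open_target.mem_nhds (Φ.map_source hw))).differentiableAt (by simp)
  have hdΨ : DifferentiableAt ℝ (Ψ ∘ Φ.symm) (Φ w) :=
    DifferentiableAt.comp _ (by rwa [Φ.left_inv hw]) hdsymm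
  rw [← fderiv_comp w hdΨ hdΦ]
  refine EventuallyEq.fderiv_eq ?_
  filter_upwards [Φ.eventually_left_inverse hw] with u hu
  exact congrArg Ψ hu

lemma contDiffOn_comp_symm (hΨ : ContDiffOn ℝ ∞ Ψ O)
    (hΦs : ContDiffOn ℝ ∞ Φ.symm Φ.target) :
    ContDiffOn ℝ ∞ (Ψ ∘ Φ.symm) (Φ.target ∩ Φ.symm ⁻¹' O) :=
  hΨ.comp (hΦs.mono inter_subset_left) fun _ hp => hp.2

lemma IsSmoothSurfaceWithBoundary.image (h : IsSmoothSurfaceWithBoundary S B)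
    (hΦ : ContDiffOn ℝ ∞ Φ Φ.source) (hΦs : ContDiffOn ℝ ∞ Φ.symm Φ.target)
    (hS : S ⊆ Φ.source) : IsSmoothSurfaceWithBoundary (Φ '' S) (Φ '' B) := by
  obtain ⟨hBS, hint, hbdry⟩ := h
  have hmem {O : Set R3} {w : R3} (hw : w ∈ Φ.source) (hwO : w ∈ O) :
      Φ w ∈ Φ.target ∩ Φ.symm ⁻¹' O :=
    ⟨Φ.map_source hw, by rwa [mem_preimage, Φ.left_inv hw]⟩
  refine ⟨image_mono hBS, ?_, ?_⟩
  · rintro _ ⟨⟨w, hw, rfl⟩, hwB⟩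
    obtain ⟨O, hO, hwO, Ψ, hΨ, hne, heq⟩ := hint w ⟨hw, fun h => hwB (mem_image_of_mem _ h)⟩
    have hd := fderiv_comp_symm_comp_fderiv hΦ hΦs (hS hw)
      ((hΨ.contDiffAt (hO.mem_nhds hwO)).differentiableAt (by simp))
    refine ⟨_, Φ.isOpen_inter_preimage_symm hO, hmem (hS hw) hwO, Ψ ∘ Φ.symm,
      contDiffOn_comp_symm hΨ hΦs, fun h0 => hne ?_, image_inter_chart hS heq⟩
    rw [← hd, h0, ContinuousLinearMap.zero_comp]
  · rintro _ ⟨w, hw, rfl⟩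
    obtain ⟨O, hO, hwO, Ψ, χ, hΨ, hχ, hind, heqS, heqB⟩ := hbdry w hw
    have hwS := hS (hBS hw)
    have hdΨ := fderiv_comp_symm_comp_fderiv hΦ hΦs hwS
      ((hΨ.contDiffAt (hO.mem_nhds hwO)).differentiableAt (by simp))
    have hdχ := fderiv_comp_symm_comp_fderiv hΦ hΦs hwS
      ((hχ.contDiffAt (hO.mem_nhds hwO)).differentiableAt (by simp))
    refine ⟨_, Φ.isOpen_inter_preimage_symm hO, hmem hwS hwO, Ψ ∘ Φ.symm, χ ∘ Φ.symm,
      contDiffOn_comp_symm hΨ hΦs, contDiffOn_comp_symm hχ hΦs, ?_, image_inter_chart hS heqS,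
      image_inter_chart (hBS.trans hS) heqB⟩
    rw [LinearIndependent.pair_iff] at hind ⊢
    refine fun s t hst => hind s t ?_
    rw [← hdΨ, ← hdχ, ← ContinuousLinearMap.smul_comp, ← ContinuousLinearMap.smul_comp,
      ← ContinuousLinearMap.add_comp, hst, ContinuousLinearMap.zero_comp]

end Chart

/-- The region of the surface swept by the lines `{(a x, b x)} × ℝ`, `x ∈ J`, between the curve
`τ = ρ x` (excluded) and the fold curve `τ = x` (included), which lies above the former if
`ε = 1` and below it if `ε = -1`. -/
def foldStrip (a b ρ : ℝ → ℝ) (J : Set ℝ) (ε : ℝ) : Set R3 :=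
  {w | ∃ x ∈ J, w.1 = a x ∧ w.2.1 = b x ∧ 0 < ε * (w.2.2 - ρ x) ∧ 0 ≤ ε * (x - w.2.2)}

variable {a ρ : ℝ → ℝ} {ε : ℝ} {e : OpenPartialHomeomorph ℝ ℝ}

lemma linearIndependent_fderiv_of_graph {α κ : ℝ → ℝ} {w : R3} (hα : DifferentiableAt ℝ α w.2.1)
    (hκ : DifferentiableAt ℝ κ w.2.1) (hε : ε ≠ 0) :
    LinearIndependent ℝ ![fderiv ℝ (fun w : R3 => w.1 - α w.2.1) w,
      fderiv ℝ (fun w : R3 => ε * (κ w.2.1 - w.2.2)) w] := by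
  have hsnd := (hasFDerivAt_snd (𝕜 := ℝ) (p := w)).fst
  have hthd := (hasFDerivAt_snd (𝕜 := ℝ) (p := w)).snd
  have hΨ := (hasFDerivAt_fst (𝕜 := ℝ) (p := w)).sub (hα.hasDerivAt.comp_hasFDerivAt w hsnd)
  have hχ := ((hκ.hasDerivAt.comp_hasFDerivAt w hsnd).sub hthd).const_mul ε
  rw [LinearIndependent.pair_iff]
  intro s t hst
  rw [HasFDerivAt.fderiv (f := fun w : R3 => w.1 - α w.2.1) hΨ,
    HasFDerivAt.fderiv (f := fun w : R3 => ε * (κ w.2.1 - w.2.2)) hχ] at hst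
  have hs : s = 0 := by simpa using DFunLike.congr_fun hst (1, 0, 0)
  have ht : t = 0 := by simpa [hε] using DFunLike.congr_fun hst (0, 0, 1)
  exact ⟨hs, ht⟩

lemma mem_foldStrip_iff (w : R3) :
    w ∈ foldStrip a e ρ e.source ε ↔
      (w.2.1 ∈ e.target ∧ 0 < ε * (w.2.2 - ρ (e.symm w.2.1))) ∧
        w.1 - a (e.symm w.2.1) = 0 ∧ 0 ≤ ε * (e.symm w.2.1 - w.2.2) := by
  constructor
  · rintro ⟨x, hx, h₀, h₁, hlt, hle⟩
    rw [h₁, e.left_inv hx]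
    exact ⟨⟨e.map_source hx, hlt⟩, sub_eq_zero.2 h₀, hle⟩
  · rintro ⟨⟨hw, hlt⟩, h₀, hle⟩
    exact ⟨_, e.map_target hw, sub_eq_zero.1 h₀, (e.right_inv hw).symm, hlt, hle⟩

lemma mem_curvePoint_image_iff (hε : ε ≠ 0) (hρ : ∀ x ∈ e.source, 0 < ε * (x - ρ x)) (w : R3) :
    w ∈ curvePoint a e '' e.source ↔
      (w.2.1 ∈ e.target ∧ 0 < ε * (w.2.2 - ρ (e.symm w.2.1))) ∧
        w.1 - a (e.symm w.2.1) = 0 ∧ ε * (e.symm w.2.1 - w.2.2) = 0 := by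
  constructor
  · rintro ⟨x, hx, rfl⟩
    simp only [curvePoint, e.left_inv hx, sub_self, mul_zero, and_true]
    exact ⟨e.map_source hx, hρ x hx⟩
  · rintro ⟨⟨hw, -⟩, h₀, h₁⟩
    have hx : e.symm w.2.1 = w.2.2 := sub_eq_zero.1 ((mul_eq_zero.1 h₁).resolve_left hε)
    exact ⟨_, e.map_target hw, Prod.ext (sub_eq_zero.1 h₀).symm (Prod.ext (e.right_inv hw) hx)⟩

lemma isSmoothSurfaceWithBoundary_foldStrip (ha : ContDiff ℝ ∞ a) (hρ : ContDiff ℝ ∞ ρ)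
    (hes : ContDiffOn ℝ ∞ e.symm e.target) (hε : ε ≠ 0)
    (hρx : ∀ x ∈ e.source, 0 < ε * (x - ρ x)) :
    IsSmoothSurfaceWithBoundary (foldStrip a e ρ e.source ε) (curvePoint a e '' e.source) := by
  let D : Set R3 := {w | w.2.1 ∈ e.target}
  have hD : IsOpen D := e.open_target.preimage (by fun_prop)
  have hκ : ContDiffOn ℝ ∞ (fun w : R3 => e.symm w.2.1) D :=
    hes.comp (by fun_prop : ContDiff ℝ ∞ fun w : R3 => w.2.1).contDiffOn fun _ hw => hw
  have hτ : ContDiffOn ℝ ∞ (fun w : R3 => w.2.2) D :=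
    (by fun_prop : ContDiff ℝ ∞ fun w : R3 => w.2.2).contDiffOn
  have hξ : ContDiffOn ℝ ∞ (fun w : R3 => ε * (w.2.2 - ρ (e.symm w.2.1))) D :=
    contDiffOn_const.mul (hτ.sub (hρ.comp_contDiffOn hκ))
  have hN : IsOpen {w : R3 | w.2.1 ∈ e.target ∧ 0 < ε * (w.2.2 - ρ (e.symm w.2.1))} :=
    hξ.continuousOn.isOpen_inter_preimage hD isOpen_Ioi
  have hND : {w : R3 | w.2.1 ∈ e.target ∧ 0 < ε * (w.2.2 - ρ (e.symm w.2.1))} ⊆ D :=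
    fun _ hw => hw.1
  have hΨ : ContDiffOn ℝ ∞ (fun w : R3 => w.1 - a (e.symm w.2.1)) D :=
    contDiff_fst.contDiffOn.sub (ha.comp_contDiffOn hκ)
  have hχ : ContDiffOn ℝ ∞ (fun w : R3 => ε * (e.symm w.2.1 - w.2.2)) D :=
    contDiffOn_const.mul (hκ.sub hτ)
  refine isSmoothSurfaceWithBoundary_of_eq hN (hΨ.mono hND) (hχ.mono hND) (fun w hw => ?_)
    (Set.ext fun w => mem_foldStrip_iff w) (Set.ext fun w => mem_curvePoint_image_iff hε hρx w)
  have hd : DifferentiableAt ℝ e.symm w.2.1 :=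
    (hes.contDiffAt (e.open_target.mem_nhds hw.1)).differentiableAt (by simp)
  exact linearIndependent_fderiv_of_graph (α := fun s => a (e.symm s))
    ((ha.differentiable (by simp) _).comp _ hd) hd hε

end Surface

/-! ### Heteroclinic surfaces -/

section Branch

variable {a b ρ : ℝ → ℝ} {J : Set ℝ} {ε₀ ε₁ δ ε x : ℝ} {Y : R3 → ℝ} {w : R3}

/-- The part over `J` of a fold curve `x ↦ (a x, b x, x)` of the vertical field `Y ∂_τ` in the box
`box ε₀ ε₁ δ`: the line `{(a x, b x)} × ℝ` carries the half-stable equilibrium `τ = x` and, on its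
unstable side, the equilibrium `τ = ρ x` (below it if `ε = 1`, above it if `ε = -1`), and distinct
`x` give distinct lines. -/
structure IsFoldBranch (Y : R3 → ℝ) (a b ρ : ℝ → ℝ) (J : Set ℝ) (ε₀ ε₁ δ ε : ℝ) : Prop where
  injOn : InjOn b J
  abs_a_lt : ∀ x ∈ J, |a x| < ε₀
  abs_b_lt : ∀ x ∈ J, |b x| < ε₁
  pair : ∀ x ∈ J, IsHalfStablePair (fun y => Y (a x, b x, y)) δ (ρ x) x ε

namespace IsFoldBranch

lemma curvePoint_mem_box (h : IsFoldBranch Y a b ρ J ε₀ ε₁ δ ε) (hx : x ∈ J) :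
    curvePoint a b x ∈ box ε₀ ε₁ δ :=
  ⟨h.abs_a_lt x hx, h.abs_b_lt x hx, (h.pair x hx).abs_source_lt⟩

lemma sink_mem_box (h : IsFoldBranch Y a b ρ J ε₀ ε₁ δ ε) (hx : x ∈ J) :
    (a x, b x, ρ x) ∈ box ε₀ ε₁ δ :=
  ⟨h.abs_a_lt x hx, h.abs_b_lt x hx, (h.pair x hx).abs_sink_lt⟩

lemma foldStrip_subset_box (h : IsFoldBranch Y a b ρ J ε₀ ε₁ δ ε) :
    foldStrip a b ρ J ε ⊆ box ε₀ ε₁ δ := by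
  rintro ⟨_, _, τ⟩ ⟨x, hx, rfl, rfl, hr, ht⟩
  have hp := h.pair x hx
  have hρ := abs_lt.1 hp.abs_sink_lt
  have hxδ := abs_lt.1 hp.abs_source_lt
  refine ⟨h.abs_a_lt x hx, h.abs_b_lt x hx, abs_lt.2 ?_⟩
  rcases hp.eq_one_or with rfl | rfl <;> constructor <;> simp only at hr ht ⊢ <;> linarith

lemma mem_foldStrip_sdiff_iff (h : IsFoldBranch Y a b ρ J ε₀ ε₁ δ ε) (hε : ε ≠ 0) :
    w ∈ foldStrip a b ρ J ε \ curvePoint a b '' J ↔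
      ∃ x ∈ J, w.1 = a x ∧ w.2.1 = b x ∧ 0 < ε * (w.2.2 - ρ x) ∧ 0 < ε * (x - w.2.2) := by
  obtain ⟨u₀, u₁, τ⟩ := w
  constructor
  · rintro ⟨⟨x, hx, rfl, rfl, hr, ht⟩, hne⟩
    refine ⟨x, hx, rfl, rfl, hr, ht.lt_of_ne fun h0 => hne ⟨x, hx, ?_⟩⟩
    rw [curvePoint, sub_eq_zero.1 ((mul_eq_zero.1 h0.symm).resolve_left hε)]
  · rintro ⟨x, hx, rfl, hb, hr, ht⟩
    refine ⟨⟨x, hx, rfl, hb, hr, ht.le⟩, ?_⟩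
    rintro ⟨x', hx', heq⟩
    obtain rfl : x' = x := h.injOn hx' hx ((congrArg (fun w : R3 => w.2.1) heq).trans hb)
    obtain rfl : x' = τ := congrArg (fun w : R3 => w.2.2) heq
    simp only [sub_self, mul_zero, lt_self_iff_false] at ht

lemma image_curvePoint_subset_foldStrip (h : IsFoldBranch Y a b ρ J ε₀ ε₁ δ ε) :
    curvePoint a b '' J ⊆ foldStrip a b ρ J ε := by
  rintro _ ⟨x, hx, rfl⟩
  exact ⟨x, hx, rfl, rfl, (h.pair x hx).side, by simp [curvePoint]⟩

lemma mul_neg_of_mem_foldStrip_sdiff (h : IsFoldBranch Y a b ρ J ε₀ ε₁ δ ε) (hε : ε ≠ 0)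
    (hw : w ∈ foldStrip a b ρ J ε \ curvePoint a b '' J) : ε * Y w < 0 := by
  obtain ⟨x, hx, ha, hb, hr, ht⟩ := (h.mem_foldStrip_sdiff_iff hε).1 hw
  have := (h.pair x hx).neg w.2.2 (h.foldStrip_subset_box hw.1).2.2
    (fun hwx => by rw [hwx, sub_self, mul_zero] at ht; exact ht.false) hr
  rwa [← ha, ← hb] at this

lemma isSmoothSurfaceWithBoundary_foldStrip (h : IsFoldBranch Y a b ρ J ε₀ ε₁ δ ε) (hε : ε ≠ 0)
    (ha : ContDiff ℝ ∞ a) (hb : ContDiff ℝ ∞ b) (hρ : ContDiff ℝ ∞ ρ) (hJ : IsOpen J)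
    (hne : ∀ x ∈ J, deriv b x ≠ 0) :
    IsSmoothSurfaceWithBoundary (foldStrip a b ρ J ε) (curvePoint a b '' J) := by
  obtain ⟨e, rfl, rfl, hes⟩ := exists_openPartialHomeomorph_source_eq hb hJ h.injOn hne
  exact DriftSing.isSmoothSurfaceWithBoundary_foldStrip ha hρ hes hε fun x hx => (h.pair x hx).side

variable {Φ : OpenPartialHomeomorph R3 R3} {F : R3 → R3}

lemma convergesBackward_iff (h : IsFoldBranch Y a b ρ J ε₀ ε₁ δ ε) (hΦ : IsFlowBox Φ Y F)
    (hB : box ε₀ ε₁ δ ⊆ Φ.source) (hw : w ∈ box ε₀ ε₁ δ) (hx : x ∈ J) :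
    ConvergesBackward F (Φ '' box ε₀ ε₁ δ) (Φ w) (Φ (curvePoint a b x)) ↔
      w.1 = a x ∧ w.2.1 = b x ∧ 0 < ε * (w.2.2 - ρ x) ∧ 0 ≤ ε * (x - w.2.2) := by
  rw [hΦ.convergesBackward_iff hB hw (h.curvePoint_mem_box hx), curvePoint, eq_comm (a := a x),
    eq_comm (a := b x)]
  refine and_congr_right fun ha => and_congr_right fun hb => ?_
  rw [ha, hb]
  exact (h.pair x hx).scalarConverges_neg_iff

lemma limitSet_convergesBackward (h : IsFoldBranch Y a b ρ J ε₀ ε₁ δ ε) (hΦ : IsFlowBox Φ Y F)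
    (hB : box ε₀ ε₁ δ ⊆ Φ.source) :
    limitSet (ConvergesBackward F (Φ '' box ε₀ ε₁ δ)) (Φ '' box ε₀ ε₁ δ)
      (Φ '' (curvePoint a b '' J)) = Φ '' foldStrip a b ρ J ε := by
  apply Subset.antisymm
  · rintro _ ⟨⟨w, hw, rfl⟩, _, ⟨_, ⟨x, hx, rfl⟩, rfl⟩, hconv⟩
    exact mem_image_of_mem _ ⟨x, hx, (h.convergesBackward_iff hΦ hB hw hx).1 hconv⟩
  · rintro _ ⟨w, hw, rfl⟩
    have hwB := h.foldStrip_subset_box hw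
    obtain ⟨x, hx, hwx⟩ := hw
    exact ⟨mem_image_of_mem _ hwB, _, mem_image_of_mem _ (mem_image_of_mem _ hx),
      (h.convergesBackward_iff hΦ hB hwB hx).2 hwx⟩

lemma exists_converges_of_mem (h : IsFoldBranch Y a b ρ J ε₀ ε₁ δ ε) (hε : ε ≠ 0)
    (hΦ : IsFlowBox Φ Y F) (hB : box ε₀ ε₁ δ ⊆ Φ.source)
    (hw : w ∈ foldStrip a b ρ J ε \ curvePoint a b '' J) :
    ∃ x ∈ J, ConvergesBackward F (Φ '' box ε₀ ε₁ δ) (Φ w) (Φ (curvePoint a b x)) ∧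
      ConvergesForward F (Φ '' box ε₀ ε₁ δ) (Φ w) (Φ (a x, b x, ρ x)) := by
  have hwB := h.foldStrip_subset_box hw.1
  obtain ⟨x, hx, ha, hb, hr, ht⟩ := (h.mem_foldStrip_sdiff_iff hε).1 hw
  refine ⟨x, hx, (h.convergesBackward_iff hΦ hB hwB hx).2 ⟨ha, hb, hr, ht.le⟩,
    (hΦ.convergesForward_iff hB hwB (h.sink_mem_box hx)).2 ⟨ha.symm, hb.symm, ?_⟩⟩
  rw [ha, hb]
  exact (h.pair x hx).scalarConverges hr ht

lemma exists_mem_converges (h : IsFoldBranch Y a b ρ J ε₀ ε₁ δ ε) (hε : ε ≠ 0)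
    (hΦ : IsFlowBox Φ Y F) (hB : box ε₀ ε₁ δ ⊆ Φ.source) (hx : x ∈ J) :
    ∃ w ∈ foldStrip a b ρ J ε \ curvePoint a b '' J,
      ConvergesBackward F (Φ '' box ε₀ ε₁ δ) (Φ w) (Φ (curvePoint a b x)) ∧
      ConvergesForward F (Φ '' box ε₀ ε₁ δ) (Φ w) (Φ (a x, b x, ρ x)) := by
  have hmid : (a x, b x, (x + ρ x) / 2) ∈ foldStrip a b ρ J ε \ curvePoint a b '' J := by
    have := (h.pair x hx).side
    refine (h.mem_foldStrip_sdiff_iff hε).2 ⟨x, hx, rfl, rfl, ?_, ?_⟩ <;> simp only <;> linarith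
  have hwB := h.foldStrip_subset_box hmid.1
  obtain ⟨x', hx', hsrc, htgt⟩ := h.exists_converges_of_mem hε hΦ hB hmid
  obtain rfl : x = x' := h.injOn hx hx' ((h.convergesBackward_iff hΦ hB hwB hx').1 hsrc).2.1
  exact ⟨_, hmid, hsrc, htgt⟩

lemma isHeteroclinicFamily (h : IsFoldBranch Y a b ρ J ε₀ ε₁ δ ε) (hε : ε ≠ 0)
    (hΦ : IsFlowBox Φ Y F) (hB : box ε₀ ε₁ δ ⊆ Φ.source) :
    IsHeteroclinicFamily (ConvergesBackward F (Φ '' box ε₀ ε₁ δ))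
      (ConvergesForward F (Φ '' box ε₀ ε₁ δ)) (Φ '' (foldStrip a b ρ J ε \ curvePoint a b '' J))
      (Φ '' (curvePoint a b '' J)) ((fun x => Φ (a x, b x, ρ x)) '' J) := by
  constructor
  · rintro _ ⟨w, hw, rfl⟩
    obtain ⟨x, hx, hsrc, htgt⟩ := h.exists_converges_of_mem hε hΦ hB hw
    refine ⟨_, mem_image_of_mem _ (mem_image_of_mem _ hx), _, mem_image_of_mem _ hx,
      fun heq => ?_, hsrc, htgt⟩
    have hxρ : x = ρ x := congrArg (fun w : R3 => w.2.2)
      (Φ.injOn (hB (h.curvePoint_mem_box hx)) (hB (h.sink_mem_box hx)) heq)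
    have := (h.pair x hx).side
    rw [← hxρ, sub_self, mul_zero] at this
    exact this.false
  · rintro _ ⟨_, ⟨x, hx, rfl⟩, rfl⟩
    obtain ⟨w, hw, hsrc, -⟩ := h.exists_mem_converges hε hΦ hB hx
    exact ⟨_, mem_image_of_mem _ hw, hsrc⟩

lemma targets_convergesForward (h : IsFoldBranch Y a b ρ J ε₀ ε₁ δ ε) (hε : ε ≠ 0)
    (hΦ : IsFlowBox Φ Y F) (hF : LocallyLipschitz F) (hB : box ε₀ ε₁ δ ⊆ Φ.source) :
    targets (ConvergesForward F (Φ '' box ε₀ ε₁ δ))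
      (Φ '' (foldStrip a b ρ J ε \ curvePoint a b '' J)) = (fun x => Φ (a x, b x, ρ x)) '' J := by
  apply Subset.antisymm
  · rintro q ⟨_, ⟨w, hw, rfl⟩, hconv⟩
    obtain ⟨x, hx, -, htgt⟩ := h.exists_converges_of_mem hε hΦ hB hw
    exact ⟨x, hx, htgt.unique hF hconv⟩
  · rintro _ ⟨x, hx, rfl⟩
    obtain ⟨w, hw, -, htgt⟩ := h.exists_mem_converges hε hΦ hB hx
    exact ⟨_, mem_image_of_mem _ hw, htgt⟩

end IsFoldBranch

end Branch

section CuspBoxBranches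

variable {a b ρ : ℝ → ℝ} {J : Set ℝ} {ε₀ ε₁ δ ε k t t₁ t₂ : ℝ} {Y : R3 → ℝ}

namespace IsCuspBox

lemma curvePoint_mem_box (h : IsCuspBox Y a b ρ k ε₀ ε₁ δ t₁ t₂) (ht : t ∈ Ioo t₁ t₂) :
    curvePoint a b t ∈ box ε₀ ε₁ δ :=
  have ht := h.curve_mem t ht
  ⟨ht.1, ht.2.1, ht.2.2.1⟩

lemma apply_curvePoint (h : IsCuspBox Y a b ρ k ε₀ ε₁ δ t₁ t₂) (ht : t ∈ Ioo t₁ t₂) :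
    Y (curvePoint a b t) = 0 := by
  rw [← sign_eq_zero_iff, curvePoint, h.sign_eq t ht t (h.curve_mem t ht).2.2.1]
  simp

lemma apply_sink (h : IsCuspBox Y a b ρ k ε₀ ε₁ δ t₁ t₂) (ht : t ∈ Ioo t₁ t₂) :
    Y (a t, b t, ρ t) = 0 := by
  rw [← sign_eq_zero_iff, h.sign_eq t ht _ (h.curve_mem t ht).2.2.2]
  simp

lemma isHalfStablePair (h : IsCuspBox Y a b ρ k ε₀ ε₁ δ t₁ t₂) (hY : ContDiff ℝ ∞ Y)
    (ht : t ∈ Ioo t₁ t₂) (hε : ε = 1 ∨ ε = -1) (hεt : 0 < ε * t) :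
    IsHalfStablePair (fun y => Y (a t, b t, y)) δ (ρ t) t ε where
  contDiff := (hY.of_le (by simp)).comp (by fun_prop)
  eq_one_or := hε
  abs_sink_lt := (h.curve_mem t ht).2.2.2
  abs_source_lt := (h.curve_mem t ht).2.2.1
  side := by
    have := h.mul_ρ_neg t ht (right_ne_zero_of_mul hεt.ne')
    rcases hε with rfl | rfl <;> nlinarith
  sink_eq_zero := h.apply_sink ht
  eq_zero := h.apply_curvePoint ht
  neg := fun τ hτ hne hr => by
    have hsq : 0 < (τ - t) ^ 2 := sq_pos_of_ne_zero (sub_ne_zero.2 hne)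
    have hsign := h.sign_eq t ht τ hτ
    rcases hε with rfl | rfl
    · rw [sign_neg (mul_neg_of_pos_of_neg hsq (by linarith)), sign_eq_neg_one_iff] at hsign
      linarith
    · rw [sign_pos (mul_pos hsq (by linarith)), sign_eq_one_iff] at hsign
      linarith

lemma isFoldBranch (h : IsCuspBox Y a b ρ k ε₀ ε₁ δ t₁ t₂) (hY : ContDiff ℝ ∞ Y)
    (hb : Differentiable ℝ b) (hJ : Convex ℝ J) (hJt : J ⊆ Ioo t₁ t₂) (hε : ε = 1 ∨ ε = -1)
    (hεJ : ∀ x ∈ J, 0 < ε * x) : IsFoldBranch Y a b ρ J ε₀ ε₁ δ ε where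
  injOn := injOn_of_mul_deriv_pos (k := ε * k) hb hJ fun x hx => by
    have hx0 : 0 < ε * x := hεJ x hx
    have := h.deriv_b_sign x (hJt hx) (right_ne_zero_of_mul hx0.ne')
    rcases hε with rfl | rfl <;> nlinarith
  abs_a_lt := fun x hx => (h.curve_mem x (hJt hx)).1
  abs_b_lt := fun x hx => (h.curve_mem x (hJt hx)).2.1
  pair := fun x hx => h.isHalfStablePair hY (hJt hx) hε (hεJ x hx)

end IsCuspBox

end CuspBoxBranches

section Arcs

variable {a b ρ : ℝ → ℝ} {k c : ℝ} {Y : R3 → ℝ} {Φ : OpenPartialHomeomorph R3 R3}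

lemma exists_isPlaneArc_comp (hΦ : ContDiff ℝ ∞ Φ) (hΦ0 : Φ 0 = 0)
    (hΦc : fderiv ℝ Φ 0 (0, 0, 1) = (0, 0, c)) (hc : 0 < c) {q : ℝ → R3} {v : ℝ}
    (hq : ContDiff ℝ ∞ q) (hq0 : q 0 = 0) (hq' : HasDerivAt q (0, 0, v) 0) (hv : 0 < v) :
    ∃ η > 0, ∀ t₁ t₂, -η < t₁ → t₁ < 0 → 0 < t₂ → t₂ < η →
      (∀ t ∈ Ioo t₁ t₂, (Φ (q t)).1 = 0) → ∃ θ α β, IsPlaneArc (fun t => Φ (q t)) t₁ t₂ θ α β := by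
  refine exists_isPlaneArc (hΦ.comp hq) (by rw [hq0, hΦ0]) (mul_pos hv hc) ?_
  have hd := (hΦ.differentiable (by simp) (q 0)).hasFDerivAt.comp_hasDerivAt (0 : ℝ) hq'
  refine hd.congr_deriv ?_
  have : ((0, 0, v) : R3) = v • (0, 0, 1) := by simp
  rw [hq0, this, map_smul, hΦc]
  simp

lemma IsFoldCurve.exists_isPlaneArc (h : IsFoldCurve Y a b ρ k) (hΦ : ContDiff ℝ ∞ Φ)
    (hΦ0 : Φ 0 = 0) (hΦc : fderiv ℝ Φ 0 (0, 0, 1) = (0, 0, c)) (hc : 0 < c) :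
    ∃ η > 0, ∀ t₁ t₂, -η < t₁ → t₁ < 0 → 0 < t₂ → t₂ < η →
      (∀ t ∈ Ioo t₁ t₂, (Φ (curvePoint a b t)).1 = 0) →
      ∃ ϑ α β, IsPlaneArc (fun t => Φ (curvePoint a b t)) t₁ t₂ ϑ α β := by
  refine exists_isPlaneArc_comp hΦ hΦ0 hΦc hc (contDiff_curvePoint h.smooth_a h.smooth_b)
    (curvePoint_zero h.a_zero h.b_zero) ?_ one_pos
  simpa only [h.deriv_a, h.deriv_b] using hasDerivAt_curvePoint
    (h.smooth_a.differentiable (by simp) 0) (h.smooth_b.differentiable (by simp) 0)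

-- The curve of sinks runs downwards, hence the reversal of its parameter.
lemma IsFoldCurve.exists_isPlaneArc_sink (h : IsFoldCurve Y a b ρ k) (hΦ : ContDiff ℝ ∞ Φ)
    (hΦ0 : Φ 0 = 0) (hΦc : fderiv ℝ Φ 0 (0, 0, 1) = (0, 0, c)) (hc : 0 < c) :
    ∃ η > 0, ∀ t₁ t₂, -η < t₁ → t₁ < 0 → 0 < t₂ → t₂ < η →
      (∀ t ∈ Ioo t₁ t₂, (Φ (a (-t), b (-t), ρ (-t))).1 = 0) →
      ∃ θ α β, IsPlaneArc (fun t => Φ (a (-t), b (-t), ρ (-t))) t₁ t₂ θ α β := by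
  have ha := h.smooth_a
  have hb := h.smooth_b
  have hρ := h.smooth_ρ
  refine exists_isPlaneArc_comp (q := fun t => (a (-t), b (-t), ρ (-t))) hΦ hΦ0 hΦc hc
    (by fun_prop) (by simp [h.a_zero, h.b_zero, h.ρ_zero]) ?_ (neg_pos.2 h.deriv_ρ)
  have hneg {g : ℝ → ℝ} (hg : ContDiff ℝ ∞ g) : HasDerivAt (fun t => g (-t)) (-deriv g 0) 0 := by
    have := ((hg.differentiable (by simp) (-0)).hasDerivAt).scomp (0 : ℝ) (hasDerivAt_neg 0)
    simpa [Function.comp_def] using this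
  simpa [h.deriv_a, h.deriv_b] using (hneg ha).prodMk ((hneg hb).prodMk (hneg hρ))

end Arcs

section LocalDynamics

variable {a b ρ ϑ θ : ℝ → ℝ} {J : Set ℝ} {ε₀ ε₁ δ ε k m c κ t₁ t₂ α β α' β' : ℝ} {Y : R3 → ℝ}
  {Φ : OpenPartialHomeomorph R3 R3} {F : R3 → R3} {T : Set R3}

lemma planeGraph_Ioo_union_zero_union (hα : α < 0) (hβ : 0 < β) (h0 : θ 0 = 0) :
    planeGraph θ (Ioo α 0) ∪ {0} ∪ planeGraph θ (Ioo 0 β) = planeGraph θ (Ioo α β) := by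
  have hzero : ({0} : Set R3) = planeGraph θ {0} := by
    rw [planeGraph, image_singleton, h0]
    rfl
  rw [hzero, planeGraph, planeGraph, planeGraph, ← image_union, ← image_union, planeGraph,
    Ioo_union_right hα, Ioc_union_Ioo_eq_Ioo hα.le hβ]

lemma image_comp_neg_Ioo (q : ℝ → R3) (s t : ℝ) :
    (fun x => q (-x)) '' Ioo s t = q '' Ioo (-t) (-s) := by
  rw [← image_neg_Ioo, image_image]

lemma IsFoldBranch.mul_fst_neg (h : IsFoldBranch Y a b ρ J ε₀ ε₁ δ ε) (hε : ε ≠ 0)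
    (hB : box ε₀ ε₁ δ ⊆ Φ.source) (hκ : κ ≠ 0) (hfst : ∀ w ∈ Φ.source, (Φ w).1 = κ * Y w)
    {p : R3} (hp : p ∈ Φ '' (foldStrip a b ρ J ε \ curvePoint a b '' J)) : κ * (ε * p.1) < 0 := by
  obtain ⟨w, hw, rfl⟩ := hp
  rw [hfst w (hB (h.foldStrip_subset_box hw.1))]
  nlinarith [mul_neg_of_pos_of_neg (sq_pos_of_ne_zero hκ) (h.mul_neg_of_mem_foldStrip_sdiff hε hw)]

namespace IsCuspBox

lemma exists_convergesForward (h : IsCuspBox Y a b ρ k ε₀ ε₁ δ t₁ t₂) (hY : ContDiff ℝ ∞ Y)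
    (hΦ : IsFlowBox Φ Y F) (hB : box ε₀ ε₁ δ ⊆ Φ.source)
    (hfst : ∀ w ∈ Φ.source, (Φ w).1 = κ * Y w) {p : R3} (hp : p ∈ Φ '' box ε₀ ε₁ δ) :
    ∃ y₁ y₂ : ℝ, (0, y₁, y₂) ∈ Φ '' box ε₀ ε₁ δ ∧
      ConvergesForward F (Φ '' box ε₀ ε₁ δ) p (0, y₁, y₂) := by
  obtain ⟨w, hw, rfl⟩ := hp
  obtain ⟨hin₁, hin₂⟩ := h.inward (w.1, w.2.1) hw.1 hw.2.1
  obtain ⟨L, hL, hL0, hconv⟩ := exists_scalarConverges (g := fun y => Y (w.1, w.2.1, y))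
    ((hY.of_le (by simp)).comp (by fun_prop)) hin₁ hin₂ hw.2.2
  have hq : (w.1, w.2.1, L) ∈ box ε₀ ε₁ δ := ⟨hw.1, hw.2.1, hL⟩
  have hΦq : Φ (w.1, w.2.1, L) =
      (0, (Φ (w.1, w.2.1, L)).2.1, (Φ (w.1, w.2.1, L)).2.2) :=
    Prod.ext ((hfst _ (hB hq)).trans (mul_eq_zero_of_right κ hL0)) rfl
  refine ⟨_, _, hΦq ▸ mem_image_of_mem Φ hq, ?_⟩
  rw [← hΦq]
  exact (hΦ.convergesForward_iff hB hw hq).2 ⟨rfl, rfl, hconv⟩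

lemma inter_image_box_eq (h : IsCuspBox Y a b ρ k ε₀ ε₁ δ t₁ t₂)
    (hB : box ε₀ ε₁ δ ⊆ Φ.source)
    (hT : ∀ w ∈ Φ.source, Φ w ∈ T ↔ Y w = 0 ∧ dτ Y w = 0) :
    T ∩ Φ '' box ε₀ ε₁ δ = (fun t => Φ (curvePoint a b t)) '' Ioo t₁ t₂ := by
  apply Subset.antisymm
  · rintro _ ⟨hp, w, hw, rfl⟩
    obtain ⟨t, ht, rfl⟩ := (h.doubleZero_iff w hw).1 ((hT w (hB hw)).1 hp)
    exact ⟨t, ht, rfl⟩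
  · rintro _ ⟨t, ht, rfl⟩
    have hw := h.curvePoint_mem_box ht
    exact ⟨(hT _ (hB hw)).2 ((h.doubleZero_iff _ hw).2 ⟨t, ht, rfl⟩), mem_image_of_mem Φ hw⟩

lemma branch_dynamics (h : IsCuspBox Y a b ρ k ε₀ ε₁ δ t₁ t₂) (hfold : IsFoldCurve Y a b ρ k)
    (hY : ContDiff ℝ ∞ Y) (hΦ : IsFlowBox Φ Y F) (hF : LocallyLipschitz F)
    (hB : box ε₀ ε₁ δ ⊆ Φ.source) (hκ : κ ≠ 0) (hfst : ∀ w ∈ Φ.source, (Φ w).1 = κ * Y w)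
    (hJ : IsOpen J) (hJc : Convex ℝ J) (hJt : J ⊆ Ioo t₁ t₂) (hε : ε = 1 ∨ ε = -1)
    (hεJ : ∀ x ∈ J, 0 < ε * x) {γ W σ : Set R3} (hγ : γ = Φ '' (curvePoint a b '' J))
    (hW : W = Φ '' foldStrip a b ρ J ε) (hσ : σ = (fun x => Φ (a x, b x, ρ x)) '' J) :
    W = limitSet (ConvergesBackward F (Φ '' box ε₀ ε₁ δ)) (Φ '' box ε₀ ε₁ δ) γ ∧
      IsSmoothSurfaceWithBoundary W γ ∧
      IsHeteroclinicFamily (ConvergesBackward F (Φ '' box ε₀ ε₁ δ))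
        (ConvergesForward F (Φ '' box ε₀ ε₁ δ)) (W \ γ) γ σ ∧
      (∀ p ∈ W \ γ, κ * (ε * p.1) < 0) ∧
      σ = targets (ConvergesForward F (Φ '' box ε₀ ε₁ δ)) (W \ γ) := by
  have hb := hfold.smooth_b
  have hε0 : ε ≠ 0 := by rcases hε with rfl | rfl <;> norm_num
  have hbr := h.isFoldBranch hY (hb.differentiable (by simp)) hJc hJt hε hεJ
  have hsdiff : W \ γ = Φ '' (foldStrip a b ρ J ε \ curvePoint a b '' J) := by
    rw [hW, hγ]
    exact ((Φ.injOn.mono (hbr.foldStrip_subset_box.trans hB)).image_sdiff_subset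
      hbr.image_curvePoint_subset_foldStrip).symm
  have hsurf := hbr.isSmoothSurfaceWithBoundary_foldStrip hε0 hfold.smooth_a hb hfold.smooth_ρ hJ
    fun x hx => right_ne_zero_of_mul
      (h.deriv_b_sign x (hJt hx) (right_ne_zero_of_mul (hεJ x hx).ne')).ne'
  rw [hsdiff, hγ, hW, hσ]
  exact ⟨(hbr.limitSet_convergesBackward hΦ hB).symm,
    hsurf.image hΦ.smooth.contDiffOn hΦ.smooth_symm (hbr.foldStrip_subset_box.trans hB),
    hbr.isHeteroclinicFamily hε0 hΦ hB, fun p hp => hbr.mul_fst_neg hε0 hB hκ hfst hp,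
    (hbr.targets_convergesForward hε0 hΦ hF hB).symm⟩

lemma localDynamics (h : IsCuspBox Y a b ρ k ε₀ ε₁ δ t₁ t₂) (hfold : IsFoldCurve Y a b ρ k)
    (hY : ContDiff ℝ ∞ Y) (hΦ : IsFlowBox Φ Y F) (hF : LocallyLipschitz F)
    (hB : box ε₀ ε₁ δ ⊆ Φ.source) (hκ : κ ≠ 0) (hfst : ∀ w ∈ Φ.source, (Φ w).1 = κ * Y w)
    (hT : ∀ w ∈ Φ.source, Φ w ∈ T ↔ Y w = 0 ∧ dτ Y w = 0)
    (hϑ : IsPlaneArc (fun t => Φ (curvePoint a b t)) t₁ t₂ ϑ α β)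
    (hθ : IsPlaneArc (fun t => Φ (a (-t), b (-t), ρ (-t))) (-t₂) (-t₁) θ α' β') :
    LocalDynamics (Φ '' box ε₀ ε₁ δ) T (ConvergesBackward F (Φ '' box ε₀ ε₁ δ))
      (ConvergesForward F (Φ '' box ε₀ ε₁ δ)) := by
  obtain ⟨hW₁, hsurf₁, hhet₁, hside₁, htgt₁⟩ := h.branch_dynamics hfold hY hΦ hF hB hκ hfst
    isOpen_Ioo (convex_Ioo 0 t₂) (Ioo_subset_Ioo_left h.t₁_neg.le) (.inl rfl)
    (fun x hx => by linarith [hx.1]) rfl rfl rfl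
  obtain ⟨hW₂, hsurf₂, hhet₂, hside₂, htgt₂⟩ := h.branch_dynamics hfold hY hΦ hF hB hκ hfst
    isOpen_Ioo (convex_Ioo t₁ 0) (Ioo_subset_Ioo_right h.t₂_pos.le) (.inr rfl)
    (fun x hx => by linarith [hx.2]) rfl rfl rfl
  have hσ₁ : (fun x => Φ (a x, b x, ρ x)) '' Ioo 0 t₂ = planeGraph θ (Ioo α' 0) := by
    simpa only [image_comp_neg_Ioo fun x => Φ (a x, b x, ρ x), neg_neg, neg_zero]
      using hθ.image_neg_eq
  have hσ₂ : (fun x => Φ (a x, b x, ρ x)) '' Ioo t₁ 0 = planeGraph θ (Ioo 0 β') := by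
    simpa only [image_comp_neg_Ioo fun x => Φ (a x, b x, ρ x), neg_neg, neg_zero]
      using hθ.image_pos_eq
  refine ⟨fun p hp => h.exists_convergesForward hY hΦ hB hfst hp, ϑ, θ, α, β, α', β', _, _, _, _,
    _, _, hϑ.α_neg, hϑ.β_pos, hϑ.contDiffOn, hϑ.zero, ?_, ?_, ?_, hW₁, hW₂, hsurf₁, hsurf₂, hhet₁,
    hhet₂, ?_, htgt₁, htgt₂, hθ.α_neg, hθ.β_pos, hθ.contDiffOn, hθ.zero, hσ₁, hσ₂, ?_, ?_⟩
  · rw [h.inter_image_box_eq hB hT, hϑ.image_eq]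
  · rw [image_image, hϑ.image_pos_eq]
  · rw [image_image, hϑ.image_neg_eq]
  · rcases hκ.lt_or_gt with hκ | hκ
    · exact .inl ⟨fun p hp => by nlinarith [hside₁ p hp], fun p hp => by nlinarith [hside₂ p hp]⟩
    · exact .inr ⟨fun p hp => by nlinarith [hside₁ p hp], fun p hp => by nlinarith [hside₂ p hp]⟩
  · rw [hσ₁, hσ₂, planeGraph_Ioo_union_zero_union hθ.α_neg hθ.β_pos hθ.zero]
  · rw [hθ.deriv_zero, hϑ.deriv_zero]

end IsCuspBox

end LocalDynamics

section Conclusion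

variable {m c κ a : ℝ} {X Y μ r : R3 → ℝ} {N : ℕ} {Φ H : OpenPartialHomeomorph R3 R3} {F : R3 → R3}
  {T O B : Set R3}

lemma IsFlowBox.exists_localDynamics (hΦ : IsFlowBox Φ Y F) (hY : IsCuspUnfolding Y m)
    (hm : m < 0) (hF : LocallyLipschitz F) (hc : 0 < c)
    (hΦc : fderiv ℝ Φ 0 (0, 0, 1) = (0, 0, c)) (hκ : κ ≠ 0)
    (hfst : ∀ w ∈ Φ.source, (Φ w).1 = κ * Y w)
    (hT : ∀ w ∈ Φ.source, Φ w ∈ T ↔ Y w = 0 ∧ dτ Y w = 0) (hO : O ∈ 𝓝 (0 : R3)) :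
    ∃ B : Set R3, IsOpen B ∧ 0 ∈ B ∧ B ⊆ O ∧ B ⊆ Φ.source ∧
      LocalDynamics (Φ '' B) T (ConvergesBackward F (Φ '' B)) (ConvergesForward F (Φ '' B)) := by
  obtain ⟨a, b, ρ, k, hk, hfold⟩ := hY.exists_isFoldCurve hm
  obtain ⟨η₁, hη₁, harc₁⟩ := hfold.exists_isPlaneArc hΦ.smooth hΦ.map_zero hΦc hc
  obtain ⟨η₂, hη₂, harc₂⟩ := hfold.exists_isPlaneArc_sink hΦ.smooth hΦ.map_zero hΦc hc
  obtain ⟨ε₀, ε₁, δ, t₁, t₂, hbox, hBO, ht₁, ht₂⟩ := hfold.exists_isCuspBox hk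
    hY.smooth.continuous (lt_min hη₁ hη₂) (inter_mem hO (Φ.open_source.mem_nhds hΦ.zero_mem))
  obtain ⟨hBO, hB⟩ := subset_inter_iff.1 hBO
  have hmem := fun t ht => hbox.curve_mem t ht
  have hmin₁ := min_le_left η₁ η₂
  have hmin₂ := min_le_right η₁ η₂
  obtain ⟨ϑ, α, β, hϑ⟩ := harc₁ t₁ t₂ (by linarith) hbox.t₁_neg hbox.t₂_pos (by linarith)
    fun t ht => by
      rw [hfst _ (hB (hbox.curvePoint_mem_box ht)), hbox.apply_curvePoint ht, mul_zero]
  obtain ⟨θ, α', β', hθ⟩ := harc₂ (-t₂) (-t₁) (by linarith) (neg_lt_zero.2 hbox.t₂_pos)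
    (neg_pos.2 hbox.t₁_neg) (by linarith) fun t ht => by
      have ht : -t ∈ Ioo t₁ t₂ := ⟨lt_neg.1 ht.2, neg_lt.1 ht.1⟩
      have hw : (a (-t), b (-t), ρ (-t)) ∈ box ε₀ ε₁ δ :=
        ⟨(hmem _ ht).1, (hmem _ ht).2.1, (hmem _ ht).2.2.2⟩
      rw [hfst _ (hB hw), hbox.apply_sink ht, mul_zero]
  refine ⟨box ε₀ ε₁ δ, isOpen_box _ _ _, ?_, hBO, hB,
    hbox.localDynamics hfold hY.smooth hΦ hF hB hκ hfst hT hϑ hθ⟩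
  simp [box, hbox.ε₀_pos, hbox.ε₁_pos, hbox.δ_pos]

lemma IsFlowBox.exists_localDynamics_of_ne_zero (hΦ : IsFlowBox Φ (fun w => (Φ w).1) F)
    (hX : IsCuspUnfolding (fun w => (Φ w).1) m) (hm : m ≠ 0) (hF : LocallyLipschitz F) (hc : 0 < c)
    (hΦc : fderiv ℝ Φ 0 (0, 0, 1) = (0, 0, c))
    (hT : ∀ w ∈ Φ.source, Φ w ∈ T ↔ (Φ w).1 = 0 ∧ dτ (fun w => (Φ w).1) w = 0)
    (hO : O ∈ 𝓝 (0 : R3)) :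
    ∃ B : Set R3, IsOpen B ∧ 0 ∈ B ∧ B ⊆ O ∧ B ⊆ Φ.source ∧
      (m < 0 → LocalDynamics (Φ '' B) T (ConvergesBackward F (Φ '' B))
        (ConvergesForward F (Φ '' B))) ∧
      (0 < m → LocalDynamics (Φ '' B) T (ConvergesForward F (Φ '' B))
        (ConvergesBackward F (Φ '' B))) := by
  rcases hm.lt_or_gt with hm | hm
  · obtain ⟨B, hB, h0, hBO, hBΦ, hdyn⟩ := hΦ.exists_localDynamics hX hm hF hc hΦc one_ne_zero
      (fun w _ => (one_mul _).symm) hT hO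
    exact ⟨B, hB, h0, hBO, hBΦ, fun _ => hdyn, fun hm' => absurd hm' hm.not_gt⟩
  · have hT' : ∀ w ∈ Φ.source, Φ w ∈ T ↔ -(Φ w).1 = 0 ∧ dτ (fun w => -(Φ w).1) w = 0 :=
      fun w hw => by simp only [hT w hw, dirDeriv_neg, neg_eq_zero]
    obtain ⟨B, hB, h0, hBO, hBΦ, hdyn⟩ := hΦ.neg.exists_localDynamics hX.neg (neg_neg_of_pos hm)
      hF.neg hc hΦc (neg_ne_zero.2 one_ne_zero) (fun w _ => by ring) hT' hO
    have hfwd : ConvergesForward (fun p => -F p) (Φ '' B) = ConvergesBackward F (Φ '' B) :=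
      funext₂ fun _ _ => propext convergesForward_neg_iff
    have hbwd : ConvergesBackward (fun p => -F p) (Φ '' B) = ConvergesForward F (Φ '' B) :=
      funext₂ fun _ _ => propext convergesBackward_neg_iff
    rw [hfwd, hbwd] at hdyn
    exact ⟨B, hB, h0, hBO, hBΦ, fun hm' => absurd hm' hm.not_gt, fun _ => hdyn⟩

lemma div_sign_pos {x : ℝ} (hx : x ≠ 0) : 0 < x / Real.sign x := by
  rcases hx.lt_or_gt with hx | hx
  · rw [Real.sign_of_neg hx]
    linarith
  · rwa [Real.sign_of_pos hx, div_one]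

lemma IsFlowBox.fderiv_comp_symm_apply (hΦ : IsFlowBox Φ X F) (hH : IsCuspChart X a N H μ r)
    {w : R3} (hw : w ∈ Φ.source) (hwH : w ∈ H.source) :
    fderiv ℝ (H ∘ Φ.symm) (Φ w) (F (Φ w)) = μ w • cuspField a r (H w) := by
  have hdH : DifferentiableAt ℝ H (Φ.symm (Φ w)) := by
    rw [Φ.left_inv hw]
    exact (hH.smooth.contDiffAt (H.open_source.mem_nhds hwH)).differentiableAt (by simp)
  have hdΦ : DifferentiableAt ℝ Φ.symm (Φ w) := (hΦ.smooth_symm.contDiffAt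
    (Φ.open_target.mem_nhds (Φ.map_source hw))).differentiableAt (by simp)
  rw [fderiv_comp _ hdH hdΦ, ContinuousLinearMap.comp_apply, hΦ.fderiv_symm_apply hw,
    Φ.left_inv hw, hH.fderiv_apply w hwH]

lemma IsFlowBox.flowEquivalentOn (hΦ : IsFlowBox Φ X F) (hH : IsCuspChart X a N H μ r)
    (hB : IsOpen B) (h0 : (0 : R3) ∈ B) (hBH : B ⊆ H.source) (hBΦ : B ⊆ Φ.source) :
    FlowEquivalentOn F (Φ '' B) (cuspField a r) (H '' B) := by
  have hmem : ∀ w ∈ B, Φ.symm (Φ w) = w := fun w hw => Φ.left_inv (hBΦ hw)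
  have hsymm : MapsTo Φ.symm (Φ '' B) B := by
    rintro _ ⟨w, hw, rfl⟩
    rwa [hmem w hw]
  have hUt : Φ '' B ⊆ Φ.target := image_subset_iff.2 fun w hw => Φ.map_source (hBΦ hw)
  have hVt : H '' B ⊆ H.target := image_subset_iff.2 fun w hw => H.map_source (hBH hw)
  let E := (Φ.symm.trans H).restrOpen (Φ '' B) (Φ.isOpen_image_of_subset_source hB hBΦ)
  have hEs : E.source = Φ '' B := inter_eq_right.2 fun p hp => ⟨hUt hp, hBH (hsymm hp)⟩
  have hEt : E.target = H '' B := by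
    rw [← E.image_source_eq_target, hEs, image_image]
    exact image_congr fun w hw => congrArg H (hmem w hw)
  refine ⟨E, hEs, hEt, ?_, (hH.smooth.mono hBH).comp (hΦ.smooth_symm.mono hUt) hsymm,
    hΦ.smooth.comp_contDiffOn (hH.smooth_symm.mono hVt), μ ∘ Φ.symm,
    (hH.smooth_factor.mono hBH).comp (hΦ.smooth_symm.mono hUt) hsymm,
    fun p hp => hH.factor_pos _ (hBH (hsymm hp)), ?_⟩
  · have hsymm0 : Φ.symm 0 = 0 := by simpa only [hΦ.map_zero] using hmem 0 h0
    exact (congrArg H hsymm0).trans hH.map_zero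
  · rintro _ ⟨w, hw, rfl⟩
    have hE : E (Φ w) = H w := congrArg H (hmem w hw)
    rw [hE, Function.comp_apply, hmem w hw]
    exact hΦ.fderiv_comp_symm_apply hH (hBΦ hw) (hBH hw)

end Conclusion

end DriftSing

open DriftSing in
theorem mainTheorem1_general (f g₁ g₂ : R3 → ℝ)
    (hf : ContDiff ℝ ∞ f) (hg₁ : ContDiff ℝ ∞ g₁) (hg₂ : ContDiff ℝ ∞ g₂)
    (h_i : ∀ y₁ y₂ : ℝ, field f g₁ g₂ (0, y₁, y₂) = 0)
    (h_ii : dx f 0 = 0)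
    (h_iii : dy₁ (dx f) 0 ≠ 0 ∧ dy₂ (dx f) 0 = 0)
    (h_iv : dx g₁ 0 = 0)
    (h_v : kappa f g₁ g₂ ≠ 0)
    (h_vi : 0 < dx g₂ 0)
    (N : ℕ) (O : Set R3) (hO : O ∈ 𝓝 (0 : R3)) :
    ∃ U : Set R3, IsOpen U ∧ (0 : R3) ∈ U ∧ U ⊆ O ∧
      (∃ (V : Set R3) (r : R3 → ℝ) (C : ℝ), ContDiffOn ℝ ∞ r V ∧
        (∀ z ∈ V, |r z| ≤ C * |z.2.2| ^ N) ∧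
        FlowEquivalentOn (field f g₁ g₂) U (cuspField (Real.sign (kappa f g₁ g₂)) r) V) ∧
      (kappa f g₁ g₂ < 0 →
        LocalDynamics U {p | p.1 = 0 ∧ dx f p = 0}
          (ConvergesBackward (field f g₁ g₂) U) (ConvergesForward (field f g₁ g₂) U)) ∧
      (0 < kappa f g₁ g₂ →
        LocalDynamics U {p | p.1 = 0 ∧ dx f p = 0}
          (ConvergesForward (field f g₁ g₂) U) (ConvergesBackward (field f g₁ g₂) U)) := by
  obtain ⟨Φ, hΦ, hX, hdτ, hΦc⟩ := exists_flowBox hf hg₁ hg₂ h_i h_ii h_iii h_iv h_vi.ne'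
  have hsign : 0 < dx g₂ 0 * kappa f g₁ g₂ / Real.sign (kappa f g₁ g₂) := by
    rw [mul_div_assoc]
    exact mul_pos h_vi (div_sign_pos h_v)
  obtain ⟨H, μ, r, hH⟩ := exists_isCuspChart hX hsign N
  have hF : LocallyLipschitz (field f g₁ g₂) :=
    ((hf.prodMk (hg₁.prodMk hg₂)).of_le (by simp)).locallyLipschitz
  have hT : ∀ w ∈ Φ.source, Φ w ∈ {p | p.1 = 0 ∧ dx f p = 0} ↔
      (Φ w).1 = 0 ∧ dτ (fun w => (Φ w).1) w = 0 := fun w hw =>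
    and_congr_right fun hw0 => by rw [hdτ w hw hw0]
  have hO' : H.source ∩ Φ ⁻¹' O ∈ 𝓝 (0 : R3) := inter_mem (H.open_source.mem_nhds hH.zero_mem)
    (hΦ.smooth.continuous.continuousAt.preimage_mem_nhds (by rwa [hΦ.map_zero]))
  obtain ⟨B, hB, h0, hBO, hBΦ, hneg, hpos⟩ := hΦ.exists_localDynamics_of_ne_zero hX
    (mul_ne_zero h_vi.ne' h_v) hF h_vi hΦc hT hO'
  obtain ⟨hBH, hBO⟩ := subset_inter_iff.1 hBO
  have hVt : H '' B ⊆ H.target := image_subset_iff.2 fun w hw => H.map_source (hBH hw)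
  exact ⟨Φ '' B, Φ.isOpen_image_of_subset_source hB hBΦ, ⟨0, h0, hΦ.map_zero⟩,
    image_subset_iff.2 hBO,
    ⟨H '' B, r, 1, hH.smooth_remainder.mono hVt,
      fun z hz => by simpa only [one_mul] using hH.abs_remainder_le z (hVt hz),
      hΦ.flowEquivalentOn hH hB h0 hBH hBΦ⟩,
    fun hκ => hneg (mul_neg_of_pos_of_neg h_vi hκ), fun hκ => hpos (mul_pos h_vi hκ)⟩

open DriftSing in
theorem mainTheorem1 (f g₁ g₂ : R3 → ℝ)
    (hf : ContDiff ℝ ∞ f) (hg₁ : ContDiff ℝ ∞ g₁) (hg₂ : ContDiff ℝ ∞ g₂)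
    (h_i : ∀ y₁ y₂ : ℝ, field f g₁ g₂ (0, y₁, y₂) = 0)
    (h_ii : dx f 0 = 0)
    (h_iii : 0 < dy₁ (dx f) 0 ∧ dy₂ (dx f) 0 = 0)
    (h_iv : dx g₁ 0 = 0)
    (h_v : kappa f g₁ g₂ ≠ 0)
    (h_vi : 0 < dx g₂ 0)
    (N : ℕ) (O : Set R3) (hO : O ∈ 𝓝 (0 : R3)) :
    ∃ U : Set R3, IsOpen U ∧ (0 : R3) ∈ U ∧ U ⊆ O ∧
      (∃ (V : Set R3) (r : R3 → ℝ) (C : ℝ), ContDiffOn ℝ ∞ r V ∧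
        (∀ z ∈ V, |r z| ≤ C * |z.2.2| ^ N) ∧
        FlowEquivalentOn (field f g₁ g₂) U (cuspField (Real.sign (kappa f g₁ g₂)) r) V) ∧
      (kappa f g₁ g₂ < 0 →
        LocalDynamics U {p | p.1 = 0 ∧ dx f p = 0}
          (ConvergesBackward (field f g₁ g₂) U) (ConvergesForward (field f g₁ g₂) U)) ∧
      (0 < kappa f g₁ g₂ →
        LocalDynamics U {p | p.1 = 0 ∧ dx f p = 0}
          (ConvergesForward (field f g₁ g₂) U) (ConvergesBackward (field f g₁ g₂) U)) :=
  mainTheorem1_general f g₁ g₂ hf hg₁ hg₂ h_i h_ii ⟨h_iii.1.ne', h_iii.2⟩ h_iv h_v h_vi N O hO
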